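/- \textbf{Conventions.} For an inverse semigroup $S$ with $0$, $E(S)$ is its set of idempotents with the natural partial order ($e\le f$ iff $ef=e$), $\mathcal D$ is Green's relation, $[s]$ is the $\mathcal D$-class of $s$ (with $0$ also denoting the class $[0]$), and $f\ll e$ means that $f<e$ are idempotents with no idempotent strictly between. The category $C(S)$ has the elements of $E(S)$ as objects and the triples $(e,s,f)$ with $s\in eSf$ as morphisms, composed by $(e,s,f)(f,t,g)=(e,st,g)$; $S$ and $T$ are \emph{Morita equivalent} if $C(S)$ and $C(T)$ are equivalent categories. \textbf{Inverse hulls.} Let $A$ be a finite alphabet and $M$ a $\{0,1\}$-matrix indexed by $A$ with a nonzero entry in each row. Let $L_M$ be the set of nonempty words $a_1\cdots a_n$ over $A$ with $M_{a_i,a_{i+1}}=1$ for all $i<n$, and for $a\in A$ let $\theta_a$ be the partial bijection $w\mapsto aw$ of $L_M$ with domain $\{w\in L_M: aw\in L_M\}$. The \emph{inverse hull of the Markov shift} is the inverse semigroup $S=H(M)$ of partial bijections of $L_M$ generated by the $\theta_a$ and $0$. Put $\mathcal O=\{\theta_a\theta_a^{-1}:a\in A\}$ and $\mathcal O^\uparrow=\{e\in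 E(S): e\ge o\text{ for some }o\in\mathcal O\}$. Each $\mathcal D$-class $a$ of $S$ contains exactly one element $e_a$ of $(\mathcal O^\uparrow-\mathcal O)\cup\{0\}$. \textbf{The order $\preceq$.} For $e\in E(S)$ the \emph{core} $C_e$ is the smallest set $C$ of idempotents below $e$ such that: $e\in C$; if $f,g\in C$ and $fg\ne0$ then $fg\in C$; if $h_1,h_2\in C$, $f\ll h_1$, $g\ll h_2$, $f$ and $g$ are incomparable and $fg\neq 0$, then $f,g\in C$; and if $e_1,e_2\in C$ and $e_1<g<e_2$ then $g\in C$. Write $a\preceq' b$ if there are $e\in E(S)$ and $f,g\in C_e$ with $[f]=a$, $[g]=b$, $f\le g$; let $\preceq$ be the transitive closure of $\preceq'$ together with the relations $0\preceq a$ for all $a\in S/\mathcal D$. Then $(S/\mathcal D,\preceq)$ is a meet semilattice. \textbf{Combinatorial data.} Let $p_{u,v}=e_{u\wedge v}$ for $u,v\in S/\mathcal D$. The inverse semigroup $S^{\preceq}$ consists of the classes $[u,s,v]$ of triples with $u,v\in S/\mathcal D$, $s\in S$, $ss^{*}\le p_{u,u}$, $s^*s\le p_{v,v}$, where $(u,s,v)$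 and $(w,t,z)$ are identified iff $s=p_{u,w}\,t\,p_{z,v}$ and $t=p_{w,u}\,s\,p_{v,z}$, with product $[u,s,v][w,t,z]=[u,s\,p_{v,w}\,t,z]$. Call $(b,f)$ a \emph{label} of $S$ if $b\in S/\mathcal D$ is nonzero, $0\ne f\ll e_b$, and either $f\ne e_{[f]}$ or $[f]\not\preceq b$. The \emph{combinatorial data} $CD(S^{\preceq})$ is the subsemigroup \[\{[a,e_a,a]: a\in S/\mathcal D\}\cup\{[b,f,b]:(b,f)\text{ a label of }S\}\] of $S^{\preceq}$. An isomorphism $\pi:CD(S^\preceq)\to CD(T^\preceq)$ is \emph{$\mathcal D$-class preserving} if, for all $x,y\in CD(S^{\preceq})$, $x$ and $y$ are $\mathcal D$-related in $S^\preceq$ if and only if $\pi(x)$ and $\pi(y)$ are $\mathcal D$-related in $T^\preceq$. \textbf{Labelled graph.} The labelled graph of $S$ has the nonzero $\mathcal D$-classes of $S$ as vertices, the labels $(a,f)$ of $S$ as alphabet, and an edge $x_{a,f,b}$ with range $a$, source $b$ and label $(a,f)$ for each label $(a,f)$ and each nonzero $b\preceq[f]$. An isomorphism of labelled graphs is a triple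 of bijections between vertices, edges and alphabets that is compatible with sources, ranges and labels. \textbf{Theorem.} Let $S$ and $T$ be inverse hulls of Markov shifts. The following are equivalent: \begin{enumerate} \item $S$ and $T$ are Morita equivalent. \item There is a $\mathcal D$-class preserving isomorphism $\pi: CD(S^{\preceq})\to CD(T^{\preceq})$. \item There is an isomorphism from the labelled graph of $S$ to the labelled graph of $T$ whose map on vertices is an order isomorphism for $\preceq$. \end{enumerate} -/

import Mathlib

open CategoryTheory

namespace MarkovMorita

/-! ### Inverse semigroups -/

/-- An inverse semigroup: every `s` has exactly one `t` with `sts = s` and `tst = t`. -/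
class InverseSemigroup (S : Type*) extends Semigroup S, Inv S where
  mul_inv_mul (s : S) : s * s⁻¹ * s = s
  inv_mul_inv (s : S) : s⁻¹ * s * s⁻¹ = s⁻¹
  inv_unique (s t : S) : s * t * s = s → t * s * t = t → t = s⁻¹

/-- An inverse semigroup with a zero element. -/
class InverseSemigroupWithZero (S : Type*) extends InverseSemigroup S, SemigroupWithZero S

section Idempotents

/-- The natural partial order on idempotents: `e ≤ f` means `ef = e = fe`. -/
def IdemLE {S : Type*} [Mul S] (e f : S) : Prop := e * f = e ∧ f * e = e

variable {S : Type*} [InverseSemigroup S]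

theorem inv_inv_eq (s : S) : s = (s⁻¹)⁻¹ :=
  InverseSemigroup.inv_unique _ _ (InverseSemigroup.inv_mul_inv s) (InverseSemigroup.mul_inv_mul s)

theorem idem_eq_inv {e : S} (he : e * e = e) : e = e⁻¹ :=
  InverseSemigroup.inv_unique _ _ (by rw [he, he]) (by rw [he, he])

theorem idem_mul_idem {e f : S} (he : e * e = e) (hf : f * f = f) : e * f * (e * f) = e * f := by
  have h1 := InverseSemigroup.mul_inv_mul (e * f)
  have h2 := InverseSemigroup.inv_mul_inv (e * f)
  generalize hx : (e * f)⁻¹ = x at h1 h2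
  have h3 : f * x * e = (e * f)⁻¹ := by
    apply InverseSemigroup.inv_unique
    · calc e * f * (f * x * e) * (e * f) = e * (f * f) * x * ((e * e) * f) := by
            simp only [mul_assoc]
        _ = e * f := by rw [hf, he, h1]
    · calc f * x * e * (e * f) * (f * x * e) = f * (x * ((e * e) * (f * f)) * x) * e := by
            simp only [mul_assoc]
        _ = f * x * e := by rw [hf, he, h2]
  rw [hx] at h3
  have h4 : x * x = x := by
    calc x * x = f * x * e * (f * x * e) := by rw [h3]
      _ = f * (x * (e * f) * x) * e := by simp only [mul_assoc]
      _ = x := by rw [h2, h3]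
  have h5 : e * f = x := by
    rw [inv_inv_eq (e * f), hx, ← idem_eq_inv h4]
  rw [h5, h4]

theorem idem_comm {e f : S} (he : e * e = e) (hf : f * f = f) : e * f = f * e := by
  have h1 := idem_mul_idem he hf
  have h2 := idem_mul_idem hf he
  have h3 : f * e = (e * f)⁻¹ := by
    apply InverseSemigroup.inv_unique
    · calc e * f * (f * e) * (e * f) = e * (f * f) * ((e * e) * f) := by simp only [mul_assoc]
        _ = e * f := by rw [hf, he, h1]
    · calc f * e * (e * f) * (f * e) = f * (e * e) * ((f * f) * e) := by simp only [mul_assoc]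
        _ = f * e := by rw [hf, he, h2]
  rw [h3, ← idem_eq_inv h1]

theorem mul_inv_idem (s : S) : s * s⁻¹ * (s * s⁻¹) = s * s⁻¹ := by
  rw [← mul_assoc, InverseSemigroup.mul_inv_mul]

theorem inv_mul_idem (s : S) : s⁻¹ * s * (s⁻¹ * s) = s⁻¹ * s := by
  rw [← mul_assoc, InverseSemigroup.inv_mul_inv]

theorem idemLE_mul_right {s x p : S} (h : IdemLE (s * s⁻¹) p) :
    IdemLE (s * x * (s * x)⁻¹) p := by
  have hs : p * s = s := by
    calc p * s = p * (s * s⁻¹) * s := by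
          rw [mul_assoc, InverseSemigroup.mul_inv_mul]
      _ = s := by rw [h.2, InverseSemigroup.mul_inv_mul]
  have hr : s * s⁻¹ * (s * x * (s * x)⁻¹) = s * x * (s * x)⁻¹ := by
    rw [← mul_assoc, ← mul_assoc, InverseSemigroup.mul_inv_mul]
  refine ⟨?_, by rw [← mul_assoc, ← mul_assoc, hs]⟩
  rw [← hr, idem_comm (mul_inv_idem s) (mul_inv_idem (s * x)), mul_assoc, h.1]

theorem idemLE_mul_left {t x p : S} (h : IdemLE (t⁻¹ * t) p) :
    IdemLE ((x * t)⁻¹ * (x * t)) p := by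
  have ht : t * p = t := by
    calc t * p = t * ((t⁻¹ * t) * p) := by
          rw [← mul_assoc, ← mul_assoc, InverseSemigroup.mul_inv_mul]
      _ = t := by rw [h.1, ← mul_assoc, InverseSemigroup.mul_inv_mul]
  have hr : (x * t)⁻¹ * (x * t) * (t⁻¹ * t) = (x * t)⁻¹ * (x * t) := by
    rw [mul_assoc, mul_assoc x, ← mul_assoc t, InverseSemigroup.mul_inv_mul]
  refine ⟨by rw [mul_assoc, mul_assoc x, ht], ?_⟩
  rw [← hr, idem_comm (inv_mul_idem (x * t)) (inv_mul_idem t), ← mul_assoc, h.2]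

end Idempotents

/-! ### Green's relations -/

section Green

variable {S : Type*} [Semigroup S]

/-- Green's relation `L`: `S¹s = S¹t`. -/
def GreenL (s t : S) : Prop := s = t ∨ ((∃ x, s = x * t) ∧ ∃ y, t = y * s)

/-- Green's relation `R`: `sS¹ = tS¹`. -/
def GreenR (s t : S) : Prop := s = t ∨ ((∃ x, s = t * x) ∧ ∃ y, t = s * y)

/-- Green's relation `D`, the composite of `L` and `R`. -/
def GreenD (s t : S) : Prop := ∃ z, GreenL s z ∧ GreenR z t

theorem GreenL.symm {s t : S} (h : GreenL s t) : GreenL t s := by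
  rcases h with h | ⟨h1, h2⟩
  · exact Or.inl h.symm
  · exact Or.inr ⟨h2, h1⟩

theorem GreenR.symm {s t : S} (h : GreenR s t) : GreenR t s := by
  rcases h with h | ⟨h1, h2⟩
  · exact Or.inl h.symm
  · exact Or.inr ⟨h2, h1⟩

theorem GreenL.trans {s t u : S} (h : GreenL s t) (h' : GreenL t u) : GreenL s u := by
  rcases h with rfl | ⟨⟨x, hx⟩, ⟨y, hy⟩⟩
  · exact h'
  · rcases h' with rfl | ⟨⟨x', hx'⟩, ⟨y', hy'⟩⟩
    · exact Or.inr ⟨⟨x, hx⟩, ⟨y, hy⟩⟩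
    · exact Or.inr ⟨⟨x * x', by rw [hx, mul_assoc, ← hx']⟩, ⟨y' * y, by rw [mul_assoc, ← hy, hy']⟩⟩

theorem GreenR.trans {s t u : S} (h : GreenR s t) (h' : GreenR t u) : GreenR s u := by
  rcases h with rfl | ⟨⟨x, hx⟩, ⟨y, hy⟩⟩
  · exact h'
  · rcases h' with rfl | ⟨⟨x', hx'⟩, ⟨y', hy'⟩⟩
    · exact Or.inr ⟨⟨x, hx⟩, ⟨y, hy⟩⟩
    · exact Or.inr ⟨⟨x' * x, by rw [hx, ← mul_assoc, ← hx']⟩, ⟨y * y', by rw [← mul_assoc, ← hy, hy']⟩⟩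

theorem greenL_greenR_comm {s z t : S} (h : GreenL s z) (h' : GreenR z t) :
    ∃ w, GreenR s w ∧ GreenL w t := by
  rcases h with rfl | ⟨⟨x, hx⟩, ⟨y, hy⟩⟩
  · exact ⟨t, h', Or.inl rfl⟩
  · rcases h' with rfl | ⟨⟨u, hu⟩, ⟨v, hv⟩⟩
    · exact ⟨s, Or.inl rfl, Or.inr ⟨⟨x, hx⟩, ⟨y, hy⟩⟩⟩
    · have hw : s * v = x * t := by rw [hx, mul_assoc, ← hv]
      refine ⟨s * v, Or.inr ⟨⟨u, ?_⟩, ⟨v, rfl⟩⟩, Or.inr ⟨⟨x, hw⟩, ⟨y, ?_⟩⟩⟩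
      · rw [hw, mul_assoc, ← hu, hx]
      · rw [← mul_assoc, ← hy, hv]

theorem GreenD.symm {s t : S} (h : GreenD s t) : GreenD t s := by
  obtain ⟨z, h1, h2⟩ := h
  obtain ⟨w, h3, h4⟩ := greenL_greenR_comm h1 h2
  exact ⟨w, h4.symm, h3.symm⟩

theorem GreenD.trans {s t u : S} (h : GreenD s t) (h' : GreenD t u) : GreenD s u := by
  obtain ⟨z, h1, h2⟩ := h
  obtain ⟨w, h3, h4⟩ := h'
  obtain ⟨v, h5, h6⟩ := greenL_greenR_comm h3.symm.symm h4
  obtain ⟨q, h7, h8⟩ : ∃ q, GreenL z q ∧ GreenR q w :=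
    GreenD.symm ⟨t, h3.symm, h2.symm⟩
  exact ⟨q, h1.trans h7, h8.trans h4⟩

variable (S) in
/-- Green's relation `D` as a setoid. -/
def greenDSetoid : Setoid S where
  r := GreenD
  iseqv := ⟨fun s => ⟨s, Or.inl rfl, Or.inl rfl⟩, GreenD.symm, GreenD.trans⟩

variable (S) in
/-- The set `S/D` of `D`-classes. -/
def DClass : Type _ := Quotient (greenDSetoid S)

/-- The `D`-class `[s]`. -/
def dClass (s : S) : DClass S := Quotient.mk (greenDSetoid S) s

end Green

/-! ### Morita equivalence -/

/-- The objects of the idempotent splitting of `S`: its idempotents. -/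
structure IdempotentSplitting (S : Type*) [Semigroup S] where
  /-- the underlying element -/
  val : S
  idem : val * val = val

/-- The category `C(S)`: morphisms `e ⟶ f` are the elements of `eSf`, and the composite of
`(e, s, f)` and `(f, t, g)` is `(e, st, g)`. -/
instance {S : Type*} [Semigroup S] : Category (IdempotentSplitting S) where
  Hom e f := {s : S // ∃ x, s = e.val * x * f.val}
  id e := ⟨e.val, e.val, by rw [e.idem, e.idem]⟩
  comp {e f g} s t := ⟨s.1 * t.1, by
    obtain ⟨s, x, hx⟩ := s
    obtain ⟨t, y, hy⟩ := t
    exact ⟨x * f.val * (f.val * y), by simp only [hx, hy, mul_assoc]⟩⟩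
  id_comp := by
    rintro e f ⟨s, x, rfl⟩
    exact Subtype.ext (by simp only [← mul_assoc, e.idem])
  comp_id := by
    rintro e f ⟨s, x, rfl⟩
    exact Subtype.ext (by simp only [mul_assoc, f.idem])
  assoc _ _ _ := Subtype.ext (mul_assoc _ _ _)

/-- Inverse semigroups are Morita equivalent if their idempotent splittings are equivalent
categories. -/
def MoritaEquivalent (S T : Type*) [InverseSemigroup S] [InverseSemigroup T] : Prop :=
  Nonempty (IdempotentSplitting S ≌ IdempotentSplitting T)

/-! ### Cores and the relation `⪯` on `D`-classes -/

section Cores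

variable {S : Type*} [InverseSemigroupWithZero S]

/-- `e ≪ f` for idempotents: `e < f` with no idempotent strictly between. -/
def ImmBelow (e f : S) : Prop :=
  IsIdempotentElem e ∧ IsIdempotentElem f ∧ IdemLE e f ∧ e ≠ f ∧
    ∀ g, IsIdempotentElem g → IdemLE e g → IdemLE g f → g = e ∨ g = f

/-- The collection of sets of idempotents below `e` whose intersection is the core of `e`. -/
structure IsCoreSet (e : S) (C : Set S) : Prop where
  subset : ∀ f ∈ C, IsIdempotentElem f ∧ IdemLE f e
  self_mem : e ∈ C
  mul_mem : ∀ f ∈ C, ∀ g ∈ C, f * g ≠ 0 → f * g ∈ C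
  diamond : ∀ h₁ ∈ C, ∀ h₂ ∈ C, ∀ f g, ImmBelow f h₁ → ImmBelow g h₂ →
    ¬ IdemLE f g → ¬ IdemLE g f → f * g ≠ 0 → f ∈ C ∧ g ∈ C
  convex : ∀ e₁ ∈ C, ∀ e₂ ∈ C, ∀ g, IsIdempotentElem g → IdemLE e₁ g → IdemLE g e₂ → g ∈ C

/-- The core of `e`. -/
def core (e : S) : Set S := {f | ∀ C, IsCoreSet e C → f ∈ C}

/-- The relation `⪯'`. -/
def PrecAux (a b : DClass S) : Prop :=
  ∃ e : S, IsIdempotentElem e ∧ ∃ f ∈ core e, ∃ g ∈ core e,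
    dClass f = a ∧ dClass g = b ∧ IdemLE f g

/-- The relation `⪯`: the transitive closure of `⪯'`, together with `0 ⪯ a` for all `a`. -/
def Prec (a b : DClass S) : Prop := Relation.TransGen PrecAux a b ∨ a = dClass 0

/-- `c` is the meet of `a` and `b` with respect to `⪯`. -/
def IsMeet (a b c : DClass S) : Prop :=
  Prec c a ∧ Prec c b ∧ ∀ d, Prec d a → Prec d b → Prec d c

open Classical in
/-- The meet `a ∧ b` with respect to `⪯` (with value `0` if there is none). -/
noncomputable def meet (a b : DClass S) : DClass S :=
  if h : ∃ c, IsMeet a b c then h.choose else dClass 0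

open Classical in
/-- For a set `R` of idempotent representatives of the `D`-classes, the element of `R` in the
class `a` (with value `0` if there is none). -/
noncomputable def rep (R : Set S) (a : DClass S) : S :=
  if h : ∃ e ∈ R, dClass e = a then h.choose else 0

end Cores

/-! ### The semigroup `IM(S, I, p)` -/

section IM

variable {S : Type*} [InverseSemigroup S] {I : Type*}

/-- Triples `(i, s, j)` with `ss* ≤ p i i` and `s*s ≤ p j j`. -/
@[ext]
structure Triple (p : I → I → S) where
  /-- the left index -/
  left : I
  /-- the middle entry -/
  mid : S
  /-- the right index -/
  right : I
  left_le : IdemLE (mid * mid⁻¹) (p left left)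
  right_le : IdemLE (mid⁻¹ * mid) (p right right)

/-- `(i, s, j)(k, t, l) = (i, s p_{j,k} t, l)`. -/
instance (p : I → I → S) : Semigroup (Triple p) where
  mul x y :=
    { left := x.left
      mid := x.mid * p x.right y.left * y.mid
      right := y.right
      left_le := by
        have h := idemLE_mul_right (x := p x.right y.left * y.mid) x.left_le
        rwa [← mul_assoc] at h
      right_le := idemLE_mul_left y.right_le }
  mul_assoc x y z := Triple.ext rfl (by
    change x.mid * p x.right y.left * y.mid * p y.right z.left * z.mid =
      x.mid * p x.right y.left * (y.mid * p y.right z.left * z.mid)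
    simp only [mul_assoc]) rfl

/-- The relation `γ` on triples. -/
def gamma (p : I → I → S) (x y : Triple p) : Prop :=
  x.mid = p x.left y.left * y.mid * p y.right x.right ∧
    y.mid = p y.left x.left * x.mid * p x.right y.right

/-- The semigroup of `γ`-classes `[i, s, j]` of triples. For a McAlister function `p` the relation
`γ` is itself a congruence, so that it coincides with the congruence it generates. -/
def IM (p : I → I → S) : Type _ := (conGen (gamma p)).Quotient

instance (p : I → I → S) : Semigroup (IM p) := inferInstanceAs (Semigroup (conGen (gamma p)).Quotient)

/-- The class `[i, s, j]` of a triple. -/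
def IM.mk {p : I → I → S} (x : Triple p) : IM p := (x : (conGen (gamma p)).Quotient)

end IM

section SPrec

variable {S : Type*} [InverseSemigroupWithZero S]

/-- The function `p_{u,v} = e_{u ∧ v}` on `D`-classes. -/
noncomputable def meetRep (R : Set S) (u v : DClass S) : S := rep R (meet u v)

/-- The semigroup `S^⪯ = IM(S, S/D, p)`. -/
abbrev SPrec (R : Set S) : Type _ := IM (meetRep R)

/-- The set `𝒞` of all `[a, e_a, a]`, `a ∈ S/D`; the class `a = 0` gives the zero of `S^⪯`. -/
def cohSet (R : Set S) : Set (SPrec R) :=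
  {x | ∃ t : Triple (meetRep R), IM.mk t = x ∧ t.left = t.right ∧ t.mid = rep R t.left}

/-- The condition on `(b, f)` that defines `𝒞^≪` and the labels:
`0 ≠ f ≪ e_b`, and `f ≠ e_[f]` or `[f] ⋠ b`. -/
def IsLabel (R : Set S) (b : DClass S) (f : S) : Prop :=
  f ≠ 0 ∧ ImmBelow f (rep R b) ∧ (f ≠ rep R (dClass f) ∨ ¬ Prec (dClass f) b)

/-- The set `𝒞^≪` of all `[b, f, b]` with `0 ≠ f ≪ e_b`, and `f ≠ e_[f]` or `[f] ⋠ b`. -/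
def cohSetBelow (R : Set S) : Set (SPrec R) :=
  {x | ∃ t : Triple (meetRep R), IM.mk t = x ∧ t.left = t.right ∧ IsLabel R t.left t.mid}

/-- The combinatorial data, a subset of `S^⪯`. -/
def combData (R : Set S) : Set (SPrec R) := cohSet R ∪ cohSetBelow R

end SPrec

/-- A bijection between subsets of two semigroups that is an isomorphism for the products of the
ambient semigroups and preserves and reflects their relations `D`. -/
structure IsDClassPreservingIso {P Q : Type*} [Semigroup P] [Semigroup Q] {X : Set P} {Y : Set Q}
    (π : X ≃ Y) : Prop where
  map_mul_iff : ∀ x y z : X, (x : P) * y = z ↔ (π x : Q) * π y = π z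
  map_greenD_iff : ∀ x y : X, GreenD (x : P) y ↔ GreenD (π x : Q) (π y)

/-! ### Labelled graphs -/

/-- A labelled graph with vertex set `V`, edge set `E` and alphabet `Λ`. -/
structure LabelledGraph (V E Λ : Type*) where
  /-- the range map -/
  r : E → V
  /-- the source map -/
  s : E → V
  /-- the labelling map -/
  label : E → Λ

/-- An isomorphism of labelled graphs. -/
structure LabelledGraph.Iso {V E Λ V' E' Λ' : Type*} (G : LabelledGraph V E Λ)
    (H : LabelledGraph V' E' Λ') where
  /-- the map on vertices -/
  onV : V ≃ V'
  /-- the map on edges -/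
  onE : E ≃ E'
  /-- the map on labels -/
  onL : Λ ≃ Λ'
  map_s : ∀ e, H.s (onE e) = onV (G.s e)
  map_r : ∀ e, H.r (onE e) = onV (G.r e)
  map_label : ∀ e, H.label (onE e) = onL (G.label e)

section Graph

variable {S : Type*} [InverseSemigroupWithZero S]

variable (S) in
/-- The nonzero `D`-classes. -/
def Vertex : Type _ := {a : DClass S // a ≠ dClass 0}

/-- The labels `(a, f)`. -/
@[ext]
structure GraphLabel (R : Set S) where
  /-- the vertex -/
  vertex : Vertex S
  /-- the idempotent immediately below -/
  elt : S
  isLabel : IsLabel R vertex.1 elt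

/-- The edges `x_{a,f,b}`, where `(a, f)` is a label and `b ⪯ [f]`. -/
@[ext]
structure GraphEdge (R : Set S) where
  /-- the label -/
  lab : GraphLabel R
  /-- the source -/
  source : Vertex S
  source_prec : Prec source.1 (dClass lab.elt)

/-- The labelled graph of `S` for the set `R` of representatives. -/
def labelledGraph (R : Set S) : LabelledGraph (Vertex S) (GraphEdge R) (GraphLabel R) where
  r x := x.lab.vertex
  s x := x.source
  label x := x.lab

end Graph

/-! ### Inverse hulls of Markov shifts -/

/-- The symmetric inverse semigroup of all partial bijections of `X`. -/
def SymInv (X : Type*) : Type _ := X ≃. X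

theorem symInv_aux {X : Type*} (f : X ≃. X) : (f.trans f.symm).trans f = f := by
  refine PEquiv.ext fun x => Option.ext fun b => ?_
  change b ∈ ((f.trans f.symm).trans f) x ↔ b ∈ f x
  simp only [PEquiv.mem_trans]
  constructor
  · rintro ⟨c, ⟨d, h1, h2⟩, h3⟩
    rw [PEquiv.mem_iff_mem] at h2
    rwa [f.inj h1 h2]
  · intro h
    exact ⟨x, ⟨b, h, f.mem_iff_mem.2 h⟩, h⟩

theorem symInv_aux_le {X : Type*} {f g : X ≃. X} (h₁ : (f.trans g).trans f = f)
    {x y : X} (h : y ∈ f x) : x ∈ g y := by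
  have h' := h
  rw [← h₁] at h'
  simp only [PEquiv.mem_trans] at h'
  obtain ⟨c, ⟨d, h2, h3⟩, h4⟩ := h'
  have hd : d = y := Option.mem_unique h2 h
  have hc : x = c := f.inj h h4
  rwa [hd, ← hc] at h3

/-- Partial bijections compose from right to left; `0` is the empty one. -/
instance (X : Type*) : InverseSemigroupWithZero (SymInv X) where
  mul f g := PEquiv.trans g f
  inv f := PEquiv.symm f
  zero := (⊥ : X ≃. X)
  mul_assoc f g h := (PEquiv.trans_assoc h g f).symm
  zero_mul f := PEquiv.trans_bot f
  mul_zero f := PEquiv.bot_trans f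
  mul_inv_mul f := (PEquiv.trans_assoc (f : X ≃. X) _ _).symm.trans (symInv_aux f)
  inv_mul_inv f := (PEquiv.trans_assoc (PEquiv.symm f : X ≃. X) _ _).symm.trans
    (symInv_aux (PEquiv.symm f))
  inv_unique f g h₁ h₂ := by
    have k₁ : (PEquiv.trans f g).trans f = f :=
      (PEquiv.trans_assoc (f : X ≃. X) _ _).trans h₁
    have k₂ : (PEquiv.trans g f).trans g = g :=
      (PEquiv.trans_assoc (g : X ≃. X) _ _).trans h₂
    refine PEquiv.ext (fun y => Option.ext fun x => ?_)
    exact ⟨fun h => (PEquiv.mem_iff_mem f).2 (symInv_aux_le k₂ h),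
      fun h => symInv_aux_le k₁ ((PEquiv.mem_iff_mem f).1 h)⟩

/-- A Markov transition matrix: entries in `{0, 1}`, and a nonzero entry in each row. -/
structure IsMarkovTransitionMatrix {A : Type*} (M : Matrix A A ℕ) : Prop where
  zero_or_one : ∀ a b, M a b = 0 ∨ M a b = 1
  row_ne_zero : ∀ a, ∃ b, M a b ≠ 0

/-- The set `L_T` of allowable (nonempty) words. -/
def Word {A : Type*} (M : Matrix A A ℕ) : Type _ :=
  {w : List A // w ≠ [] ∧ w.IsChain (fun a b => M a b = 1)}

open Classical in
/-- The partial bijection `θ_a : w ↦ aw`, defined on the `w ∈ L_T` with `aw ∈ L_T`. -/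
noncomputable def theta {A : Type*} (M : Matrix A A ℕ) (a : A) : SymInv (Word M) where
  toFun w := if h : (a :: w.1).IsChain (fun a b => M a b = 1) then
    some ⟨a :: w.1, List.cons_ne_nil _ _, h⟩ else none
  invFun v := if h : ∃ w : Word M, v.1 = a :: w.1 then some h.choose else none
  inv w v := by
    constructor
    · intro h
      split_ifs at h with h1
      have h2 := h1.choose_spec
      rw [Option.some.inj h] at h2
      have h3 := v.2.2
      rw [h2] at h3
      rw [dif_pos h3]
      exact congrArg some (Subtype.ext h2.symm)
    · intro h
      split_ifs at h with h1
      have h2 : v.1 = a :: w.1 := (congrArg Subtype.val (Option.some.inj h)).symm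
      have h3 : ∃ w : Word M, v.1 = a :: w.1 := ⟨w, h2⟩
      rw [dif_pos h3]
      have h4 : a :: w.1 = a :: h3.choose.1 := h2.symm.trans h3.choose_spec
      exact congrArg some (Subtype.ext (List.cons.inj h4).2.symm)

/-- The inverse hull `H(T)` as a set of partial bijections of `L_T`: all finite products of the
`θ_a`, their inverses, and `0`. -/
noncomputable def hull {A : Type*} (M : Matrix A A ℕ) : Subsemigroup (SymInv (Word M)) :=
  Subsemigroup.closure ({0} ∪ Set.range (theta M) ∪ Set.range (fun a => (theta M a)⁻¹))

theorem zero_mem_hull {A : Type*} (M : Matrix A A ℕ) : 0 ∈ hull M :=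
  Subsemigroup.subset_closure (Or.inl (Or.inl rfl))

theorem inv_mem_hull {A : Type*} (M : Matrix A A ℕ) {f : SymInv (Word M)} (hf : f ∈ hull M) :
    f⁻¹ ∈ hull M := by
  induction hf using Subsemigroup.closure_induction with
  | mem x hx =>
    rcases hx with (hx | ⟨a, rfl⟩) | ⟨a, rfl⟩
    · rw [Set.mem_singleton_iff.1 hx]
      exact zero_mem_hull M
    · exact Subsemigroup.subset_closure (Or.inr ⟨a, rfl⟩)
    · exact Subsemigroup.subset_closure (Or.inl (Or.inr ⟨a, inv_inv_eq (theta M a)⟩))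
  | mul x y _ _ hx hy =>
    have h : (x * y)⁻¹ = y⁻¹ * x⁻¹ := PEquiv.symm_trans_rev (y : Word M ≃. Word M) x
    rw [h]
    exact (hull M).mul_mem hy hx

/-- The inverse hull `H(T)`. -/
def InverseHull {A : Type*} (M : Matrix A A ℕ) : Type _ := hull M

instance {A : Type*} (M : Matrix A A ℕ) : InverseSemigroupWithZero (InverseHull M) where
  mul f g := ⟨f.1 * g.1, (hull M).mul_mem f.2 g.2⟩
  inv f := ⟨f.1⁻¹, inv_mem_hull M f.2⟩
  zero := ⟨0, zero_mem_hull M⟩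
  mul_assoc f g h := Subtype.ext (mul_assoc f.1 g.1 h.1)
  zero_mul f := Subtype.ext (zero_mul f.1)
  mul_zero f := Subtype.ext (mul_zero f.1)
  mul_inv_mul f := Subtype.ext (InverseSemigroup.mul_inv_mul f.1)
  inv_mul_inv f := Subtype.ext (InverseSemigroup.inv_mul_inv f.1)
  inv_unique f g h₁ h₂ := Subtype.ext
    (InverseSemigroup.inv_unique f.1 g.1 (congrArg Subtype.val h₁) (congrArg Subtype.val h₂))

/-- The element `θ_a` of `H(T)`. -/
noncomputable def hullTheta {A : Type*} (M : Matrix A A ℕ) (a : A) : InverseHull M :=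
  ⟨theta M a, Subsemigroup.subset_closure (Or.inl (Or.inr ⟨a, rfl⟩))⟩

/-- The set `𝒪` of the idempotents `θ_a θ_a⁻¹`. -/
def rangeIdempotents {A : Type*} (M : Matrix A A ℕ) : Set (InverseHull M) :=
  Set.range (fun a => hullTheta M a * (hullTheta M a)⁻¹)

/-- The set `(𝒪^↑ - 𝒪) ∪ {0}` of representatives of the `D`-classes of `H(T)`. -/
def hullReps {A : Type*} (M : Matrix A A ℕ) : Set (InverseHull M) :=
  ({e | IsIdempotentElem e ∧ ∃ o ∈ rangeIdempotents M, IdemLE o e} \ rangeIdempotents M) ∪ {0}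

end MarkovMorita

/-!
The proof puts an explicit combinatorial notion, `DataIso M N`, between the three conditions: a
bijection of `𝒟`-classes that respects `⪯`, together with a bijection of labels that respects the
vertex of a label and the class of its idempotent. Each condition is shown to be equivalent to the
existence of such data.

**Normal forms.** Let `Fam M` be the set of nonempty intersections of follower sets
`{b | M a b = 1}`. Every nonzero element of the hull is of the form `el M u Z v : v w ↦ u w`, where
`w` runs over the words with first letter in `Z ∈ Fam M` and every letter of `Z` may follow both
`u` and `v` (`eq_zero_or_eq_el`, `el_inj`). The `𝒟`-class of `el M u Z v` is determined by `Z`, so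
the nonzero classes correspond to `Fam M`, the representative of `Z` being the idempotent with
empty words. An idempotent `el M v Y v` is below the representative of `X` iff `v w` has its first
letter in `X` for all `w` (`Bel`).

**The order.** The idempotents covered by the representative of `X` are the maximal members of
`Fam M` properly contained in `X` and, for the letters `a` that lie in no smaller member, the
idempotent of the words starting with `a` (`ImmBelow.cases`). Cores below `X` thereby become the
sets `CoreF` of subsets of `X` (`mem_core_el_iff`), and `⪯` becomes a relation `PrecF` on `Fam M`.
The decisive facts are that a member of `Fam M` contained in `X` that meets an element `Y` of the
core of `X` lies in the core or is contained in `Y` (`CoreF.of_inter_nonempty`), and its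
consequence `PrecF.inter_prec`. They make `⪯` a meet semilattice, and they show that distinct labels
at a vertex are orthogonal (`IsLabel.mul_eq_zero`) and that a label is orthogonal to every class
strictly below its vertex (`IsLabel.rep_mul_eq_zero`).

**Combinatorial data.** An element of `CD` is a class or a label (`combEquiv`). Classes multiply by
meets, the labels are the atoms (`isRight_iff`), and `[u, s, u]` and `[w, t, w]` with
idempotents `s` and `t` are `𝒟`-related exactly when `s` and `t` are (`IM.greenD_iff`). So a class
preserving isomorphism is a `DataIso`. In the labelled graph, a label determines its vertex as the range, and
its class as the largest source, of the edges that carry it.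

**Morita equivalence.** An equivalence of idempotent splittings gives a bijection of classes and
isomorphisms of the semilattices of idempotents below corresponding objects. It preserves covers and
cores, hence `⪯`, hence the number of labels with given vertex and class (`ncard_labelSet`); a
bijection of labels is chosen accordingly.

**From data to an equivalence.** Every idempotent below the representative of `X` is the end of a
unique path of labels starting at `X` (`Bel.exists_isPath`, `IsPath.unique`), where a path may pass
to a smaller class for `⪯` before each label and at its end. A morphism between two idempotents is determined by
the pairs of paths which it matches (`Res`, `hom_eq_of_res`), a nonzero morphism being the
simultaneous prolongation of one such pair (`hom_cases`, `res_el_iff`). This description uses only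
classes, `⪯` and labels, so a `DataIso` carries it over to the other hull.
-/

namespace MarkovMorita

/-! ### Cores in families of sets -/

section Family

variable {A : Type*}

/-- `Y` is a maximal proper subset of `Z` within the family `𝓕`. -/
structure Cov (𝓕 : Set (Set A)) (Y Z : Set A) : Prop where
  left_mem : Y ∈ 𝓕
  right_mem : Z ∈ 𝓕
  subset : Y ⊆ Z
  ne : Y ≠ Z
  eq_or_eq : ∀ W ∈ 𝓕, Y ⊆ W → W ⊆ Z → W = Y ∨ W = Z

/-- `CoreF 𝓕 X Y` says that `Y` lies in the core of `X`, formed inside the family `𝓕` ordered by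
inclusion, in which disjointness takes the place of having product zero. -/
inductive CoreF (𝓕 : Set (Set A)) (X : Set A) : Set A → Prop
  | self : CoreF 𝓕 X X
  | inter {Y Z : Set A} : CoreF 𝓕 X Y → CoreF 𝓕 X Z → (Y ∩ Z).Nonempty → CoreF 𝓕 X (Y ∩ Z)
  | diamond {H₁ H₂ Y Z : Set A} : CoreF 𝓕 X H₁ → CoreF 𝓕 X H₂ → Cov 𝓕 Y H₁ → Cov 𝓕 Z H₂ →
      ¬ Y ⊆ Z → ¬ Z ⊆ Y → (Y ∩ Z).Nonempty → CoreF 𝓕 X Y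
  | convex {Y Z W : Set A} : CoreF 𝓕 X Y → CoreF 𝓕 X Z → W ∈ 𝓕 → Y ⊆ W → W ⊆ Z → CoreF 𝓕 X W

/-- The relation `⪯` on the members of the family `𝓕`. -/
def PrecF (𝓕 : Set (Set A)) : Set A → Set A → Prop :=
  Relation.TransGen fun Y Z => ∃ X ∈ 𝓕, CoreF 𝓕 X Y ∧ CoreF 𝓕 X Z ∧ Y ⊆ Z

variable {𝓕 : Set (Set A)}

theorem CoreF.mem (hF : ∀ X ∈ 𝓕, ∀ Y ∈ 𝓕, (X ∩ Y).Nonempty → X ∩ Y ∈ 𝓕) {X Y : Set A}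
    (hX : X ∈ 𝓕) (h : CoreF 𝓕 X Y) : Y ∈ 𝓕 ∧ Y ⊆ X := by
  induction h with
  | self => exact ⟨hX, subset_rfl⟩
  | inter _ _ hn h1 h2 => exact ⟨hF _ h1.1 _ h2.1 hn, Set.inter_subset_left.trans h1.2⟩
  | diamond _ _ h3 _ _ _ _ h1 _ => exact ⟨h3.left_mem, h3.subset.trans h1.2⟩
  | convex _ _ hW _ h3 _ h2 => exact ⟨hW, h3.trans h2.2⟩

theorem Cov.not_subset {Y Y' Z : Set A} (h : Cov 𝓕 Y Z) (h' : Cov 𝓕 Y' Z) (hne : Y ≠ Y') :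
    ¬ Y ⊆ Y' := fun hs => by
  rcases h.eq_or_eq _ h'.left_mem hs h'.subset with h1 | h1
  · exact hne h1.symm
  · exact h'.ne h1

theorem exists_cov [Finite A] {Y Z : Set A} (hY : Y ∈ 𝓕) (hZ : Z ∈ 𝓕) (hs : Y ⊆ Z)
    (hne : Y ≠ Z) : ∃ K, Cov 𝓕 K Z ∧ Y ⊆ K := by
  have hfin : {K | K ∈ 𝓕 ∧ Y ⊆ K ∧ K ⊂ Z}.Finite := Set.toFinite _
  obtain ⟨K, hK⟩ := hfin.exists_maximal ⟨Y, hY, subset_rfl, hs.ssubset_of_ne hne⟩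
  refine ⟨K, ⟨hK.prop.1, hZ, hK.prop.2.2.subset, hK.prop.2.2.ne, fun W hW h1 h2 => ?_⟩,
    hK.prop.2.1⟩
  by_cases h : W = Z
  · exact Or.inr h
  · exact Or.inl ((hK.le_of_ge ⟨hW, hK.prop.2.1.trans h1, h2.ssubset_of_ne h⟩ h1).antisymm h1)

/-- A minimal member `K` of the core of `X` that contains `W` must be `W`: otherwise a member
`K₁` of the family covered by `K` and containing `W` would be in the core as well, by convexity if it
contains `Y ∩ K`, and by the diamond condition if not. -/
theorem CoreF.of_inter_nonempty [Finite A]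
    (hF : ∀ X ∈ 𝓕, ∀ Y ∈ 𝓕, (X ∩ Y).Nonempty → X ∩ Y ∈ 𝓕) {X Y W : Set A}
    (hX : X ∈ 𝓕) (h : CoreF 𝓕 X Y) (hW : W ∈ 𝓕) (hWX : W ⊆ X) (hn : (W ∩ Y).Nonempty)
    (hWY : ¬ W ⊆ Y) : CoreF 𝓕 X W := by
  have hfin : {K | CoreF 𝓕 X K ∧ W ⊆ K}.Finite := Set.toFinite _
  obtain ⟨K, hK⟩ := hfin.exists_minimal ⟨X, CoreF.self, hWX⟩
  obtain ⟨hKc, hWK⟩ := hK.prop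
  by_cases hne : W = K
  · rwa [hne]
  exfalso
  obtain ⟨K₁, hK₁, hWK₁⟩ := exists_cov hW (hKc.mem hF hX).1 hWK hne
  have key : ¬ CoreF 𝓕 X K₁ := fun h1 =>
    hK₁.ne (hK₁.subset.antisymm (hK.2 ⟨h1, hWK₁⟩ hK₁.subset))
  have hnK : (Y ∩ K).Nonempty := hn.mono fun a ha => ⟨ha.2, hWK ha.1⟩
  have hYK := CoreF.inter h hKc hnK
  by_cases h1 : Y ∩ K ⊆ K₁
  · exact key (hYK.convex hKc hK₁.left_mem h1 hK₁.subset)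
  have h2 : Y ∩ K ≠ K := fun h2 => hWY fun a ha => by
    have := hWK ha
    rw [← h2] at this
    exact this.1
  obtain ⟨G, hG, hYG⟩ := exists_cov (hYK.mem hF hX).1 (hKc.mem hF hX).1 Set.inter_subset_right h2
  have h3 : K₁ ≠ G := fun h3 => h1 (h3 ▸ hYG)
  exact key (CoreF.diamond hKc hKc hK₁ hG (hK₁.not_subset hG h3) (hG.not_subset hK₁ h3.symm)
    (hn.mono fun a ha => ⟨hWK₁ ha.1, hYG ⟨ha.2, hWK ha.1⟩⟩))

theorem PrecF.refl {X : Set A} (hX : X ∈ 𝓕) : PrecF 𝓕 X X :=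
  .single ⟨X, hX, .self, .self, subset_rfl⟩

theorem PrecF.trans {X Y Z : Set A} (h : PrecF 𝓕 X Y) (h' : PrecF 𝓕 Y Z) : PrecF 𝓕 X Z :=
  Relation.TransGen.trans h h'

theorem PrecF.subset {Y Z : Set A} (h : PrecF 𝓕 Y Z) : Y ⊆ Z := by
  induction h with
  | single h => exact h.choose_spec.2.2.2
  | tail _ h ih => exact ih.trans h.choose_spec.2.2.2

theorem PrecF.mem (hF : ∀ X ∈ 𝓕, ∀ Y ∈ 𝓕, (X ∩ Y).Nonempty → X ∩ Y ∈ 𝓕) {Y Z : Set A}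
    (h : PrecF 𝓕 Y Z) : Y ∈ 𝓕 ∧ Z ∈ 𝓕 := by
  have key : ∀ Y Z, (∃ X ∈ 𝓕, CoreF 𝓕 X Y ∧ CoreF 𝓕 X Z ∧ Y ⊆ Z) → Y ∈ 𝓕 ∧ Z ∈ 𝓕 := by
    rintro Y Z ⟨X, hX, h1, h2, -⟩
    exact ⟨(h1.mem hF hX).1, (h2.mem hF hX).1⟩
  induction h with
  | single h => exact key _ _ h
  | tail _ h ih => exact ⟨ih.1, (key _ _ h).2⟩

theorem PrecF.of_diamond {Y Y' Z : Set A} (h : Cov 𝓕 Y Z) (h' : Cov 𝓕 Y' Z) (hne : Y ≠ Y')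
    (hn : (Y ∩ Y').Nonempty) : PrecF 𝓕 Y Z :=
  .single ⟨Z, h.right_mem, CoreF.diamond .self .self h h' (h.not_subset h' hne)
    (h'.not_subset h hne.symm) hn, .self, h.subset⟩

variable [Finite A] (hF : ∀ X ∈ 𝓕, ∀ Y ∈ 𝓕, (X ∩ Y).Nonempty → X ∩ Y ∈ 𝓕)
include hF

/-- A member of the family below `Z` that meets some `Y ⪯ Z` is contained in `Y` or satisfies `⪯ Z`
itself. -/
theorem PrecF.subset_or_prec {Y Z W : Set A} (h : PrecF 𝓕 Y Z) (hW : W ∈ 𝓕) (hWZ : W ⊆ Z)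
    (hn : (W ∩ Y).Nonempty) : W ⊆ Y ∨ PrecF 𝓕 W Z := by
  have key : ∀ Y Z, (∃ X ∈ 𝓕, CoreF 𝓕 X Y ∧ CoreF 𝓕 X Z ∧ Y ⊆ Z) → W ⊆ Z →
      (W ∩ Y).Nonempty → W ⊆ Y ∨ PrecF 𝓕 W Z := by
    rintro Y Z ⟨X, hX, h1, h2, -⟩ hWZ hn
    by_cases hWY : W ⊆ Y
    · exact Or.inl hWY
    · exact Or.inr (.single ⟨X, hX, h1.of_inter_nonempty hF hX hW
        (hWZ.trans (h2.mem hF hX).2) hn hWY, h2, hWZ⟩)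
  induction h with
  | single h => exact key _ _ h hWZ hn
  | tail h1 h2 ih =>
    rcases key _ _ h2 hWZ (hn.mono (Set.inter_subset_inter_right _ (PrecF.subset h1))) with h3 | h3
    · rcases ih h3 with h4 | h4
      · exact Or.inl h4
      · exact Or.inr (h4.tail h2)
    · exact Or.inr h3

/-- The elements below `Z` for `⪯` are cut out of each smaller member `W` of the family as elements
below `W`: this is what makes meets and products of representatives compatible. -/
theorem PrecF.inter_prec {Y Z W : Set A} (h : PrecF 𝓕 Y Z) (hW : W ∈ 𝓕) (hWZ : W ⊆ Z)
    (hn : (W ∩ Y).Nonempty) : PrecF 𝓕 (W ∩ Y) W := by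
  have key : ∀ W ∈ 𝓕, ∀ Y Z, (∃ X ∈ 𝓕, CoreF 𝓕 X Y ∧ CoreF 𝓕 X Z ∧ Y ⊆ Z) → W ⊆ Z →
      (W ∩ Y).Nonempty → PrecF 𝓕 (W ∩ Y) W := by
    rintro W hW Y Z ⟨X, hX, h1, h2, -⟩ hWZ hn
    by_cases hWY : W ⊆ Y
    · rw [Set.inter_eq_left.2 hWY]
      exact .refl hW
    · have h3 := h1.of_inter_nonempty hF hX hW (hWZ.trans (h2.mem hF hX).2) hn hWY
      exact .single ⟨X, hX, .inter h3 h1 hn, h3, Set.inter_subset_left⟩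
  induction h using Relation.TransGen.head_induction_on generalizing W with
  | single h => exact key _ hW _ _ h hWZ hn
  | head h1 h2 ih =>
    have hs := h1.choose_spec.2.2.2
    have hn' := hn.mono (Set.inter_subset_inter_right _ hs)
    have h3 := ih hW hWZ hn'
    refine PrecF.trans ?_ h3
    have h4 := key _ (hF _ hW _ (PrecF.mem hF h2).1 hn') _ _ h1 Set.inter_subset_right
    rw [Set.inter_assoc, Set.inter_eq_right.2 hs] at h4
    exact h4 hn

/-- If `Y ⪯ Z`, then every member of the family between `Y` and `Z` for inclusion is so for `⪯`. -/
theorem PrecF.of_subset_of_subset {Y Z W : Set A} (hY : Y.Nonempty) (h : PrecF 𝓕 Y Z)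
    (hW : W ∈ 𝓕) (hYW : Y ⊆ W) (hWZ : W ⊆ Z) : PrecF 𝓕 Y W ∧ PrecF 𝓕 W Z := by
  have h0 := Set.inter_eq_right.2 hYW
  have hn : (W ∩ Y).Nonempty := h0.symm ▸ hY
  have h1 := h.inter_prec hF hW hWZ hn
  rw [h0] at h1
  refine ⟨h1, ?_⟩
  rcases h.subset_or_prec hF hW hWZ hn with h2 | h2
  · rwa [h2.antisymm hYW]
  · exact h2

end Family

/-! ### Normal forms in the inverse hull -/

section NormalForm

variable {A : Type*} {M : Matrix A A ℕ}

/-- An element of the symmetric inverse semigroup, as a partial bijection. -/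
def SymInv.toPEquiv {X : Type*} (f : SymInv X) : X ≃. X := f

/-- The partial bijection `f`, as a relation between lists: `f` maps the word `x` to `y`. -/
def Rel (f : SymInv (Word M)) (x y : List A) : Prop :=
  ∃ p q : Word M, p.1 = x ∧ q.1 = y ∧ q ∈ f.toPEquiv p

theorem SymInv.ext_rel {f g : SymInv (Word M)} (h : ∀ x y, Rel f x y ↔ Rel g x y) : f = g := by
  have key : ∀ {f : SymInv (Word M)} {p q : Word M}, Rel f p.1 q.1 ↔
      q ∈ f.toPEquiv p := by
    intro f p q
    refine ⟨?_, fun h => ⟨p, q, rfl, rfl, h⟩⟩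
    rintro ⟨p', q', h1, h2, h3⟩
    rwa [Subtype.ext h1, Subtype.ext h2] at h3
  refine PEquiv.ext fun p => Option.ext fun q => ?_
  exact key.symm.trans ((h _ _).trans key)

theorem rel_mul {f g : SymInv (Word M)} {x y : List A} :
    Rel (f * g) x y ↔ ∃ z, Rel g x z ∧ Rel f z y := by
  constructor
  · rintro ⟨p, q, rfl, rfl, h⟩
    obtain ⟨r, h1, h2⟩ := (PEquiv.mem_trans g.toPEquiv f.toPEquiv p q).1 h
    exact ⟨r.1, ⟨p, r, rfl, rfl, h1⟩, ⟨r, q, rfl, rfl, h2⟩⟩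
  · rintro ⟨z, ⟨p, r, rfl, rfl, h1⟩, ⟨r', q, h3, rfl, h2⟩⟩
    rw [Subtype.ext h3] at h2
    exact ⟨p, q, rfl, rfl, (PEquiv.mem_trans g.toPEquiv f.toPEquiv p q).2 ⟨r, h1, h2⟩⟩

theorem rel_inv {f : SymInv (Word M)} {x y : List A} : Rel f⁻¹ x y ↔ Rel f y x := by
  constructor
  · rintro ⟨p, q, rfl, rfl, h⟩
    exact ⟨q, p, rfl, rfl, (PEquiv.mem_iff_mem f.toPEquiv).1 h⟩
  · rintro ⟨p, q, rfl, rfl, h⟩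
    exact ⟨q, p, rfl, rfl, (PEquiv.mem_iff_mem f.toPEquiv).2 h⟩

theorem not_rel_zero {x y : List A} : ¬ Rel (0 : SymInv (Word M)) x y := by
  rintro ⟨p, q, rfl, rfl, h⟩
  exact Option.not_mem_none _ h

theorem Rel.unique {f : SymInv (Word M)} {x y z : List A} (h : Rel f x y) (h' : Rel f x z) :
    y = z := by
  obtain ⟨p, q, rfl, rfl, h⟩ := h
  obtain ⟨p', q', h1, rfl, h'⟩ := h'
  rw [Subtype.ext h1] at h'
  exact congrArg Subtype.val (Option.mem_unique h h')

/-- `w` is an allowable word. -/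
abbrev Chain (M : Matrix A A ℕ) (w : List A) : Prop := w.IsChain (fun a b => M a b = 1)

open Classical in
theorem theta_apply (a : A) (p : Word M) : (theta M a).toPEquiv p =
    if h : Chain M (a :: p.1) then some ⟨a :: p.1, List.cons_ne_nil _ _, h⟩ else none := rfl

theorem rel_theta {a : A} {x y : List A} :
    Rel (theta M a) x y ↔ x ≠ [] ∧ Chain M y ∧ y = a :: x := by
  constructor
  · rintro ⟨p, q, rfl, rfl, h⟩
    rw [Option.mem_def, theta_apply] at h
    split_ifs at h with h1
    have h2 := Option.some.inj h
    exact ⟨p.2.1, q.2.2, (congrArg Subtype.val h2).symm⟩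
  · rintro ⟨hx, hc, rfl⟩
    refine ⟨⟨x, hx, hc.tail⟩, ⟨a :: x, List.cons_ne_nil _ _, hc⟩, rfl, rfl, ?_⟩
    exact (theta_apply a ⟨x, hx, hc.tail⟩).trans (dif_pos hc)

/-- `w` is an allowable word whose first letter lies in `Z`. -/
def IsW (M : Matrix A A ℕ) (Z : Set A) (w : List A) : Prop :=
  Chain M w ∧ ∃ a ∈ Z, w.head? = some a

variable (M) in
/-- The set of letters that may follow `a`. -/
def foll (a : A) : Set A := {b | M a b = 1}

variable (M) in
/-- The nonempty intersections of the sets `foll M a`, over nonempty sets of letters `a`. They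
parametrize the nonzero `D`-classes of the inverse hull. -/
def Fam : Set (Set A) := {Z | Z.Nonempty ∧ ∃ T : Set A, T.Nonempty ∧ Z = {b | ∀ a ∈ T, M a b = 1}}

theorem Fam.inter : ∀ X ∈ Fam M, ∀ Y ∈ Fam M, (X ∩ Y).Nonempty → X ∩ Y ∈ Fam M := by
  rintro X ⟨-, T, hT, rfl⟩ Y ⟨-, U, -, rfl⟩ hn
  refine ⟨hn, T ∪ U, hT.inl, ?_⟩
  ext b
  constructor
  · rintro ⟨h1, h2⟩ a (ha | ha)
    · exact h1 a ha
    · exact h2 a ha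
  · exact fun h => ⟨fun a ha => h a (Or.inl ha), fun a ha => h a (Or.inr ha)⟩

theorem foll_mem_fam (hM : IsMarkovTransitionMatrix M) (a : A) : foll M a ∈ Fam M := by
  obtain ⟨b, hb⟩ := hM.row_ne_zero a
  exact ⟨⟨b, (hM.zero_or_one a b).resolve_left hb⟩, {a}, ⟨a, rfl⟩, by
    ext b
    exact ⟨fun h a' ha => by rw [Set.mem_singleton_iff.1 ha]; exact h, fun h => h a rfl⟩⟩

/-- `u` can be prolonged by any letter in `Z`. -/
def Pre (M : Matrix A A ℕ) (u : List A) (Z : Set A) : Prop := ∀ z ∈ Z, Chain M (u ++ [z])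

/-- Prolonging `k` by a letter in `Z` gives an allowable word with first letter in `Y`. -/
def Bel (M : Matrix A A ℕ) (Y : Set A) (k : List A) (Z : Set A) : Prop :=
  ∀ z ∈ Z, IsW M Y (k ++ [z])

theorem IsW.ne_nil {Z : Set A} {w : List A} (h : IsW M Z w) : w ≠ [] := by
  rintro rfl
  obtain ⟨_, a, -, h⟩ := h
  exact absurd h (by simp)

theorem IsW.cases {Z : Set A} {w : List A} (h : IsW M Z w) : ∃ a ∈ Z, ∃ w', w = a :: w' := by
  obtain ⟨_, a, ha, h⟩ := h
  cases w with
  | nil => exact absurd h (by simp)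
  | cons b w' => exact ⟨a, ha, w', by rw [Option.some.inj h]⟩

theorem isW_singleton {Z : Set A} {a : A} : IsW M Z [a] ↔ a ∈ Z := by
  constructor
  · rintro ⟨-, b, hb, h⟩
    rwa [Option.some.inj h]
  · exact fun h => ⟨List.isChain_singleton _, a, h, rfl⟩

theorem IsW.mono {Y Z : Set A} {w : List A} (h : IsW M Y w) (hs : Y ⊆ Z) : IsW M Z w :=
  ⟨h.1, h.2.choose, hs h.2.choose_spec.1, h.2.choose_spec.2⟩

theorem bel_nil {Y Z : Set A} : Bel M Y [] Z ↔ Z ⊆ Y :=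
  ⟨fun h _ hz => isW_singleton.1 (h _ hz), fun h _ hz => isW_singleton.2 (h hz)⟩

theorem pre_nil {Z : Set A} : Pre M [] Z := fun _ _ => List.isChain_singleton _

theorem pre_singleton {a : A} {Z : Set A} : Pre M [a] Z ↔ Z ⊆ foll M a := by
  simp [Pre, foll, Set.subset_def]

theorem Pre.mono {u : List A} {Y Z : Set A} (h : Pre M u Z) (hs : Y ⊆ Z) : Pre M u Y :=
  fun z hz => h z (hs hz)

theorem Pre.chain {u : List A} {Z : Set A} (h : Pre M u Z) {w : List A} (hw : IsW M Z w) :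
    Chain M (u ++ w) := by
  obtain ⟨a, ha, w', rfl⟩ := hw.cases
  have h1 := h a ha
  have h2 := hw.1
  rw [Chain, List.isChain_append] at h1 ⊢
  exact ⟨h1.1, h2, fun x hx y hy => h1.2.2 x hx y (by simpa using hy)⟩

theorem Bel.isW {Y Z : Set A} {k w : List A} (h : Bel M Y k Z) (hw : IsW M Z w) :
    IsW M Y (k ++ w) := by
  refine ⟨Pre.chain (fun z hz => (h z hz).1) hw, ?_⟩
  obtain ⟨a, ha, w', rfl⟩ := hw.cases
  obtain ⟨b, hb, h1⟩ := (h a ha).2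
  refine ⟨b, hb, ?_⟩
  cases k <;> simpa using h1

theorem Bel.append {X Y Z : Set A} {k j : List A} (h : Bel M X k Y) (h' : Bel M Y j Z) :
    Bel M X (k ++ j) Z := fun z hz => by
  rw [List.append_assoc]
  exact h.isW (h' z hz)

theorem Pre.append {Y Z : Set A} {k j : List A} (h : Pre M k Y) (h' : Bel M Y j Z) :
    Pre M (k ++ j) Z := fun z hz => by
  rw [List.append_assoc]
  exact h.chain (h' z hz)

theorem bel_cons {Y Z : Set A} (hZ : Z.Nonempty) {a : A} {k : List A} :
    Bel M Y (a :: k) Z ↔ a ∈ Y ∧ Pre M (a :: k) Z := by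
  constructor
  · intro h
    refine ⟨?_, fun z hz => (h z hz).1⟩
    obtain ⟨z, hz⟩ := hZ
    obtain ⟨b, hb, h1⟩ := (h z hz).2
    rwa [Option.some.inj h1]
  · exact fun h z hz => ⟨h.2 z hz, a, h.1, rfl⟩

/-- The side conditions under which `v ++ w ↦ u ++ w` (`w` a word with first letter in `Z`) is a
nonzero element of the inverse hull. -/
structure Good (M : Matrix A A ℕ) (u : List A) (Z : Set A) (v : List A) : Prop where
  mem : Z ∈ Fam M
  left : Pre M u Z
  right : Pre M v Z

theorem Good.symm {u v : List A} {Z : Set A} (h : Good M u Z v) : Good M v Z u :=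
  ⟨h.mem, h.right, h.left⟩

/-- `s` maps the word `x` to `y`. -/
def HRel (s : InverseHull M) (x y : List A) : Prop := Rel s.1 x y

theorem hull_ext {s t : InverseHull M} (h : ∀ x y, HRel s x y ↔ HRel t x y) : s = t :=
  Subtype.ext (SymInv.ext_rel h)

theorem hrel_mul {f g : InverseHull M} {x y : List A} :
    HRel (f * g) x y ↔ ∃ z, HRel g x z ∧ HRel f z y := rel_mul

theorem hrel_inv {f : InverseHull M} {x y : List A} : HRel f⁻¹ x y ↔ HRel f y x := rel_inv

theorem not_hrel_zero {x y : List A} : ¬ HRel (0 : InverseHull M) x y := not_rel_zero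

theorem HRel.unique {f : InverseHull M} {x y z : List A} (h : HRel f x y) (h' : HRel f x z) :
    y = z := Rel.unique h h'

/-- `s` acts as `v ++ w ↦ u ++ w` on the words `w` with first letter in `Z`. -/
def IsEl (s : InverseHull M) (u : List A) (Z : Set A) (v : List A) : Prop :=
  ∀ x y, HRel s x y ↔ ∃ w, IsW M Z w ∧ x = v ++ w ∧ y = u ++ w

theorem hrel_hullTheta {a : A} {x y : List A} :
    HRel (hullTheta M a) x y ↔ x ≠ [] ∧ Chain M y ∧ y = a :: x := rel_theta

theorem isW_foll {a : A} {w : List A} : IsW M (foll M a) w ↔ w ≠ [] ∧ Chain M (a :: w) := by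
  cases w with
  | nil => simp [IsW]
  | cons b w => simp [IsW, foll, and_comm, List.isChain_cons_cons]

theorem isEl_hullTheta (a : A) : IsEl (hullTheta M a) [a] (foll M a) [] := by
  intro x y
  rw [hrel_hullTheta]
  constructor
  · rintro ⟨h1, h2, rfl⟩
    exact ⟨x, isW_foll.2 ⟨h1, h2⟩, rfl, rfl⟩
  · rintro ⟨w, h, rfl, rfl⟩
    exact ⟨(isW_foll.1 h).1, (isW_foll.1 h).2, rfl⟩

theorem IsEl.inv {s : InverseHull M} {u v : List A} {Z : Set A} (h : IsEl s u Z v) :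
    IsEl s⁻¹ v Z u := fun x y => by
  rw [hrel_inv, h]
  exact ⟨fun ⟨w, h1, h2, h3⟩ => ⟨w, h1, h3, h2⟩, fun ⟨w, h1, h2, h3⟩ => ⟨w, h1, h3, h2⟩⟩

/-- The product of normal forms when the inner word on the right prolongs the inner word on the
left. -/
theorem IsEl.mul {s t : InverseHull M} {u v c d : List A} {Y Z : Set A} (h : IsEl s u Z v)
    (h' : IsEl t (v ++ c) Y d) (hb : Bel M Z c Y) : IsEl (s * t) (u ++ c) Y d := fun x y => by
  rw [hrel_mul]
  constructor
  · rintro ⟨z, h1, h2⟩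
    obtain ⟨w, hw, rfl, rfl⟩ := (h' _ _).1 h1
    obtain ⟨w', hw', h3, rfl⟩ := (h _ _).1 h2
    rw [List.append_assoc] at h3
    rw [← List.append_cancel_left h3]
    exact ⟨w, hw, rfl, by simp⟩
  · rintro ⟨w, hw, rfl, rfl⟩
    exact ⟨v ++ c ++ w, (h' _ _).2 ⟨w, hw, rfl, rfl⟩,
      (h _ _).2 ⟨c ++ w, hb.isW hw, by simp, by simp⟩⟩

theorem IsEl.mul_inter {s t : InverseHull M} {u v d : List A} {Y Z : Set A} (h : IsEl s u Z v)
    (h' : IsEl t v Y d) : IsEl (s * t) u (Z ∩ Y) d := fun x y => by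
  rw [hrel_mul]
  constructor
  · rintro ⟨z, h1, h2⟩
    obtain ⟨w, hw, rfl, rfl⟩ := (h' _ _).1 h1
    obtain ⟨w', hw', h3, rfl⟩ := (h _ _).1 h2
    obtain rfl := List.append_cancel_left h3
    obtain ⟨a, ha, h4⟩ := hw.2
    obtain ⟨b, hb, h5⟩ := hw'.2
    rw [h4] at h5
    exact ⟨w, ⟨hw.1, a, ⟨(Option.some.inj h5) ▸ hb, ha⟩, h4⟩, rfl, rfl⟩
  · rintro ⟨w, hw, rfl, rfl⟩
    exact ⟨v ++ w, (h' _ _).2 ⟨w, hw.mono Set.inter_subset_right, rfl, rfl⟩,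
      (h _ _).2 ⟨w, hw.mono Set.inter_subset_left, rfl, rfl⟩⟩

theorem IsEl.eq {s t : InverseHull M} {u v : List A} {Z : Set A} (h : IsEl s u Z v)
    (h' : IsEl t u Z v) : s = t := hull_ext fun x y => (h x y).trans (h' x y).symm

variable (M) in
/-- The partial identities on the words with first letter in `Z`. -/
theorem exists_isEl_nil [Finite A] {Z : Set A} (hZ : Z ∈ Fam M) :
    ∃ s : InverseHull M, IsEl s [] Z [] := by
  have h1 : ∀ a, IsEl ((hullTheta M a)⁻¹ * hullTheta M a) [] (foll M a) [] := fun a => by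
    simpa using (isEl_hullTheta (M := M) a).inv.mul_inter (isEl_hullTheta a)
  obtain ⟨-, T, hT, rfl⟩ := hZ
  induction T, T.toFinite using Set.Finite.induction_on with
  | empty => exact absurd hT Set.not_nonempty_empty
  | @insert a T _ _ ih =>
    have h2 : {b | ∀ c ∈ insert a T, M c b = 1} = foll M a ∩ {b | ∀ c ∈ T, M c b = 1} := by
      ext b
      simp [foll]
    rcases T.eq_empty_or_nonempty with rfl | hT
    · refine ⟨(hullTheta M a)⁻¹ * hullTheta M a, ?_⟩
      convert h1 a using 1
      simpa using h2
    · obtain ⟨s, hs⟩ := ih hT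
      rw [h2]
      exact ⟨_, (h1 a).mul_inter hs⟩

theorem Pre.tail {a : A} {u : List A} {Z : Set A} (h : Pre M (a :: u) Z) : Pre M u Z :=
  fun z hz => (h z hz).tail

theorem exists_isEl [Finite A] {u v : List A} {Z : Set A} (h : Good M u Z v) :
    ∃ s : InverseHull M, IsEl s u Z v := by
  have key : ∀ u, Pre M u Z → ∃ s : InverseHull M, IsEl s u Z [] := by
    intro u
    induction u with
    | nil => exact fun _ => exists_isEl_nil M h.mem
    | cons a u ih =>
      intro hp
      obtain ⟨s, hs⟩ := ih hp.tail
      have h1 : IsEl s ([] ++ u) Z [] := hs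
      exact ⟨_, (isEl_hullTheta a).mul h1 fun z hz =>
        isW_foll.2 ⟨by simp, hp z hz⟩⟩
  obtain ⟨s, hs⟩ := key u h.left
  obtain ⟨t, ht⟩ := key v h.right
  have := hs.mul_inter ht.inv
  rw [Set.inter_self] at this
  exact ⟨_, this⟩

open Classical in
/-- The element `v ++ w ↦ u ++ w` (`w` a word with first letter in `Z`) of the inverse hull,
and `0` if there is no such element. -/
noncomputable def el (M : Matrix A A ℕ) (u : List A) (Z : Set A) (v : List A) : InverseHull M :=
  if h : Good M u Z v ∧ ∃ s : InverseHull M, IsEl s u Z v then h.2.choose else 0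

theorem isEl_el [Finite A] {u v : List A} {Z : Set A} (h : Good M u Z v) :
    IsEl (el M u Z v) u Z v := by
  have h' := And.intro h (exists_isEl h)
  rw [el, dif_pos h']
  exact h'.2.choose_spec

/-- The element `s` is zero or in normal form. -/
def IsNormal (s : InverseHull M) : Prop := s = 0 ∨ ∃ u Z v, Good M u Z v ∧ IsEl s u Z v

theorem eq_zero_of_not_hrel (s : InverseHull M) (h : ∀ x y, ¬ HRel s x y) : s = 0 :=
  hull_ext fun x y => ⟨fun h' => (h x y h').elim, fun h' => (not_hrel_zero h').elim⟩

theorem hull_mul_inv_rev (s t : InverseHull M) : (s * t)⁻¹ = t⁻¹ * s⁻¹ := hull_ext fun x y => by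
  simp only [hrel_inv, hrel_mul]
  exact ⟨fun ⟨z, h1, h2⟩ => ⟨z, h2, h1⟩, fun ⟨z, h1, h2⟩ => ⟨z, h2, h1⟩⟩

theorem IsNormal.of_inv {s : InverseHull M} (h : IsNormal s⁻¹) : IsNormal s := by
  rcases h with h | ⟨u, Z, v, h1, h2⟩
  · refine Or.inl (eq_zero_of_not_hrel _ fun x y hxy => ?_)
    have := hrel_inv.2 hxy
    rw [h] at this
    exact not_hrel_zero this
  · refine Or.inr ⟨v, Z, u, h1.symm, ?_⟩
    rw [inv_inv_eq s]
    exact h2.inv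

theorem IsNormal.mul {s t : InverseHull M} (ihx : IsNormal s) (ihy : IsNormal t) :
    IsNormal (s * t) := by
  -- the product, when the inner word on the right prolongs the inner word on the left
  have hmul : ∀ (s t : InverseHull M) (u v c d : List A) (Y Z : Set A), Good M u Z v →
      Good M (v ++ c) Y d → IsEl s u Z v → IsEl t (v ++ c) Y d →
      IsNormal (s * t) := by
    intro s t u v c d Y Z hs ht hs' ht'
    cases c with
    | nil =>
      rw [List.append_nil] at ht ht'
      have h := hs'.mul_inter ht'
      rcases (Z ∩ Y).eq_empty_or_nonempty with he | hn
      · refine Or.inl (eq_zero_of_not_hrel _ fun x y hxy => ?_)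
        obtain ⟨w, hw, -⟩ := (h x y).1 hxy
        obtain ⟨a, ha, -⟩ := hw.2
        rw [he] at ha
        exact ha
      · exact Or.inr ⟨_, _, _, ⟨Fam.inter _ hs.mem _ ht.mem hn,
          hs.left.mono Set.inter_subset_left, ht.right.mono Set.inter_subset_right⟩, h⟩
    | cons a c =>
      have hch : Pre M (a :: c) Y := fun z hz => by
        have := ht.left z hz
        rw [List.append_assoc, Chain, List.isChain_append] at this
        exact this.2.1
      by_cases ha : a ∈ Z
      · have hb : Bel M Z (a :: c) Y := fun z hz => ⟨hch z hz, a, ha, rfl⟩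
        exact Or.inr ⟨_, _, _, ⟨ht.mem, hs.left.append hb, ht.right⟩, hs'.mul ht' hb⟩
      · refine Or.inl (eq_zero_of_not_hrel _ fun x y hxy => ?_)
        obtain ⟨z, h1, h2⟩ := hrel_mul.1 hxy
        obtain ⟨w, hw, rfl, rfl⟩ := (ht' _ _).1 h1
        obtain ⟨w', hw', h3, rfl⟩ := (hs' _ _).1 h2
        rw [List.append_assoc] at h3
        rw [← List.append_cancel_left h3] at hw'
        obtain ⟨b, hb, h4⟩ := hw'.2
        exact ha ((Option.some.inj h4) ▸ hb)
  rcases ihx with rfl | ⟨u, Z, v, hs, hs'⟩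
  · exact Or.inl (zero_mul t)
  rcases ihy with rfl | ⟨c, Y, d, ht, ht'⟩
  · exact Or.inl (mul_zero s)
  by_cases hpre : v <+: c
  · obtain ⟨k, rfl⟩ := hpre
    exact hmul s t u v k d Y Z hs ht hs' ht'
  by_cases hpre' : c <+: v
  · obtain ⟨k, rfl⟩ := hpre'
    refine IsNormal.of_inv ?_
    rw [hull_mul_inv_rev]
    exact hmul _ _ d c k u Z Y ht.symm hs.symm ht'.inv hs'.inv
  · refine Or.inl (eq_zero_of_not_hrel _ fun x y hxy => ?_)
    obtain ⟨z, h1, h2⟩ := hrel_mul.1 hxy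
    obtain ⟨w, hw, rfl, rfl⟩ := (ht' _ _).1 h1
    obtain ⟨w', hw', h3, rfl⟩ := (hs' _ _).1 h2
    rcases List.append_eq_append_iff.1 h3 with ⟨k, h4, -⟩ | ⟨k, h4, -⟩
    · exact hpre' ⟨k, h4.symm⟩
    · exact hpre ⟨k, h4.symm⟩

theorem isNormal [Finite A] (hM : IsMarkovTransitionMatrix M) (s : InverseHull M) :
    IsNormal s := by
  obtain ⟨s, hs⟩ := s
  have hth : ∀ a, Good M [a] (foll M a) [] := fun a =>
    ⟨foll_mem_fam hM a, pre_singleton.2 subset_rfl, pre_nil⟩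
  induction hs using Subsemigroup.closure_induction with
  | mem x hx =>
    rcases hx with (hx | ⟨a, rfl⟩) | ⟨a, rfl⟩
    · exact Or.inl (Subtype.ext hx)
    · exact Or.inr ⟨_, _, _, hth a, isEl_hullTheta a⟩
    · exact Or.inr ⟨_, _, _, (hth a).symm, (isEl_hullTheta a).inv⟩
  | mul x y hx hy ihx ihy => exact IsNormal.mul ihx ihy

/-- Every nonzero element of the inverse hull is of the form `el M u Z v`. -/
theorem eq_zero_or_eq_el [Finite A] (hM : IsMarkovTransitionMatrix M) (s : InverseHull M) :
    s = 0 ∨ ∃ u Z v, Good M u Z v ∧ s = el M u Z v := by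
  rcases isNormal hM s with h | ⟨u, Z, v, h1, h2⟩
  · exact Or.inl h
  · exact Or.inr ⟨u, Z, v, h1, h2.eq (isEl_el h1)⟩

end NormalForm

/-! ### Green's relations and the natural order on normal forms -/

section Green

variable {S : Type*}

theorem IdemLE.antisymm [Mul S] {e f : S} (h : IdemLE e f) (h' : IdemLE f e) : e = f :=
  h.2.symm.trans h'.1

theorem IdemLE.trans [Semigroup S] {e f g : S} (h : IdemLE e f) (h' : IdemLE f g) :
    IdemLE e g :=
  ⟨by rw [← h.1, mul_assoc, h'.1], by rw [← h.2, ← mul_assoc, h'.2]⟩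

theorem IdemLE.refl [Mul S] {e : S} (h : IsIdempotentElem e) : IdemLE e e := ⟨h, h⟩

theorem idemLE_mul_self_left [InverseSemigroup S] {e f : S} (he : IsIdempotentElem e)
    (hf : IsIdempotentElem f) : IdemLE (e * f) e :=
  ⟨by rw [idem_comm he hf, mul_assoc, he], by rw [← mul_assoc, he]⟩

theorem GreenL.inv_mul_self_eq [InverseSemigroup S] {s t : S} (h : GreenL s t) :
    s⁻¹ * s = t⁻¹ * t := by
  rcases h with rfl | ⟨⟨x, hx⟩, ⟨y, hy⟩⟩
  · rfl
  · refine IdemLE.antisymm ?_ ?_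
    · rw [hx]
      exact idemLE_mul_left (.refl (inv_mul_idem t))
    · rw [hy]
      exact idemLE_mul_left (.refl (inv_mul_idem s))

theorem GreenR.mul_inv_self_eq [InverseSemigroup S] {s t : S} (h : GreenR s t) :
    s * s⁻¹ = t * t⁻¹ := by
  rcases h with rfl | ⟨⟨x, hx⟩, ⟨y, hy⟩⟩
  · rfl
  · refine IdemLE.antisymm ?_ ?_
    · rw [hx]
      exact idemLE_mul_right (.refl (mul_inv_idem t))
    · rw [hy]
      exact idemLE_mul_right (.refl (mul_inv_idem s))

theorem dClass_eq_iff [Semigroup S] {s t : S} : dClass s = dClass t ↔ GreenD s t :=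
  Quotient.eq (r := greenDSetoid S)

theorem dClass_eq_zero_iff [InverseSemigroupWithZero S] {s : S} :
    dClass s = dClass (0 : S) ↔ s = 0 := by
  refine ⟨fun h => ?_, fun h => by rw [h]⟩
  obtain ⟨z, h1, h2⟩ := dClass_eq_iff.1 h
  have hz := h2.mul_inv_self_eq
  rw [zero_mul] at hz
  have hz' : z = 0 := by rw [← InverseSemigroup.mul_inv_mul z, hz, zero_mul]
  have hs := h1.inv_mul_self_eq
  rw [hz', mul_zero] at hs
  rw [← InverseSemigroup.mul_inv_mul s, mul_assoc, hs, mul_zero]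

end Green

section NormalForm

variable {A : Type*} {M : Matrix A A ℕ} [Finite A]

theorem hrel_el {u v : List A} {Z : Set A} (h : Good M u Z v) {x y : List A} :
    HRel (el M u Z v) x y ↔ ∃ w, IsW M Z w ∧ x = v ++ w ∧ y = u ++ w := isEl_el h x y

theorem hrel_el_append {u v w : List A} {Z : Set A} (h : Good M u Z v) (hw : IsW M Z w) :
    HRel (el M u Z v) (v ++ w) (u ++ w) := (hrel_el h).2 ⟨w, hw, rfl, rfl⟩

theorem el_ne_zero {u v : List A} {Z : Set A} (h : Good M u Z v) : el M u Z v ≠ 0 := fun h0 => by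
  obtain ⟨z, hz⟩ := h.mem.1
  have := hrel_el_append h (isW_singleton.2 hz)
  rw [h0] at this
  exact not_hrel_zero this

theorem el_inv {u v : List A} {Z : Set A} (h : Good M u Z v) :
    (el M u Z v)⁻¹ = el M v Z u := (isEl_el h).inv.eq (isEl_el h.symm)

theorem el_mul {u v w : List A} {Z : Set A} (h : Good M u Z v) (h' : Good M v Z w) :
    el M u Z v * el M v Z w = el M u Z w := by
  have := (isEl_el h).mul_inter (isEl_el h')
  rw [Set.inter_self] at this
  exact this.eq (isEl_el ⟨h.mem, h.left, h'.right⟩)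

/-- The element `v ++ w ↦ u ++ w` is a restriction of `s`. -/
def Sub (s : InverseHull M) (u : List A) (Z : Set A) (v : List A) : Prop :=
  ∀ w, IsW M Z w → HRel s (v ++ w) (u ++ w)

theorem sub_el_iff {a b u v : List A} {Y Z : Set A} (h : Good M a Y b) (hZ : Z.Nonempty) :
    Sub (el M a Y b) u Z v ↔ ∃ k, u = a ++ k ∧ v = b ++ k ∧ Bel M Y k Z := by
  constructor
  · intro hs
    have key : ∀ z ∈ Z, ∃ k, u = a ++ k ∧ v = b ++ k ∧ IsW M Y (k ++ [z]) := by
      intro z hz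
      obtain ⟨w, hw, h1, h2⟩ := (hrel_el h).1 (hs [z] (isW_singleton.2 hz))
      obtain ⟨k, c, rfl⟩ := (List.eq_nil_or_concat w).resolve_left hw.ne_nil
      rw [List.concat_eq_append] at *
      rw [← List.append_assoc] at h1 h2
      have h3 := List.append_inj' h1 rfl
      have h4 := List.append_inj' h2 rfl
      rw [List.cons.inj h3.2 |>.1]
      exact ⟨k, h4.1, h3.1, hw⟩
    obtain ⟨z, hz⟩ := hZ
    obtain ⟨k, rfl, rfl, -⟩ := key z hz
    refine ⟨k, rfl, rfl, fun z hz => ?_⟩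
    obtain ⟨k', h1, -, h2⟩ := key z hz
    rwa [List.append_cancel_left h1]
  · rintro ⟨k, rfl, rfl, hb⟩ w hw
    rw [List.append_assoc, List.append_assoc]
    exact hrel_el_append h (hb.isW hw)

theorem Sub.self {u v : List A} {Z : Set A} (h : Good M u Z v) : Sub (el M u Z v) u Z v :=
  fun _ hw => hrel_el_append h hw

theorem el_inj {u v u' v' : List A} {Z Z' : Set A} (h : Good M u Z v)
    (he : el M u Z v = el M u' Z' v') : u = u' ∧ Z = Z' ∧ v = v' := by
  have h' : Good M u' Z' v' := by
    by_contra hn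
    refine el_ne_zero h (he.trans ?_)
    rw [el, dif_neg (fun h => hn h.1)]
  obtain ⟨k, h1, h2, h3⟩ := (sub_el_iff h' h.mem.1).1 (he ▸ Sub.self h)
  obtain ⟨k', h4, h5, h6⟩ := (sub_el_iff h h'.mem.1).1 (he.symm ▸ Sub.self h')
  rw [h1, List.append_assoc, List.self_eq_append_right, List.append_eq_nil_iff] at h4
  obtain ⟨rfl, rfl⟩ := h4
  rw [bel_nil] at h3 h6
  exact ⟨by simpa using h1, h3.antisymm h6, by simpa using h2⟩

omit [Finite A] in
theorem good_self_of {u : List A} {Z : Set A} (hZ : Z ∈ Fam M) (h : Pre M u Z) : Good M u Z u :=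
  ⟨hZ, h, h⟩

omit [Finite A] in
theorem good_nil {Z : Set A} (hZ : Z ∈ Fam M) : Good M [] Z [] := ⟨hZ, pre_nil, pre_nil⟩

theorem isIdempotentElem_el {u : List A} {Z : Set A} (h : Good M u Z u) :
    IsIdempotentElem (el M u Z u) := el_mul h h

theorem isIdempotentElem_cases (hM : IsMarkovTransitionMatrix M) {e : InverseHull M}
    (he : IsIdempotentElem e) : e = 0 ∨ ∃ u Z, Good M u Z u ∧ e = el M u Z u := by
  rcases eq_zero_or_eq_el hM e with h | ⟨u, Z, v, h, rfl⟩
  · exact Or.inl h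
  · have h1 := idem_eq_inv he
    rw [el_inv h] at h1
    obtain ⟨rfl, -, -⟩ := el_inj h h1
    exact Or.inr ⟨u, Z, h, rfl⟩

omit [Finite A] in
theorem HRel.injective {s : InverseHull M} {x y z : List A} (h : HRel s x z) (h' : HRel s y z) :
    x = y := (hrel_inv.2 h).unique (hrel_inv.2 h')

theorem idemLE_iff_sub {u : List A} {Z : Set A} (h : Good M u Z u) {f : InverseHull M} :
    IdemLE (el M u Z u) f ↔ Sub f u Z u := by
  constructor
  · intro hle w hw
    have h1 := hrel_el_append h hw
    rw [← hle.2, hrel_mul] at h1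
    obtain ⟨z, h2, h3⟩ := h1
    rwa [h2.unique (hrel_el_append h hw)] at h3
  · intro hs
    constructor
    · refine hull_ext fun x y => ?_
      rw [hrel_mul, hrel_el h]
      constructor
      · rintro ⟨z, h1, h2⟩
        obtain ⟨w, hw, rfl, rfl⟩ := (hrel_el h).1 h2
        exact ⟨w, hw, h1.injective (hs w hw), rfl⟩
      · rintro ⟨w, hw, rfl, rfl⟩
        exact ⟨_, hs w hw, hrel_el_append h hw⟩
    · refine hull_ext fun x y => ?_
      rw [hrel_mul, hrel_el h]
      constructor
      · rintro ⟨z, h1, h2⟩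
        obtain ⟨w, hw, rfl, rfl⟩ := (hrel_el h).1 h1
        exact ⟨w, hw, rfl, h2.unique (hs w hw)⟩
      · rintro ⟨w, hw, rfl, rfl⟩
        exact ⟨_, hrel_el_append h hw, hs w hw⟩

theorem idemLE_el_iff {u v : List A} {Y Z : Set A} (h : Good M u Z u) (h' : Good M v Y v) :
    IdemLE (el M u Z u) (el M v Y v) ↔ ∃ k, u = v ++ k ∧ Bel M Y k Z := by
  rw [idemLE_iff_sub h, sub_el_iff h' h.mem.1]
  exact ⟨fun ⟨k, h1, _, h2⟩ => ⟨k, h1, h2⟩, fun ⟨k, h1, h2⟩ => ⟨k, h1, h1, h2⟩⟩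

theorem idemLE_el_same_iff {u : List A} {Y Z : Set A} (h : Good M u Z u) (h' : Good M u Y u) :
    IdemLE (el M u Z u) (el M u Y u) ↔ Z ⊆ Y := by
  rw [idemLE_el_iff h h']
  constructor
  · rintro ⟨k, h1, h2⟩
    rw [List.self_eq_append_right.1 h1] at h2
    exact bel_nil.1 h2
  · exact fun h => ⟨[], by simp, bel_nil.2 h⟩

theorem el_mul_inter {u : List A} {Y Z : Set A} (h : Good M u Z u) (h' : Good M u Y u)
    (hn : (Z ∩ Y).Nonempty) : el M u Z u * el M u Y u = el M u (Z ∩ Y) u :=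
  ((isEl_el h).mul_inter (isEl_el h')).eq (isEl_el
    (good_self_of (Fam.inter _ h.mem _ h'.mem hn) (h.left.mono Set.inter_subset_left)))

theorem exists_common_of_mul_ne_zero {u v : List A} {Y Z : Set A} (h : Good M u Z u)
    (h' : Good M v Y v) (hn : el M u Z u * el M v Y v ≠ 0) :
    ∃ w w', IsW M Z w ∧ IsW M Y w' ∧ u ++ w = v ++ w' := by
  by_contra hc
  refine hn (eq_zero_of_not_hrel _ fun x y hxy => hc ?_)
  obtain ⟨z, h1, h2⟩ := hrel_mul.1 hxy
  obtain ⟨w', hw', rfl, rfl⟩ := (hrel_el h').1 h1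
  obtain ⟨w, hw, h3, rfl⟩ := (hrel_el h).1 h2
  exact ⟨w, w', hw, hw', h3.symm⟩

theorem inter_nonempty_of_mul_ne_zero {u : List A} {Y Z : Set A} (h : Good M u Z u)
    (h' : Good M u Y u) (hn : el M u Z u * el M u Y u ≠ 0) : (Z ∩ Y).Nonempty := by
  obtain ⟨w, w', h1, h2, h3⟩ := exists_common_of_mul_ne_zero h h' hn
  rw [List.append_cancel_left h3] at h1
  obtain ⟨a, ha, h4⟩ := h1.2
  obtain ⟨b, hb, h5⟩ := h2.2
  rw [h4] at h5
  exact ⟨a, ha, Option.some.inj h5 ▸ hb⟩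

variable (M) in
/-- The `D`-class of the partial identity on the words with first letter in `Z`. -/
noncomputable def cls (Z : Set A) : DClass (InverseHull M) := dClass (el M [] Z [])

theorem dClass_el {u v : List A} {Z : Set A} (h : Good M u Z v) :
    dClass (el M u Z v) = cls M Z := by
  have h0 := good_nil h.mem
  have h1 : Good M [] Z v := ⟨h.mem, pre_nil, h.right⟩
  have h2 : Good M u Z [] := ⟨h.mem, h.left, pre_nil⟩
  exact dClass_eq_iff.2 ⟨el M [] Z v,
    Or.inr ⟨⟨el M u Z [], (el_mul h2 h1).symm⟩, ⟨el M [] Z u, (el_mul h2.symm h).symm⟩⟩,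
    Or.inr ⟨⟨el M [] Z v, (el_mul h0 h1).symm⟩, ⟨el M v Z [], (el_mul h1 h1.symm).symm⟩⟩⟩

theorem cls_ne_zero {Z : Set A} (h : Z ∈ Fam M) : cls M Z ≠ dClass 0 := fun h0 =>
  el_ne_zero (good_nil h) (dClass_eq_zero_iff.1 h0)

theorem cls_inj (hM : IsMarkovTransitionMatrix M) {Y Z : Set A} (hY : Y ∈ Fam M)
    (hZ : Z ∈ Fam M) (h : cls M Y = cls M Z) : Y = Z := by
  obtain ⟨z, h1, h2⟩ := dClass_eq_iff.1 h
  have h3 := h1.inv_mul_self_eq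
  have h4 := h2.mul_inv_self_eq
  rw [el_inv (good_nil hY), el_mul (good_nil hY) (good_nil hY)] at h3
  rw [el_inv (good_nil hZ), el_mul (good_nil hZ) (good_nil hZ)] at h4
  rcases eq_zero_or_eq_el hM z with rfl | ⟨u, X, v, hz, rfl⟩
  · rw [mul_zero] at h3
    exact (el_ne_zero (good_nil hY) h3).elim
  · rw [el_inv hz, el_mul hz.symm hz] at h3
    rw [el_inv hz, el_mul hz hz.symm] at h4
    exact (el_inj (good_nil hY) h3).2.1.trans (el_inj (good_nil hZ) h4.symm).2.1.symm

theorem eq_zero_or_eq_cls (hM : IsMarkovTransitionMatrix M) (a : DClass (InverseHull M)) :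
    a = dClass 0 ∨ ∃ Z ∈ Fam M, a = cls M Z := by
  induction a using Quotient.inductionOn with
  | h s =>
    rcases eq_zero_or_eq_el hM s with rfl | ⟨u, Z, v, h, rfl⟩
    · exact Or.inl rfl
    · exact Or.inr ⟨Z, h.mem, dClass_el h⟩

/-! ### Representatives of the `D`-classes -/

theorem el_singleton_mem_rangeIdempotents (hM : IsMarkovTransitionMatrix M) (a : A) :
    hullTheta M a * (hullTheta M a)⁻¹ = el M [a] (foll M a) [a] := by
  have := (isEl_hullTheta (M := M) a).mul_inter (isEl_hullTheta a).inv
  rw [Set.inter_self] at this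
  exact this.eq (isEl_el (good_self_of (foll_mem_fam hM a) (pre_singleton.2 subset_rfl)))

omit [Finite A] in
theorem good_letter (hM : IsMarkovTransitionMatrix M) (a : A) : Good M [a] (foll M a) [a] :=
  good_self_of (foll_mem_fam hM a) (pre_singleton.2 subset_rfl)

theorem letter_le (hM : IsMarkovTransitionMatrix M) {a : A} {Z : Set A} (hZ : Z ∈ Fam M)
    (ha : a ∈ Z) : IdemLE (el M [a] (foll M a) [a]) (el M [] Z []) :=
  (idemLE_el_iff (good_letter hM a) (good_nil hZ)).2 ⟨[a], rfl,
    (bel_cons (foll_mem_fam hM a).1).2 ⟨ha, pre_singleton.2 subset_rfl⟩⟩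

/-- The idempotents in `𝒪^↑` have words of length at most one, and `𝒪` takes away those of length
one. -/
theorem mem_hullReps (hM : IsMarkovTransitionMatrix M) {e : InverseHull M} :
    e ∈ hullReps M ↔ e = 0 ∨ ∃ Z ∈ Fam M, e = el M [] Z [] := by
  constructor
  · rintro (⟨⟨he, o, ⟨a, rfl⟩, hle⟩, hno⟩ | h)
    · rcases isIdempotentElem_cases hM he with h | ⟨u, Z, h, rfl⟩
      · exact Or.inl h
      · change IdemLE (hullTheta M a * (hullTheta M a)⁻¹) _ at hle
        rw [el_singleton_mem_rangeIdempotents hM, idemLE_el_iff (good_letter hM a) h] at hle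
        obtain ⟨k, h1, h2⟩ := hle
        cases u with
        | nil => exact Or.inr ⟨Z, h.mem, rfl⟩
        | cons b u =>
          rw [List.cons_append, List.cons.injEq, List.nil_eq_append_iff] at h1
          obtain ⟨rfl, rfl, rfl⟩ := h1
          refine (hno ⟨a, ?_⟩).elim
          change hullTheta M a * (hullTheta M a)⁻¹ = _
          rw [el_singleton_mem_rangeIdempotents hM,
            (bel_nil.1 h2).antisymm (pre_singleton.1 h.left)]
    · exact Or.inl h
  · rintro (rfl | ⟨Z, hZ, rfl⟩)
    · exact Or.inr rfl
    · obtain ⟨a, ha⟩ := hZ.1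
      refine Or.inl ⟨⟨isIdempotentElem_el (good_nil hZ), _, ⟨a, rfl⟩, ?_⟩, ?_⟩
      · change IdemLE (hullTheta M a * (hullTheta M a)⁻¹) _
        rw [el_singleton_mem_rangeIdempotents hM]
        exact letter_le hM hZ ha
      · rintro ⟨b, hb⟩
        change hullTheta M b * (hullTheta M b)⁻¹ = _ at hb
        rw [el_singleton_mem_rangeIdempotents hM] at hb
        exact absurd (el_inj (good_letter hM b) hb).1 (by simp)

theorem rep_cls (hM : IsMarkovTransitionMatrix M) {Z : Set A} (hZ : Z ∈ Fam M) :
    rep (hullReps M) (cls M Z) = el M [] Z [] := by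
  have h : ∃ e ∈ hullReps M, dClass e = cls M Z :=
    ⟨_, (mem_hullReps hM).2 (Or.inr ⟨Z, hZ, rfl⟩), rfl⟩
  rw [rep, dif_pos h]
  obtain ⟨h1, h2⟩ := h.choose_spec
  rcases (mem_hullReps hM).1 h1 with h3 | ⟨Y, hY, h3⟩
  · rw [h3] at h2
    exact (cls_ne_zero hZ h2.symm).elim
  · rw [h3] at h2
    rw [h3, cls_inj hM hY hZ h2]

omit [Finite A] in
theorem rep_zero : rep (hullReps M) (dClass 0) = 0 := by
  have h : ∃ e ∈ hullReps M, dClass e = dClass 0 := ⟨0, Or.inr rfl, rfl⟩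
  rw [rep, dif_pos h]
  exact dClass_eq_zero_iff.1 h.choose_spec.2

theorem dClass_rep (hM : IsMarkovTransitionMatrix M) (a : DClass (InverseHull M)) :
    dClass (rep (hullReps M) a) = a := by
  rcases eq_zero_or_eq_cls hM a with rfl | ⟨Z, hZ, rfl⟩
  · rw [rep_zero]
  · rw [rep_cls hM hZ]
    rfl

theorem isIdempotentElem_rep (hM : IsMarkovTransitionMatrix M) (a : DClass (InverseHull M)) :
    IsIdempotentElem (rep (hullReps M) a) := by
  rcases eq_zero_or_eq_cls hM a with rfl | ⟨Z, hZ, rfl⟩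
  · rw [rep_zero]
    exact zero_mul 0
  · rw [rep_cls hM hZ]
    exact isIdempotentElem_el (good_nil hZ)

/-! ### Covers and cores in the inverse hull -/

theorem immBelow_el_of_cov (hM : IsMarkovTransitionMatrix M) {u : List A} {X Y : Set A}
    (hX : Good M u X u) (h : Cov (Fam M) Y X) : ImmBelow (el M u Y u) (el M u X u) := by
  have hY : Good M u Y u := good_self_of h.left_mem (hX.left.mono h.subset)
  refine ⟨isIdempotentElem_el hY, isIdempotentElem_el hX, (idemLE_el_same_iff hY hX).2 h.subset,
    fun he => h.ne (el_inj hY he).2.1, fun g hg h1 h2 => ?_⟩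
  rcases isIdempotentElem_cases hM hg with rfl | ⟨v, W, hW, rfl⟩
  · refine absurd ?_ (el_ne_zero hY)
    rw [← h1.1, mul_zero]
  obtain ⟨k, h3, h4⟩ := (idemLE_el_iff hY hW).1 h1
  obtain ⟨k', h5, h6⟩ := (idemLE_el_iff hW hX).1 h2
  rw [h5, List.append_assoc, List.self_eq_append_right, List.append_eq_nil_iff] at h3
  obtain ⟨rfl, rfl⟩ := h3
  rw [List.append_nil] at h5
  subst h5
  rw [bel_nil] at h4 h6
  rcases h.eq_or_eq W hW.mem h4 h6 with rfl | rfl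
  · exact Or.inl rfl
  · exact Or.inr rfl

theorem immBelow_letter (hM : IsMarkovTransitionMatrix M) {a : A} {X : Set A} (hX : X ∈ Fam M)
    (ha : a ∈ X) (h : ∀ Y ∈ Fam M, a ∈ Y → Y ⊆ X → Y = X) :
    ImmBelow (el M [a] (foll M a) [a]) (el M [] X []) := by
  refine ⟨isIdempotentElem_el (good_letter hM a), isIdempotentElem_el (good_nil hX),
    letter_le hM hX ha, fun he => absurd (el_inj (good_letter hM a) he).1 (by simp),
    fun g hg h1 h2 => ?_⟩
  rcases isIdempotentElem_cases hM hg with rfl | ⟨v, W, hW, rfl⟩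
  · refine absurd ?_ (el_ne_zero (good_letter hM a))
    rw [← h1.1, mul_zero]
  obtain ⟨k, h3, h4⟩ := (idemLE_el_iff (good_letter hM a) hW).1 h1
  obtain ⟨k', h5, h6⟩ := (idemLE_el_iff hW (good_nil hX)).1 h2
  rw [List.nil_append] at h5
  subst h5
  cases v with
  | nil =>
    rw [List.nil_append] at h3
    subst h3
    exact Or.inr (by rw [h W hW.mem ((bel_cons (foll_mem_fam hM a).1).1 h4).1 (bel_nil.1 h6)])
  | cons b v =>
    rw [List.cons_append, List.cons.injEq, List.nil_eq_append_iff] at h3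
    obtain ⟨rfl, rfl, rfl⟩ := h3
    exact Or.inl (by rw [(pre_singleton.1 hW.left).antisymm (bel_nil.1 h4)])

/-- The idempotents immediately below the identity on the words that start with `u`, followed by a
letter in `X`: either the set `X` is cut down, or a letter is added to `u`. -/
theorem ImmBelow.cases (hM : IsMarkovTransitionMatrix M) {u : List A} {X : Set A}
    {f : InverseHull M} (hX : Good M u X u) (h : ImmBelow f (el M u X u)) (hf : f ≠ 0) :
    (∃ Y, Cov (Fam M) Y X ∧ f = el M u Y u) ∨
      ∃ a ∈ X, f = el M (u ++ [a]) (foll M a) (u ++ [a]) ∧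
        Good M (u ++ [a]) (foll M a) (u ++ [a]) ∧ ∀ Y ∈ Fam M, a ∈ Y → Y ⊆ X → Y = X := by
  obtain ⟨hif, -, hle, hne, hmin⟩ := h
  obtain ⟨v, Z, hZ, rfl⟩ := (isIdempotentElem_cases hM hif).resolve_left hf
  obtain ⟨k, rfl, hk⟩ := (idemLE_el_iff hZ hX).1 hle
  cases k with
  | nil =>
    rw [List.append_nil] at *
    refine Or.inl ⟨Z, ⟨hZ.mem, hX.mem, bel_nil.1 hk, fun he => hne (by rw [he]),
      fun W hW h1 h2 => ?_⟩, rfl⟩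
    have hW' : Good M u W u := good_self_of hW (hX.left.mono h2)
    rcases hmin _ (isIdempotentElem_el hW') ((idemLE_el_same_iff hZ hW').2 h1)
      ((idemLE_el_same_iff hW' hX).2 h2) with h3 | h3
    · exact Or.inl (el_inj hW' h3).2.1
    · exact Or.inr (el_inj hW' h3).2.1
  | cons a k =>
    obtain ⟨ha, hak⟩ := (bel_cons hZ.mem.1).1 hk
    have hb : Bel M X [a] (foll M a) :=
      (bel_cons (foll_mem_fam hM a).1).2 ⟨ha, pre_singleton.2 subset_rfl⟩
    have hg : Good M (u ++ [a]) (foll M a) (u ++ [a]) :=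
      good_self_of (foll_mem_fam hM a) (hX.left.append hb)
    have hle' : IdemLE (el M (u ++ a :: k) Z (u ++ a :: k))
        (el M (u ++ [a]) (foll M a) (u ++ [a])) := by
      refine (idemLE_el_iff hZ hg).2 ⟨k, by simp, fun z hz => ?_⟩
      rw [isW_foll]
      exact ⟨by simp, hak z hz⟩
    refine Or.inr ⟨a, ha, ?_, hg, fun Y hY haY hYX => ?_⟩
    · rcases hmin _ (isIdempotentElem_el hg) hle' ((idemLE_el_iff hg hX).2 ⟨[a], rfl, hb⟩)
        with h1 | h1
      · exact h1.symm
      · exact absurd (el_inj hg h1).1 (by simp)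
    · have hY' : Good M u Y u := good_self_of hY (hX.left.mono hYX)
      rcases hmin _ (isIdempotentElem_el hY') ((idemLE_el_iff hZ hY').2 ⟨_, rfl,
        (bel_cons hZ.mem.1).2 ⟨haY, hak⟩⟩) ((idemLE_el_same_iff hY' hX).2 hYX) with h1 | h1
      · exact absurd (el_inj hY' h1).1 (by simp)
      · exact (el_inj hY' h1).2.1

theorem isCoreSet_image_coreF (hM : IsMarkovTransitionMatrix M) {u : List A} {X : Set A}
    (hX : Good M u X u) :
    IsCoreSet (el M u X u) {f | ∃ Y, CoreF (Fam M) X Y ∧ f = el M u Y u} := by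
  have good : ∀ {Y}, CoreF (Fam M) X Y → Good M u Y u := fun {Y} hY => by
    have := hY.mem Fam.inter hX.mem
    exact good_self_of this.1 (hX.left.mono this.2)
  -- of two incomparable idempotents with nonzero product, neither arises by adding a letter
  have diam : ∀ {H₁ H₂}, CoreF (Fam M) X H₁ → CoreF (Fam M) X H₂ → ∀ {f g},
      ImmBelow f (el M u H₁ u) → ImmBelow g (el M u H₂ u) → ¬ IdemLE f g → ¬ IdemLE g f →
      f * g ≠ 0 → ∃ Y, CoreF (Fam M) X Y ∧ f = el M u Y u := by
    intro H₁ H₂ h₁ h₂ f g hf hg hfg hgf hn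
    have hf0 : f ≠ 0 := fun h => hn (by rw [h, zero_mul])
    have hg0 : g ≠ 0 := fun h => hn (by rw [h, mul_zero])
    rcases hf.cases hM (good h₁) hf0 with ⟨Y, hY, rfl⟩ | ⟨a, ha, rfl, hga, -⟩ <;>
      rcases hg.cases hM (good h₂) hg0 with ⟨Z, hZ, rfl⟩ | ⟨b, hb, rfl, hgb, -⟩
    · have hY' : Good M u Y u := good_self_of hY.left_mem ((good h₁).left.mono hY.subset)
      have hZ' : Good M u Z u := good_self_of hZ.left_mem ((good h₂).left.mono hZ.subset)
      rw [idemLE_el_same_iff hY' hZ'] at hfg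
      rw [idemLE_el_same_iff hZ' hY'] at hgf
      exact ⟨Y, .diamond h₁ h₂ hY hZ hfg hgf (inter_nonempty_of_mul_ne_zero hY' hZ' hn), rfl⟩
    · have hY' : Good M u Y u := good_self_of hY.left_mem ((good h₁).left.mono hY.subset)
      obtain ⟨w, w', h1, h2, h3⟩ := exists_common_of_mul_ne_zero hY' hgb hn
      rw [List.append_assoc] at h3
      rw [List.append_cancel_left h3] at h1
      obtain ⟨c, hc, h4⟩ := h1.2
      obtain rfl : b = c := Option.some.inj h4
      exact (hgf ((idemLE_el_iff hgb hY').2 ⟨[b], rfl,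
        (bel_cons (foll_mem_fam hM b).1).2 ⟨hc, pre_singleton.2 subset_rfl⟩⟩)).elim
    · have hZ' : Good M u Z u := good_self_of hZ.left_mem ((good h₂).left.mono hZ.subset)
      obtain ⟨w, w', h1, h2, h3⟩ := exists_common_of_mul_ne_zero hga hZ' hn
      rw [List.append_assoc] at h3
      rw [← List.append_cancel_left h3] at h2
      obtain ⟨c, hc, h4⟩ := h2.2
      obtain rfl : a = c := Option.some.inj h4
      exact (hfg ((idemLE_el_iff hga hZ').2 ⟨[a], rfl,
        (bel_cons (foll_mem_fam hM a).1).2 ⟨hc, pre_singleton.2 subset_rfl⟩⟩)).elim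
    · obtain ⟨w, w', h1, h2, h3⟩ := exists_common_of_mul_ne_zero hga hgb hn
      rw [List.append_assoc, List.append_assoc] at h3
      have h4 := List.append_cancel_left h3
      rw [List.singleton_append, List.singleton_append, List.cons.injEq] at h4
      rw [h4.1] at hfg
      exact (hfg (.refl (isIdempotentElem_el hgb))).elim
  refine ⟨?_, ⟨X, .self, rfl⟩, ?_, ?_, ?_⟩
  · rintro f ⟨Y, hY, rfl⟩
    exact ⟨isIdempotentElem_el (good hY), (idemLE_el_same_iff (good hY) hX).2
      (hY.mem Fam.inter hX.mem).2⟩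
  · rintro f ⟨Y, hY, rfl⟩ g ⟨Z, hZ, rfl⟩ hn
    have hn' := inter_nonempty_of_mul_ne_zero (good hY) (good hZ) hn
    exact ⟨_, .inter hY hZ hn', el_mul_inter (good hY) (good hZ) hn'⟩
  · rintro h₁ ⟨H₁, hH₁, rfl⟩ h₂ ⟨H₂, hH₂, rfl⟩ f g hf hg hfg hgf hn
    exact ⟨diam hH₁ hH₂ hf hg hfg hgf hn, diam hH₂ hH₁ hg hf hgf hfg
      (by rwa [idem_comm hg.1 hf.1])⟩
  · rintro f ⟨Y, hY, rfl⟩ g ⟨Z, hZ, rfl⟩ h hh h1 h2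
    rcases isIdempotentElem_cases hM hh with rfl | ⟨v, W, hW, rfl⟩
    · refine absurd ?_ (el_ne_zero (good hY))
      rw [← h1.1, mul_zero]
    obtain ⟨k, h3, h4⟩ := (idemLE_el_iff (good hY) hW).1 h1
    obtain ⟨k', h5, h6⟩ := (idemLE_el_iff hW (good hZ)).1 h2
    rw [h5, List.append_assoc, List.self_eq_append_right, List.append_eq_nil_iff] at h3
    obtain ⟨rfl, rfl⟩ := h3
    rw [List.append_nil] at h5
    subst h5
    exact ⟨W, .convex hY hZ hW.mem (bel_nil.1 h4) (bel_nil.1 h6), rfl⟩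

/-- Letters added to `u` never enter the core: only the subsets of `X` matter. -/
theorem mem_core_el_iff (hM : IsMarkovTransitionMatrix M) {u : List A} {X : Set A}
    (hX : Good M u X u) {f : InverseHull M} :
    f ∈ core (el M u X u) ↔ ∃ Y, CoreF (Fam M) X Y ∧ f = el M u Y u := by
  refine ⟨fun h => h _ (isCoreSet_image_coreF hM hX), ?_⟩
  rintro ⟨Y, hY, rfl⟩ C hC
  have good : ∀ {Y}, CoreF (Fam M) X Y → Good M u Y u := fun {Y} hY => by
    have := hY.mem Fam.inter hX.mem
    exact good_self_of this.1 (hX.left.mono this.2)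
  induction hY with
  | self => exact hC.self_mem
  | inter h1 h2 hn ih1 ih2 =>
    rw [← el_mul_inter (good h1) (good h2) hn]
    refine hC.mul_mem _ ih1 _ ih2 ?_
    rw [el_mul_inter (good h1) (good h2) hn]
    exact el_ne_zero (good (.inter h1 h2 hn))
  | @diamond H₁ H₂ Y Z h1 h2 h3 h4 h5 h6 hn ih1 ih2 =>
    have gY := good (.diamond h1 h2 h3 h4 h5 h6 hn)
    have gZ : Good M u Z u := good_self_of h4.left_mem ((good h2).left.mono h4.subset)
    refine (hC.diamond _ ih1 _ ih2 _ (el M u Z u) (immBelow_el_of_cov hM (good h1) h3)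
      (immBelow_el_of_cov hM (good h2) h4) ?_ ?_ ?_).1
    · rwa [idemLE_el_same_iff gY gZ]
    · rwa [idemLE_el_same_iff gZ gY]
    · rw [el_mul_inter gY gZ hn]
      exact el_ne_zero (good_self_of (Fam.inter _ gY.mem _ gZ.mem hn)
        (gY.left.mono Set.inter_subset_left))
  | convex h1 h2 hW h3 h4 ih1 ih2 =>
    have gW := good (.convex h1 h2 hW h3 h4)
    exact hC.convex _ ih1 _ ih2 _ (isIdempotentElem_el gW)
      ((idemLE_el_same_iff (good h1) gW).2 h3) ((idemLE_el_same_iff gW (good h2)).2 h4)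

end NormalForm

/-! ### The order on the `D`-classes of the inverse hull -/

section Order

theorem eq_zero_of_mem_core_zero {S : Type*} [InverseSemigroupWithZero S] {f : S}
    (hf : f ∈ core (0 : S)) : f = 0 := by
  refine hf {0} ⟨?_, rfl, ?_, ?_, ?_⟩
  · rintro f rfl
    exact ⟨zero_mul 0, zero_mul 0, zero_mul 0⟩
  · rintro f rfl g - hn
    exact (hn (zero_mul g)).elim
  · rintro h₁ rfl h₂ rfl f g hf
    exact (hf.2.2.2.1 (hf.2.2.1.1.symm.trans (mul_zero f))).elim
  · rintro e₁ - e₂ rfl g - - h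
    exact h.1.symm.trans (mul_zero g)

theorem prec_zero_left {S : Type*} [InverseSemigroupWithZero S] (a : DClass S) :
    Prec (dClass 0) a := Or.inr rfl

variable {A : Type*} {M : Matrix A A ℕ} [Finite A] (hM : IsMarkovTransitionMatrix M)
include hM

theorem precAux_iff {a b : DClass (InverseHull M)} : PrecAux a b ↔ (a = dClass 0 ∧ b = dClass 0) ∨
    ∃ X ∈ Fam M, ∃ Y Z, CoreF (Fam M) X Y ∧ CoreF (Fam M) X Z ∧ Y ⊆ Z ∧
      a = cls M Y ∧ b = cls M Z := by
  have good : ∀ {u X Y}, Good M u X u → CoreF (Fam M) X Y → Good M u Y u := fun hX hY => by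
    have := hY.mem Fam.inter hX.mem
    exact good_self_of this.1 (hX.left.mono this.2)
  constructor
  · rintro ⟨e, he, f, hf, g, hg, rfl, rfl, hle⟩
    rcases isIdempotentElem_cases hM he with rfl | ⟨u, X, hX, rfl⟩
    · rw [eq_zero_of_mem_core_zero hf, eq_zero_of_mem_core_zero hg]
      exact Or.inl ⟨rfl, rfl⟩
    · obtain ⟨Y, hY, rfl⟩ := (mem_core_el_iff hM hX).1 hf
      obtain ⟨Z, hZ, rfl⟩ := (mem_core_el_iff hM hX).1 hg
      exact Or.inr ⟨X, hX.mem, Y, Z, hY, hZ,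
        (idemLE_el_same_iff (good hX hY) (good hX hZ)).1 hle, dClass_el (good hX hY),
        dClass_el (good hX hZ)⟩
  · rintro (⟨rfl, rfl⟩ | ⟨X, hX, Y, Z, hY, hZ, hle, rfl, rfl⟩)
    · have h0 : (0 : InverseHull M) ∈ core 0 := fun C hC => hC.self_mem
      exact ⟨0, zero_mul 0, 0, h0, 0, h0, rfl, rfl, zero_mul 0, zero_mul 0⟩
    · have hX' := good_nil hX
      exact ⟨_, isIdempotentElem_el hX', _, (mem_core_el_iff hM hX').2 ⟨Y, hY, rfl⟩, _,
        (mem_core_el_iff hM hX').2 ⟨Z, hZ, rfl⟩, rfl, rfl,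
        (idemLE_el_same_iff (good hX' hY) (good hX' hZ)).2 hle⟩

theorem prec_cls_iff {Y Z : Set A} (hY : Y ∈ Fam M) (hZ : Z ∈ Fam M) :
    Prec (cls M Y) (cls M Z) ↔ PrecF (Fam M) Y Z := by
  constructor
  · rintro (h | h)
    · have key : ∀ a b, Relation.TransGen PrecAux a b → ∀ Y ∈ Fam M, a = cls M Y →
          ∃ Z ∈ Fam M, b = cls M Z ∧ PrecF (Fam M) Y Z := by
        have step : ∀ a b, PrecAux a b → ∀ Y ∈ Fam M, a = cls M Y →
            ∃ Z ∈ Fam M, b = cls M Z ∧ PrecF (Fam M) Y Z := by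
          rintro a b h Y hY rfl
          rcases (precAux_iff hM).1 h with ⟨h1, -⟩ | ⟨X, hX, Y', Z, h1, h2, h3, h4, h5⟩
          · exact (cls_ne_zero hY h1).elim
          · obtain rfl := cls_inj hM hY (h1.mem Fam.inter hX).1 h4
            exact ⟨Z, (h2.mem Fam.inter hX).1, h5, .single ⟨X, hX, h1, h2, h3⟩⟩
        intro a b h Y hY ha
        induction h with
        | single h => exact step _ _ h Y hY ha
        | tail _ h ih =>
          obtain ⟨Z, hZ, h1, h2⟩ := ih
          obtain ⟨W, hW, h3, h4⟩ := step _ _ h Z hZ h1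
          exact ⟨W, hW, h3, h2.trans h4⟩
      obtain ⟨Z', hZ', h1, h2⟩ := key _ _ h Y hY rfl
      rwa [cls_inj hM hZ hZ' h1]
    · exact (cls_ne_zero hY h).elim
  · intro h
    refine Or.inl (Relation.TransGen.lift (cls M) ?_ _ _ h)
    rintro Y Z ⟨X, hX, h1, h2, h3⟩
    exact (precAux_iff hM).2 (Or.inr ⟨X, hX, Y, Z, h1, h2, h3, rfl, rfl⟩)

theorem prec_zero_iff {a : DClass (InverseHull M)} : Prec a (dClass 0) ↔ a = dClass 0 := by
  refine ⟨?_, fun h => Or.inr h⟩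
  rintro (h | h)
  · generalize hb : (dClass 0 : DClass (InverseHull M)) = b at h
    have step : ∀ a, PrecAux a (dClass (0 : InverseHull M)) → a = dClass 0 := fun a h => by
      rcases (precAux_iff hM).1 h with ⟨h1, -⟩ | ⟨X, hX, Y, Z, -, h2, -, -, h5⟩
      · exact h1
      · exact (cls_ne_zero (h2.mem Fam.inter hX).1 h5.symm).elim
    induction h with
    | single h =>
      subst hb
      exact step _ h
    | tail _ h ih =>
      subst hb
      exact (ih (step _ h).symm).trans (step _ h)
  · exact h

theorem prec_refl (a : DClass (InverseHull M)) : Prec a a := by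
  rcases eq_zero_or_eq_cls hM a with rfl | ⟨Z, hZ, rfl⟩
  · exact Or.inr rfl
  · exact (prec_cls_iff hM hZ hZ).2 (.refl hZ)

theorem prec_trans {a b c : DClass (InverseHull M)} (h : Prec a b) (h' : Prec b c) :
    Prec a c := by
  rcases h with h | h
  · rcases h' with h' | rfl
    · exact Or.inl (h.trans h')
    · exact Or.inr ((prec_zero_iff hM).1 (Or.inl h))
  · exact Or.inr h

theorem prec_cases {a b : DClass (InverseHull M)} (h : Prec a b) : a = dClass 0 ∨
    ∃ Y ∈ Fam M, ∃ Z ∈ Fam M, a = cls M Y ∧ b = cls M Z ∧ PrecF (Fam M) Y Z := by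
  rcases eq_zero_or_eq_cls hM a with rfl | ⟨Y, hY, rfl⟩
  · exact Or.inl rfl
  rcases eq_zero_or_eq_cls hM b with rfl | ⟨Z, hZ, rfl⟩
  · exact Or.inl ((prec_zero_iff hM).1 h)
  · exact Or.inr ⟨Y, hY, Z, hZ, rfl, rfl, (prec_cls_iff hM hY hZ).1 h⟩

theorem prec_antisymm {a b : DClass (InverseHull M)} (h : Prec a b) (h' : Prec b a) : a = b := by
  rcases prec_cases hM h with rfl | ⟨Y, hY, Z, hZ, rfl, rfl, h1⟩
  · exact ((prec_zero_iff hM).1 h').symm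
  · rw [h1.subset.antisymm ((prec_cls_iff hM hZ hY).1 h').subset]

theorem idemLE_rep_of_prec {a b : DClass (InverseHull M)} (h : Prec a b) :
    IdemLE (rep (hullReps M) a) (rep (hullReps M) b) := by
  rcases prec_cases hM h with rfl | ⟨Y, hY, Z, hZ, rfl, rfl, h1⟩
  · rw [rep_zero]
    exact ⟨zero_mul _, mul_zero _⟩
  · rw [rep_cls hM hY, rep_cls hM hZ, idemLE_el_same_iff (good_nil hY) (good_nil hZ)]
    exact h1.subset

/-- A product of representatives of two classes below `v` is zero or represents a common lower
bound of these classes. -/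
theorem exists_rep_eq_mul {c d v : DClass (InverseHull M)} (hc : Prec c v) (hd : Prec d v)
    (hn : rep (hullReps M) c * rep (hullReps M) d ≠ 0) :
    ∃ g, rep (hullReps M) g = rep (hullReps M) c * rep (hullReps M) d ∧ Prec g c ∧ Prec g d := by
  rcases prec_cases hM hc with rfl | ⟨Y, hY, V, hV, rfl, rfl, h1⟩
  · rw [rep_zero, zero_mul] at hn
    exact (hn rfl).elim
  rcases prec_cases hM hd with rfl | ⟨Z, hZ, V', hV', rfl, h3, h2⟩
  · rw [rep_zero, mul_zero] at hn
    exact (hn rfl).elim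
  obtain rfl := cls_inj hM hV hV' h3
  rw [rep_cls hM hY, rep_cls hM hZ] at hn ⊢
  have h4 := inter_nonempty_of_mul_ne_zero (good_nil hY) (good_nil hZ) hn
  have h5 := Fam.inter _ hY _ hZ h4
  refine ⟨cls M (Y ∩ Z), ?_, (prec_cls_iff hM h5 hY).2 ?_, (prec_cls_iff hM h5 hZ).2 ?_⟩
  · rw [rep_cls hM h5, el_mul_inter (good_nil hY) (good_nil hZ) h4]
  · exact h2.inter_prec Fam.inter hY h1.subset h4
  · rw [Set.inter_comm] at h4 ⊢
    exact h1.inter_prec Fam.inter hZ h2.subset h4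

/-- The classes form a meet semilattice: the meet of two classes with a nonzero common lower bound
belongs to the intersection of the two sets of letters. -/
theorem exists_isMeet (a b : DClass (InverseHull M)) : ∃ c, IsMeet a b c := by
  by_cases h : ∃ d, d ≠ dClass 0 ∧ Prec d a ∧ Prec d b
  · obtain ⟨d, hd, ha, hb⟩ := h
    obtain ⟨D, hD, Y, hY, rfl, rfl, h1⟩ := (prec_cases hM ha).resolve_left hd
    obtain ⟨D', hD', Z, hZ, h0, rfl, h2⟩ := (prec_cases hM hb).resolve_left hd
    obtain rfl := cls_inj hM hD hD' h0
    have hs := Set.subset_inter h1.subset h2.subset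
    have hW := Fam.inter _ hY _ hZ (hD.1.mono hs)
    refine ⟨cls M (Y ∩ Z), (prec_cls_iff hM hW hY).2 ?_, (prec_cls_iff hM hW hZ).2 ?_, ?_⟩
    · exact (h1.of_subset_of_subset Fam.inter hD.1 hW hs Set.inter_subset_left).2
    · exact (h2.of_subset_of_subset Fam.inter hD.1 hW hs Set.inter_subset_right).2
    · intro e ha hb
      rcases prec_cases hM ha with rfl | ⟨E, hE, Y', hY', rfl, h4, h3⟩
      · exact prec_zero_left _
      obtain rfl := cls_inj hM hY hY' h4
      rw [prec_cls_iff hM hE hZ] at hb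
      exact (prec_cls_iff hM hE hW).2 (h3.of_subset_of_subset Fam.inter hE.1 hW
        (Set.subset_inter h3.subset hb.subset) Set.inter_subset_left).1
  · refine ⟨dClass 0, prec_zero_left _, prec_zero_left _, fun d ha hb => ?_⟩
    by_contra hd
    exact h ⟨d, fun h0 => hd (h0 ▸ prec_zero_left _), ha, hb⟩

theorem isMeet_meet (a b : DClass (InverseHull M)) : IsMeet a b (meet a b) := by
  have h := exists_isMeet hM a b
  rw [meet, dif_pos h]
  exact h.choose_spec

theorem meet_eq_of_isMeet {a b c : DClass (InverseHull M)} (h : IsMeet a b c) : meet a b = c := by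
  have h' := isMeet_meet hM a b
  exact prec_antisymm hM (h.2.2 _ h'.1 h'.2.1) (h'.2.2 _ h.1 h.2.1)

theorem meet_comm (a b : DClass (InverseHull M)) : meet a b = meet b a :=
  meet_eq_of_isMeet hM ⟨(isMeet_meet hM b a).2.1, (isMeet_meet hM b a).1,
    fun d h1 h2 => (isMeet_meet hM b a).2.2 d h2 h1⟩

theorem meet_eq_right {a b : DClass (InverseHull M)} (h : Prec b a) : meet a b = b :=
  meet_eq_of_isMeet hM ⟨h, prec_refl hM b, fun _ _ h => h⟩

theorem meet_self (a : DClass (InverseHull M)) : meet a a = a := meet_eq_right hM (prec_refl hM a)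

/-! ### Labels -/

omit [Finite A] hM in
theorem IsLabel.ne_zero {b : DClass (InverseHull M)} {f : InverseHull M}
    (h : IsLabel (hullReps M) b f) : b ≠ dClass 0 := by
  rintro rfl
  have h1 := h.2.1
  rw [rep_zero] at h1
  exact h1.2.2.2.1 (h1.2.2.1.1.symm.trans (mul_zero f))

/-- The two kinds of labels at the class of `X`: subsets covered by `X` but not below `X` for `⪯`,
and letters that lie in `X` but in no smaller member of the family. -/
theorem isLabel_cls_iff {X : Set A} (hX : X ∈ Fam M) {f : InverseHull M} :
    IsLabel (hullReps M) (cls M X) f ↔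
      (∃ Y, Cov (Fam M) Y X ∧ f = el M [] Y [] ∧ ¬ PrecF (Fam M) Y X) ∨
      ∃ a ∈ X, f = el M [a] (foll M a) [a] ∧ ∀ Y ∈ Fam M, a ∈ Y → Y ⊆ X → Y = X := by
  rw [IsLabel, rep_cls hM hX]
  constructor
  · rintro ⟨h0, h1, h2⟩
    rcases h1.cases hM (good_nil hX) h0 with ⟨Y, hY, rfl⟩ | ⟨a, ha, h3, -, h4⟩
    · refine Or.inl ⟨Y, hY, rfl, ?_⟩
      rw [dClass_el (good_nil hY.left_mem), rep_cls hM hY.left_mem,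
        prec_cls_iff hM hY.left_mem hX] at h2
      exact h2.resolve_left fun h => h rfl
    · exact Or.inr ⟨a, ha, h3, h4⟩
  · rintro (⟨Y, hY, rfl, h⟩ | ⟨a, ha, rfl, h⟩)
    · have gY := good_nil hY.left_mem
      refine ⟨el_ne_zero gY, immBelow_el_of_cov hM (good_nil hX) hY, Or.inr ?_⟩
      rwa [dClass_el gY, prec_cls_iff hM hY.left_mem hX]
    · refine ⟨el_ne_zero (good_letter hM a), immBelow_letter hM hX ha h, Or.inl fun he => ?_⟩
      rw [dClass_el (good_letter hM a), rep_cls hM (foll_mem_fam hM a)] at he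
      exact absurd (el_inj (good_letter hM a) he).1 (by simp)

omit hM in
theorem mem_of_mul_letter_ne_zero (hM : IsMarkovTransitionMatrix M) {a : A} {Z : Set A}
    (hZ : Z ∈ Fam M) (hn : el M [] Z [] * el M [a] (foll M a) [a] ≠ 0) : a ∈ Z := by
  obtain ⟨w, w', h1, h2, h3⟩ := exists_common_of_mul_ne_zero (good_nil hZ) (good_letter hM a) hn
  rw [List.nil_append, List.singleton_append] at h3
  rw [h3] at h1
  obtain ⟨c, hc, h4⟩ := h1.2
  rwa [Option.some.inj h4]

/-- A label at `b` is disjoint from every class strictly below `b` for `⪯`; otherwise the diamond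
condition would put the label into the core. -/
theorem IsLabel.rep_mul_eq_zero {a b : DClass (InverseHull M)} {f : InverseHull M}
    (h : IsLabel (hullReps M) b f) (hab : Prec a b) (hne : a ≠ b) :
    rep (hullReps M) a * f = 0 := by
  by_contra hn
  rcases prec_cases hM hab with rfl | ⟨Y, hY, X, hX, rfl, rfl, hYX⟩
  · rw [rep_zero, zero_mul] at hn
    exact hn rfl
  rw [rep_cls hM hY] at hn
  rcases (isLabel_cls_iff hM hX).1 h with ⟨Z, hZ, rfl, hZX⟩ | ⟨c, hc, rfl, hcX⟩
  · have h1 := inter_nonempty_of_mul_ne_zero (good_nil hY) (good_nil hZ.left_mem) hn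
    rw [Set.inter_comm] at h1
    have h2 := (hYX.subset_or_prec Fam.inter hZ.left_mem hZ.subset h1).resolve_right hZX
    rcases hZ.eq_or_eq Y hY h2 hYX.subset with rfl | rfl
    · exact hZX hYX
    · exact hne rfl
  · exact hne (by rw [hcX Y hY (mem_of_mul_letter_ne_zero hM hY hn) hYX.subset])

theorem IsLabel.mul_eq_zero {b : DClass (InverseHull M)} {f g : InverseHull M}
    (hf : IsLabel (hullReps M) b f) (hg : IsLabel (hullReps M) b g) (hne : f ≠ g) :
    f * g = 0 := by
  obtain ⟨X, hX, rfl⟩ := (eq_zero_or_eq_cls hM b).resolve_left (hf.ne_zero)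
  by_contra hn
  have hn' : g * f ≠ 0 := by rwa [idem_comm hg.2.1.1 hf.2.1.1]
  rcases (isLabel_cls_iff hM hX).1 hf with ⟨Y, hY, rfl, hYX⟩ | ⟨a, ha, rfl, haX⟩ <;>
    rcases (isLabel_cls_iff hM hX).1 hg with ⟨Z, hZ, rfl, hZX⟩ | ⟨c, hc, rfl, hcX⟩
  · exact hYX (.of_diamond hY hZ (fun h => hne (by rw [h]))
      (inter_nonempty_of_mul_ne_zero (good_nil hY.left_mem) (good_nil hZ.left_mem) hn))
  · exact hY.ne (hcX Y hY.left_mem (mem_of_mul_letter_ne_zero hM hY.left_mem hn) hY.subset)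
  · exact hZ.ne (haX Z hZ.left_mem (mem_of_mul_letter_ne_zero hM hZ.left_mem hn') hZ.subset)
  · obtain ⟨w, w', h1, h2, h3⟩ :=
      exists_common_of_mul_ne_zero (good_letter hM a) (good_letter hM c) hn
    rw [List.singleton_append, List.singleton_append, List.cons.injEq] at h3
    exact hne (by rw [h3.1])

theorem exists_isLabel_or_prec {b : DClass (InverseHull M)} (hb : b ≠ dClass 0) :
    (∃ f, IsLabel (hullReps M) b f) ∨ ∃ a, a ≠ dClass 0 ∧ a ≠ b ∧ Prec a b := by
  obtain ⟨X, hX, rfl⟩ := (eq_zero_or_eq_cls hM b).resolve_left hb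
  obtain ⟨a, ha⟩ := hX.1
  by_cases h : ∀ Y ∈ Fam M, a ∈ Y → Y ⊆ X → Y = X
  · exact Or.inl ⟨_, (isLabel_cls_iff hM hX).2 (Or.inr ⟨a, ha, rfl, h⟩)⟩
  · push Not at h
    obtain ⟨Y, hY, -, hYX, hne⟩ := h
    obtain ⟨K, hK, -⟩ := exists_cov hY hX hYX hne
    by_cases hp : PrecF (Fam M) K X
    · exact Or.inr ⟨cls M K, cls_ne_zero hK.left_mem,
        fun h => hK.ne (cls_inj hM hK.left_mem hX h), (prec_cls_iff hM hK.left_mem hX).2 hp⟩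
    · exact Or.inl ⟨_, (isLabel_cls_iff hM hX).2 (Or.inl ⟨K, hK, rfl, hp⟩)⟩

/-- Since intervals for inclusion between comparable classes are intervals for `⪯`, whether a
representative is immediately below another one can be read off from `⪯`. -/
theorem immBelow_rep_iff {a b : DClass (InverseHull M)} (ha : a ≠ dClass 0) (hab : Prec a b) :
    ImmBelow (rep (hullReps M) a) (rep (hullReps M) b) ↔
      a ≠ b ∧ ∀ c, Prec a c → Prec c b → c = a ∨ c = b := by
  obtain ⟨Y, hY, X, hX, rfl, rfl, hYX⟩ := (prec_cases hM hab).resolve_left ha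
  rw [rep_cls hM hY, rep_cls hM hX]
  constructor
  · intro h
    rcases h.cases hM (good_nil hX) (el_ne_zero (good_nil hY)) with
      ⟨Y', hY', h1⟩ | ⟨c, hc, h1, -⟩
    · obtain rfl := (el_inj (good_nil hY) h1).2.1
      refine ⟨fun h => hY'.ne (cls_inj hM hY hX h), fun c h2 h3 => ?_⟩
      rcases prec_cases hM h2 with h4 | ⟨Y₂, hY₂, C, hC, h4, rfl, h5⟩
      · exact (cls_ne_zero hY h4).elim
      obtain rfl := cls_inj hM hY hY₂ h4
      rw [prec_cls_iff hM hC hX] at h3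
      rcases hY'.eq_or_eq C hC h5.subset h3.subset with rfl | rfl
      · exact Or.inl rfl
      · exact Or.inr rfl
    · exact absurd (el_inj (good_nil hY) h1).1 (by simp)
  · rintro ⟨hne, h⟩
    refine immBelow_el_of_cov hM (good_nil hX) ⟨hY, hX, hYX.subset, fun h => hne (by rw [h]),
      fun W hW h1 h2 => ?_⟩
    obtain ⟨h3, h4⟩ := hYX.of_subset_of_subset Fam.inter hY.1 hW h1 h2
    rcases h (cls M W) ((prec_cls_iff hM hY hW).2 h3) ((prec_cls_iff hM hW hX).2 h4) with h5 | h5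
    · exact Or.inl (cls_inj hM hW hY h5)
    · exact Or.inr (cls_inj hM hW hX h5)

end Order

/-! ### McAlister functions -/

section McAlister

variable {S : Type*} [InverseSemigroup S] {I : Type*}

/-- A McAlister function with values in the idempotents, that is, a symmetric family of idempotents
with `p i j * p j k ≤ p i k`. -/
structure IsMcAlister (p : I → I → S) : Prop where
  idem (i j : I) : IsIdempotentElem (p i j)
  symm (i j : I) : p i j = p j i
  mul_le (i j k : I) : IdemLE (p i j * p j k) (p i k)

theorem mul_eq_of_idemLE_left {s p : S} (h : IdemLE (s * s⁻¹) p) : p * s = s := by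
  rw [← InverseSemigroup.mul_inv_mul s, ← mul_assoc, h.2]

theorem mul_eq_of_idemLE_right {s p : S} (h : IdemLE (s⁻¹ * s) p) : s * p = s := by
  calc s * p = s * (s⁻¹ * s * p) := by
        rw [← mul_assoc, ← mul_assoc, InverseSemigroup.mul_inv_mul]
    _ = s := by rw [h.1, ← mul_assoc, InverseSemigroup.mul_inv_mul]

theorem IsMcAlister.mul_eq {p : I → I → S} (hp : IsMcAlister p) {i j k : I} {s : S}
    (h : p i j * s = s) (h' : p j k * s = s) : p i k * s = s := by
  have h1 : p i j * p j k * s = s := by rw [mul_assoc, h', h]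
  rw [← h1, ← mul_assoc, (hp.mul_le i j k).2]

theorem IsMcAlister.mul_eq' {p : I → I → S} (hp : IsMcAlister p) {i j k : I} {s : S}
    (h : s * p i j = s) (h' : s * p j k = s) : s * p i k = s := by
  have h1 : s * (p i j * p j k) = s := by rw [← mul_assoc, h, h']
  rw [← h1, mul_assoc, (hp.mul_le i j k).1]

/-- An explicit form of the congruence generated by `gamma p`: the middle entries agree, and they
are unchanged by the idempotents attached to the pairs of outer entries. -/
def tripleCon {p : I → I → S} (hp : IsMcAlister p) : Con (Triple p) where
  r x y := x.mid = y.mid ∧ p x.left y.left * x.mid = x.mid ∧ x.mid * p x.right y.right = x.mid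
  iseqv :=
    { refl := fun x => ⟨rfl, mul_eq_of_idemLE_left x.left_le, mul_eq_of_idemLE_right x.right_le⟩
      symm := fun {x y} h => by
        obtain ⟨h1, h2, h3⟩ := h
        rw [h1, hp.symm] at h2 h3
        exact ⟨h1.symm, h2, h3⟩
      trans := fun {x y z} h h' => by
        obtain ⟨h1, h2, h3⟩ := h
        obtain ⟨h4, h5, h6⟩ := h'
        rw [← h1] at h5 h6
        exact ⟨h1.trans h4, hp.mul_eq h2 h5, hp.mul_eq' h3 h6⟩ }
  mul' := fun {x x' y y'} h h' => by
    obtain ⟨i, s, j, hs, hs'⟩ := x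
    obtain ⟨i', s', j', _, _⟩ := x'
    obtain ⟨k, t, l, ht, ht'⟩ := y
    obtain ⟨k', t', l', _, _⟩ := y'
    obtain ⟨h1, h2, h3⟩ := h
    obtain ⟨h4, h5, h6⟩ := h'
    dsimp only at h1 h2 h3 h4 h5 h6
    subst h1
    subst h4
    refine ⟨?_, ?_, ?_⟩
    · change s * p j k * t = s * p j' k' * t
      -- `p j j'` and `p k k'` may be inserted next to `p j k` and next to `p j' k'`; both products
      -- then become `p j j' * p j k * p j' k' * p k k'`
      have e1 : IdemLE (p j j' * p j k * p k k') (p j' k') := by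
        rw [hp.symm j j']
        have h7 := hp.mul_le j' j k
        have h8 := hp.mul_le j' k k'
        refine IdemLE.trans ⟨?_, ?_⟩ h8
        · calc p j' j * p j k * p k k' * (p j' k * p k k')
              = p j' j * p j k * (p k k' * p j' k) * p k k' := by simp only [mul_assoc]
            _ = p j' j * p j k * (p j' k * p k k') * p k k' := by
                rw [idem_comm (hp.idem k k') (hp.idem j' k)]
            _ = p j' j * p j k * p j' k * (p k k' * p k k') := by simp only [mul_assoc]
            _ = p j' j * p j k * p k k' := by rw [h7.1, hp.idem k k']
        · calc p j' k * p k k' * (p j' j * p j k * p k k')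
              = p j' k * (p k k' * (p j' j * p j k)) * p k k' := by simp only [mul_assoc]
            _ = p j' k * (p j' j * p j k * p k k') * p k k' := by
                rw [idem_comm (hp.idem k k') (idem_mul_idem (hp.idem j' j) (hp.idem j k))]
            _ = p j' k * (p j' j * p j k) * (p k k' * p k k') := by simp only [mul_assoc]
            _ = p j' j * p j k * p k k' := by rw [h7.2, hp.idem k k']
      have e2 : IdemLE (p j j' * p j' k' * p k k') (p j k) := by
        rw [hp.symm k k']
        have h7 := hp.mul_le j j' k'
        have h8 := hp.mul_le j k' k
        refine IdemLE.trans ⟨?_, ?_⟩ h8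
        · calc p j j' * p j' k' * p k' k * (p j k' * p k' k)
              = p j j' * p j' k' * (p k' k * p j k') * p k' k := by simp only [mul_assoc]
            _ = p j j' * p j' k' * (p j k' * p k' k) * p k' k := by
                rw [idem_comm (hp.idem k' k) (hp.idem j k')]
            _ = p j j' * p j' k' * p j k' * (p k' k * p k' k) := by simp only [mul_assoc]
            _ = p j j' * p j' k' * p k' k := by rw [h7.1, hp.idem k' k]
        · calc p j k' * p k' k * (p j j' * p j' k' * p k' k)
              = p j k' * (p k' k * (p j j' * p j' k')) * p k' k := by simp only [mul_assoc]
            _ = p j k' * (p j j' * p j' k' * p k' k) * p k' k := by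
                rw [idem_comm (hp.idem k' k) (idem_mul_idem (hp.idem j j') (hp.idem j' k'))]
            _ = p j k' * (p j j' * p j' k') * (p k' k * p k' k) := by simp only [mul_assoc]
            _ = p j j' * p j' k' * p k' k := by rw [h7.2, hp.idem k' k]
      calc s * p j k * t = s * (p j j' * p j k * p k k') * t := by
            rw [← mul_assoc, ← mul_assoc, h3, mul_assoc _ (p k k'), h5]
        _ = s * (p j j' * (p j k * p k k') * p j' k') * t := by rw [← mul_assoc (p j j'), e1.1]
        _ = s * (p j j' * (p j k * (p k k' * p j' k'))) * t := by simp only [mul_assoc]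
        _ = s * (p j j' * (p j' k' * p k k' * p j k)) * t := by
            rw [idem_comm (hp.idem k k') (hp.idem j' k'),
              idem_comm (hp.idem j k) (idem_mul_idem (hp.idem j' k') (hp.idem k k'))]
        _ = s * (p j j' * p j' k' * p k k') * t := by
            rw [← mul_assoc (p j j'), ← mul_assoc (p j j'), e2.1]
        _ = s * p j' k' * t := by
            rw [← mul_assoc, ← mul_assoc, h3, mul_assoc _ (p k k'), h5]
    · change p i i' * (s * p j k * t) = s * p j k * t
      rw [← mul_assoc, ← mul_assoc, h2]
    · change s * p j k * t * p l l' = s * p j k * t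
      rw [mul_assoc, h6]

theorem tripleCon_apply {p : I → I → S} (hp : IsMcAlister p) {x y : Triple p} :
    tripleCon hp x y ↔ x.mid = y.mid ∧ p x.left y.left * x.mid = x.mid ∧
      x.mid * p x.right y.right = x.mid := Iff.rfl

/-- The relation `gamma p` is a congruence already, with the simpler description above. -/
theorem conGen_gamma {p : I → I → S} (hp : IsMcAlister p) : conGen (gamma p) = tripleCon hp := by
  refine le_antisymm (Con.conGen_le.2 fun x y => ?_) fun x y h => ?_
  · rintro ⟨h1, h2⟩
    have h3 : p x.left y.left * x.mid = x.mid := by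
      rw [h1, ← mul_assoc, ← mul_assoc, hp.idem]
    have h4 : x.mid * p x.right y.right = x.mid := by
      rw [h1, hp.symm x.right, mul_assoc, hp.idem]
    rw [hp.symm y.left, h3, h4] at h2
    exact ⟨h2.symm, h3, h4⟩
  · rw [tripleCon_apply] at h
    obtain ⟨h1, h2, h3⟩ := h
    refine ConGen.Rel.of _ _ ⟨?_, ?_⟩
    · rw [← h1, h2, hp.symm, h3]
    · rw [← h1, hp.symm, h2, h3]

theorem IM.mk_eq_mk {p : I → I → S} (hp : IsMcAlister p) {x y : Triple p} :
    IM.mk x = IM.mk y ↔ x.mid = y.mid ∧ p x.left y.left * x.mid = x.mid ∧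
      x.mid * p x.right y.right = x.mid := by
  rw [← tripleCon_apply hp, ← conGen_gamma hp]
  exact Con.eq _

theorem IM.exists_mk {p : I → I → S} (x : IM p) : ∃ t, IM.mk t = x := by
  induction x using Quotient.inductionOn with
  | h t => exact ⟨t, rfl⟩

theorem IM.greenL_mid {p : I → I → S} (hp : IsMcAlister p) {x y : Triple p}
    (h : GreenL (IM.mk x) (IM.mk y)) : GreenL x.mid y.mid := by
  rcases h with h | ⟨⟨a, ha⟩, ⟨b, hb⟩⟩
  · exact Or.inl ((IM.mk_eq_mk hp).1 h).1
  · obtain ⟨a, rfl⟩ := IM.exists_mk a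
    obtain ⟨b, rfl⟩ := IM.exists_mk b
    exact Or.inr ⟨⟨_, ((IM.mk_eq_mk hp).1 ha).1⟩, ⟨_, ((IM.mk_eq_mk hp).1 hb).1⟩⟩

theorem IM.greenR_mid {p : I → I → S} (hp : IsMcAlister p) {x y : Triple p}
    (h : GreenR (IM.mk x) (IM.mk y)) : GreenR x.mid y.mid := by
  rcases h with h | ⟨⟨a, ha⟩, ⟨b, hb⟩⟩
  · exact Or.inl ((IM.mk_eq_mk hp).1 h).1
  · obtain ⟨a, rfl⟩ := IM.exists_mk a
    obtain ⟨b, rfl⟩ := IM.exists_mk b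
    refine Or.inr ⟨⟨p y.right a.left * a.mid, ?_⟩, ⟨p x.right b.left * b.mid, ?_⟩⟩
    · rw [← mul_assoc]
      exact ((IM.mk_eq_mk hp).1 ha).1
    · rw [← mul_assoc]
      exact ((IM.mk_eq_mk hp).1 hb).1

theorem exists_of_greenD {e f : S} (he : IsIdempotentElem e) (hf : IsIdempotentElem f)
    (h : GreenD e f) : ∃ s : S, s * s⁻¹ = e ∧ s⁻¹ * s = f := by
  obtain ⟨z, h1, h2⟩ := h.symm
  have h3 := h1.inv_mul_self_eq
  have h4 := h2.mul_inv_self_eq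
  rw [← idem_eq_inv hf, hf] at h3
  rw [← idem_eq_inv he, he] at h4
  exact ⟨z, h4, h3.symm⟩

/-- On classes of triples with idempotent middle entry, Green's relation `D` is that of the middle
entries. -/
theorem IM.greenD_iff {p : I → I → S} (hp : IsMcAlister p) {x y : Triple p}
    (hx : IsIdempotentElem x.mid) (hy : IsIdempotentElem y.mid) (hx' : x.left = x.right)
    (hy' : y.left = y.right) : GreenD (IM.mk x) (IM.mk y) ↔ GreenD x.mid y.mid := by
  constructor
  · rintro ⟨z, h1, h2⟩
    obtain ⟨z, rfl⟩ := IM.exists_mk z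
    exact ⟨z.mid, IM.greenL_mid hp h1, IM.greenR_mid hp h2⟩
  · intro h
    obtain ⟨s, h1, h2⟩ := exists_of_greenD hy hx h.symm
    obtain ⟨a, e, a', ha, ha'⟩ := x
    obtain ⟨b, f, b', hb, hb'⟩ := y
    dsimp only at hx hy hx' hy' h1 h2
    subst hx' hy' h1 h2
    rw [← idem_eq_inv hx, hx] at ha
    rw [← idem_eq_inv hy, hy] at hb
    have h3 := mul_eq_of_idemLE_left hb
    have h4 := mul_eq_of_idemLE_right ha
    have h5 : p a a * s⁻¹ = s⁻¹ := mul_eq_of_idemLE_left (by rwa [← inv_inv_eq])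
    have h6 : s⁻¹ * p b b = s⁻¹ := mul_eq_of_idemLE_right (by rwa [← inv_inv_eq])
    have hs := InverseSemigroup.mul_inv_mul s
    have hs' := InverseSemigroup.inv_mul_inv s
    let z : Triple p := ⟨b, s, a, hb, ha⟩
    let z' : Triple p := ⟨a, s⁻¹, b, by rwa [← inv_inv_eq], by rwa [← inv_inv_eq]⟩
    have key : ∀ {u v : Triple p}, u.left = v.left → u.mid = v.mid → u.right = v.right →
        IM.mk u = IM.mk v := fun h h' h'' => by rw [Triple.ext h h' h'']
    refine ⟨IM.mk z, Or.inr ⟨⟨IM.mk z', key rfl ?_ rfl⟩, ⟨IM.mk z, key rfl ?_ rfl⟩⟩,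
      Or.inr ⟨⟨IM.mk z, key rfl ?_ rfl⟩, ⟨IM.mk z', key rfl ?_ rfl⟩⟩⟩
    · change s⁻¹ * s = s⁻¹ * p b b * s
      rw [h6]
    · change s = s * p a a * (s⁻¹ * s)
      rw [h4, ← mul_assoc, hs]
    · change s = s * s⁻¹ * p b b * s
      rw [mul_assoc s, h6, hs]
    · change s * s⁻¹ = s * p a a * s⁻¹
      rw [h4]

end McAlister

/-! ### The combinatorial data of an inverse hull -/

section CombData

variable {A : Type*} {M : Matrix A A ℕ} [Finite A] (hM : IsMarkovTransitionMatrix M)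
include hM

/-- The product of the representatives of two classes below `j` is zero or represents a class below
both, hence below the meet of `i` and `k`. -/
theorem isMcAlister_meetRep : IsMcAlister (meetRep (hullReps M)) where
  idem i j := isIdempotentElem_rep hM _
  symm i j := by rw [meetRep, meetRep, meet_comm hM]
  mul_le i j k := by
    obtain ⟨-, h1, -⟩ := isMeet_meet hM i j
    obtain ⟨h2, -, -⟩ := isMeet_meet hM j k
    by_cases hn : meetRep (hullReps M) i j * meetRep (hullReps M) j k = 0
    · rw [hn]
      exact ⟨zero_mul _, mul_zero _⟩
    · obtain ⟨g, h3, h4, h5⟩ := exists_rep_eq_mul hM h1 h2 hn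
      rw [meetRep, meetRep, ← h3]
      exact idemLE_rep_of_prec hM ((isMeet_meet hM i k).2.2 g
        (prec_trans hM h4 (isMeet_meet hM i j).1) (prec_trans hM h5 (isMeet_meet hM j k).2.1))

theorem meetRep_self (a : DClass (InverseHull M)) :
    meetRep (hullReps M) a a = rep (hullReps M) a := by rw [meetRep, meet_self hM]

theorem meetRep_of_prec {a b : DClass (InverseHull M)} (h : Prec b a) :
    meetRep (hullReps M) a b = rep (hullReps M) b := by rw [meetRep, meet_eq_right hM h]

omit hM [Finite A] in
theorem mul_inv_of_idem {S : Type*} [InverseSemigroup S] {e : S} (he : IsIdempotentElem e) :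
    e * e⁻¹ = e := by rw [← idem_eq_inv he, he]

omit hM [Finite A] in
theorem inv_mul_of_idem {S : Type*} [InverseSemigroup S] {e : S} (he : IsIdempotentElem e) :
    e⁻¹ * e = e := by rw [← idem_eq_inv he, he]

/-- The triple `(a, e_a, a)`. -/
noncomputable def vertexTriple (a : DClass (InverseHull M)) : Triple (meetRep (hullReps M)) where
  left := a
  mid := rep (hullReps M) a
  right := a
  left_le := by
    rw [meetRep_self hM, mul_inv_of_idem (isIdempotentElem_rep hM a)]
    exact .refl (isIdempotentElem_rep hM a)
  right_le := by
    rw [meetRep_self hM, inv_mul_of_idem (isIdempotentElem_rep hM a)]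
    exact .refl (isIdempotentElem_rep hM a)

/-- The triple `(b, f, b)` of a label `(b, f)`. -/
noncomputable def labelTriple (x : GraphLabel (hullReps M)) : Triple (meetRep (hullReps M)) where
  left := x.vertex.1
  mid := x.elt
  right := x.vertex.1
  left_le := by
    rw [meetRep_self hM, mul_inv_of_idem x.isLabel.2.1.1]
    exact x.isLabel.2.1.2.2.1
  right_le := by
    rw [meetRep_self hM, inv_mul_of_idem x.isLabel.2.1.1]
    exact x.isLabel.2.1.2.2.1

/-- The elements of the combinatorial data, parametrized by the classes and the labels. -/
noncomputable def combElt : DClass (InverseHull M) ⊕ GraphLabel (hullReps M) → SPrec (hullReps M)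
  | .inl a => IM.mk (vertexTriple hM a)
  | .inr x => IM.mk (labelTriple hM x)

theorem combElt_mem (x : DClass (InverseHull M) ⊕ GraphLabel (hullReps M)) :
    combElt hM x ∈ combData (hullReps M) := by
  rcases x with a | x
  · exact Or.inl ⟨vertexTriple hM a, rfl, rfl, rfl⟩
  · exact Or.inr ⟨labelTriple hM x, rfl, rfl, x.isLabel⟩

theorem exists_combElt {y : SPrec (hullReps M)} (hy : y ∈ combData (hullReps M)) :
    ∃ x, combElt hM x = y := by
  rcases hy with ⟨t, rfl, h1, h2⟩ | ⟨t, rfl, h1, h2⟩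
  · exact ⟨.inl t.left, congrArg IM.mk (Triple.ext rfl h2.symm h1)⟩
  · exact ⟨.inr ⟨⟨t.left, h2.ne_zero⟩, t.mid, h2⟩, congrArg IM.mk (Triple.ext rfl rfl h1)⟩

theorem rep_injective {a b : DClass (InverseHull M)}
    (h : rep (hullReps M) a = rep (hullReps M) b) : a = b := by
  rw [← dClass_rep hM a, h, dClass_rep hM]

theorem GraphLabel.rep_mul_eq_zero (x : GraphLabel (hullReps M)) {a : DClass (InverseHull M)}
    (h : ¬ Prec x.vertex.1 a) : meetRep (hullReps M) a x.vertex.1 * x.elt = 0 :=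
  x.isLabel.rep_mul_eq_zero hM (isMeet_meet hM _ _).2.1 fun h' => h (by
    rw [← h']
    exact (isMeet_meet hM _ _).1)

theorem combElt_injective : Function.Injective (combElt hM) := by
  have hp := isMcAlister_meetRep hM
  have key : ∀ (a : DClass (InverseHull M)) (x : GraphLabel (hullReps M)),
      combElt hM (.inr x) ≠ combElt hM (.inl a) := by
    intro a x h
    obtain ⟨h1, h2, -⟩ := (IM.mk_eq_mk hp).1 h
    change x.elt = rep (hullReps M) a at h1
    change meetRep (hullReps M) x.vertex.1 a * x.elt = x.elt at h2
    rw [h1] at h2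
    -- `e_{b ∧ a} e_a = e_a` forces `b ∧ a = a`
    have h3 := idemLE_rep_of_prec hM (isMeet_meet hM x.vertex.1 a).2.1
    have h4 := rep_injective hM (h3.1.symm.trans h2)
    have h5 := (isMeet_meet hM x.vertex.1 a).1
    rw [h4] at h5
    rcases x.isLabel.2.2 with h6 | h6
    · rw [h1, dClass_rep hM] at h6
      exact h6 rfl
    · rw [h1, dClass_rep hM] at h6
      exact h6 h5
  rintro (a | x) (b | y) h
  · exact congrArg Sum.inl (rep_injective hM ((IM.mk_eq_mk hp).1 h).1)
  · exact (key _ _ h.symm).elim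
  · exact (key _ _ h).elim
  · obtain ⟨h1, h2, -⟩ := (IM.mk_eq_mk hp).1 h
    change x.elt = y.elt at h1
    change meetRep (hullReps M) x.vertex.1 y.vertex.1 * x.elt = x.elt at h2
    have h3 : Prec y.vertex.1 x.vertex.1 := by
      by_contra hn
      have := y.rep_mul_eq_zero hM hn
      rw [← h1, h2] at this
      exact x.isLabel.1 this
    have h4 : Prec x.vertex.1 y.vertex.1 := by
      by_contra hn
      have := x.rep_mul_eq_zero hM hn
      rw [hp.symm, h2] at this
      exact x.isLabel.1 this
    exact congrArg Sum.inr (GraphLabel.ext (Subtype.ext (prec_antisymm hM h4 h3)) h1)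

omit hM [Finite A] in
open Classical in
/-- The product of the combinatorial data in terms of classes and labels: classes multiply by meets,
a class fixes or annihilates a label, and distinct labels have product zero. -/
noncomputable def combMul : (x y : DClass (InverseHull M) ⊕ GraphLabel (hullReps M)) →
    DClass (InverseHull M) ⊕ GraphLabel (hullReps M)
  | .inl a, .inl b => .inl (meet a b)
  | .inl a, .inr x => if Prec x.vertex.1 a then .inr x else .inl (dClass 0)
  | .inr x, .inl a => if Prec x.vertex.1 a then .inr x else .inl (dClass 0)
  | .inr x, .inr y => if x = y then .inr x else .inl (dClass 0)

theorem mk_eq_combElt_zero {t : Triple (meetRep (hullReps M))} (h : t.mid = 0) :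
    IM.mk t = combElt hM (.inl (dClass 0)) := by
  refine (IM.mk_eq_mk (isMcAlister_meetRep hM)).2 ⟨?_, ?_, ?_⟩
  · rw [h]
    exact rep_zero.symm
  · rw [h, mul_zero]
  · rw [h, zero_mul]

theorem combElt_mul (x y : DClass (InverseHull M) ⊕ GraphLabel (hullReps M)) :
    combElt hM x * combElt hM y = combElt hM (combMul x y) := by
  have hp := isMcAlister_meetRep hM
  have hid := isIdempotentElem_rep hM
  rcases x with a | x <;> rcases y with b | y
  · obtain ⟨h1, h2, -⟩ := isMeet_meet hM a b
    have h3 := idemLE_rep_of_prec hM h1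
    have h4 := idemLE_rep_of_prec hM h2
    have h5 : rep (hullReps M) a * rep (hullReps M) (meet a b) * rep (hullReps M) b =
        rep (hullReps M) (meet a b) := by rw [h3.2, h4.1]
    refine (IM.mk_eq_mk hp).2 ⟨h5, ?_, ?_⟩
    · change meetRep (hullReps M) a (meet a b) * (rep (hullReps M) a *
        rep (hullReps M) (meet a b) * rep (hullReps M) b) = rep (hullReps M) a *
        rep (hullReps M) (meet a b) * rep (hullReps M) b
      rw [h5, meetRep_of_prec hM h1]
      exact hid _
    · change (rep (hullReps M) a * rep (hullReps M) (meet a b) * rep (hullReps M) b) *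
        meetRep (hullReps M) b (meet a b) =
        rep (hullReps M) a * rep (hullReps M) (meet a b) * rep (hullReps M) b
      rw [h5, meetRep_of_prec hM h2]
      exact hid _
  · have hle := y.isLabel.2.1.2.2.1
    by_cases h : Prec y.vertex.1 a
    · have h3 := idemLE_rep_of_prec hM h
      have h5 : rep (hullReps M) a * meetRep (hullReps M) a y.vertex.1 * y.elt = y.elt := by
        rw [meetRep_of_prec hM h, h3.2, hle.2]
      rw [combMul, if_pos h]
      refine (IM.mk_eq_mk hp).2 ⟨h5, ?_, ?_⟩
      · change meetRep (hullReps M) a y.vertex.1 * (rep (hullReps M) a *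
          meetRep (hullReps M) a y.vertex.1 * y.elt) = rep (hullReps M) a *
          meetRep (hullReps M) a y.vertex.1 * y.elt
        rw [h5, meetRep_of_prec hM h, hle.2]
      · change (rep (hullReps M) a * meetRep (hullReps M) a y.vertex.1 * y.elt) *
          meetRep (hullReps M) y.vertex.1 y.vertex.1 = rep (hullReps M) a *
          meetRep (hullReps M) a y.vertex.1 * y.elt
        rw [h5, meetRep_self hM, hle.1]
    · rw [combMul, if_neg h]
      refine mk_eq_combElt_zero hM ?_
      change rep (hullReps M) a * meetRep (hullReps M) a y.vertex.1 * y.elt = 0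
      rw [mul_assoc, y.rep_mul_eq_zero hM h, mul_zero]
  · have hle := x.isLabel.2.1.2.2.1
    by_cases h : Prec x.vertex.1 b
    · have h3 := idemLE_rep_of_prec hM h
      have h5 : x.elt * meetRep (hullReps M) x.vertex.1 b * rep (hullReps M) b = x.elt := by
        rw [hp.symm, meetRep_of_prec hM h, mul_assoc, h3.1, hle.1]
      rw [combMul, if_pos h]
      refine (IM.mk_eq_mk hp).2 ⟨h5, ?_, ?_⟩
      · change meetRep (hullReps M) x.vertex.1 x.vertex.1 * (x.elt *
          meetRep (hullReps M) x.vertex.1 b * rep (hullReps M) b) = x.elt *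
          meetRep (hullReps M) x.vertex.1 b * rep (hullReps M) b
        rw [h5, meetRep_self hM, hle.2]
      · change (x.elt * meetRep (hullReps M) x.vertex.1 b * rep (hullReps M) b) *
          meetRep (hullReps M) b x.vertex.1 = x.elt *
          meetRep (hullReps M) x.vertex.1 b * rep (hullReps M) b
        rw [h5, meetRep_of_prec hM h, hle.1]
    · rw [combMul, if_neg h]
      refine mk_eq_combElt_zero hM ?_
      change x.elt * meetRep (hullReps M) x.vertex.1 b * rep (hullReps M) b = 0
      rw [hp.symm, idem_comm x.isLabel.2.1.1 (hp.idem _ _), x.rep_mul_eq_zero hM h, zero_mul]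
  · by_cases h : x = y
    · subst h
      rw [combMul, if_pos rfl]
      refine congrArg IM.mk (Triple.ext rfl ?_ rfl)
      change x.elt * meetRep (hullReps M) x.vertex.1 x.vertex.1 * x.elt = x.elt
      rw [meetRep_self hM, x.isLabel.2.1.2.2.1.1, x.isLabel.2.1.1]
    · rw [combMul, if_neg h]
      refine mk_eq_combElt_zero hM ?_
      change x.elt * meetRep (hullReps M) x.vertex.1 y.vertex.1 * y.elt = 0
      by_cases h1 : Prec y.vertex.1 x.vertex.1
      · by_cases h2 : Prec x.vertex.1 y.vertex.1
        · have h3 := prec_antisymm hM h1 h2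
          have h4 : x.elt ≠ y.elt := fun h4 => h (GraphLabel.ext (Subtype.ext h3.symm) h4)
          rw [h3, meetRep_self hM, x.isLabel.2.1.2.2.1.1]
          have := y.isLabel
          rw [h3] at this
          exact x.isLabel.mul_eq_zero hM this h4
        · rw [hp.symm, idem_comm x.isLabel.2.1.1 (hp.idem _ _), x.rep_mul_eq_zero hM h2, zero_mul]
      · rw [mul_assoc, y.rep_mul_eq_zero hM h1, mul_zero]

omit hM [Finite A] in
/-- The `D`-class in the inverse hull that belongs to an element of the combinatorial data. -/
def combClass : DClass (InverseHull M) ⊕ GraphLabel (hullReps M) → DClass (InverseHull M)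
  | .inl a => a
  | .inr x => dClass x.elt

theorem greenD_combElt_iff (x y : DClass (InverseHull M) ⊕ GraphLabel (hullReps M)) :
    GreenD (combElt hM x) (combElt hM y) ↔ combClass x = combClass y := by
  have hp := isMcAlister_meetRep hM
  have hid := isIdempotentElem_rep hM
  rcases x with a | x <;> rcases y with b | y
  · exact (IM.greenD_iff hp (hid a) (hid b) rfl rfl).trans (by
      rw [← dClass_eq_iff]
      change dClass (rep _ a) = dClass (rep _ b) ↔ _
      rw [dClass_rep hM, dClass_rep hM]
      rfl)
  · exact (IM.greenD_iff hp (hid a) y.isLabel.2.1.1 rfl rfl).trans (by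
      rw [← dClass_eq_iff]
      change dClass (rep _ a) = _ ↔ _
      rw [dClass_rep hM]
      rfl)
  · exact (IM.greenD_iff hp x.isLabel.2.1.1 (hid b) rfl rfl).trans (by
      rw [← dClass_eq_iff]
      change _ = dClass (rep _ b) ↔ _
      rw [dClass_rep hM]
      rfl)
  · exact (IM.greenD_iff hp x.isLabel.2.1.1 y.isLabel.2.1.1 rfl rfl).trans dClass_eq_iff.symm

/-- The combinatorial data, parametrized by the classes and the labels. -/
noncomputable def combEquiv :
    DClass (InverseHull M) ⊕ GraphLabel (hullReps M) ≃ combData (hullReps M) :=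
  Equiv.ofBijective (fun x => ⟨combElt hM x, combElt_mem hM x⟩)
    ⟨fun _ _ h => combElt_injective hM (congrArg Subtype.val h),
      fun y => (exists_combElt hM y.2).imp fun _ h => Subtype.ext h⟩

theorem combEquiv_val (x : DClass (InverseHull M) ⊕ GraphLabel (hullReps M)) :
    (combEquiv hM x : SPrec (hullReps M)) = combElt hM x := rfl

theorem combEquiv_mul_iff (x y z : DClass (InverseHull M) ⊕ GraphLabel (hullReps M)) :
    (combEquiv hM x : SPrec (hullReps M)) * combEquiv hM y = combEquiv hM z ↔
      combMul x y = z := by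
  rw [combEquiv_val, combEquiv_val, combEquiv_val, combElt_mul,
    (combElt_injective hM).eq_iff]

end CombData

/-! ### Isomorphisms of the classes and labels -/

section DataIso

variable {A B : Type*} {M : Matrix A A ℕ} {N : Matrix B B ℕ}

variable (M N) in
/-- Compatible bijections between the classes and the labels of two inverse hulls: the common
content of the isomorphisms of combinatorial data and of labelled graphs. -/
structure DataIso where
  /-- the map on `D`-classes -/
  cl : DClass (InverseHull M) ≃ DClass (InverseHull N)
  /-- the map on labels -/
  lab : GraphLabel (hullReps M) ≃ GraphLabel (hullReps N)
  map_zero : cl (dClass 0) = dClass 0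
  prec_iff (a b : DClass (InverseHull M)) : Prec (cl a) (cl b) ↔ Prec a b
  map_vertex (x : GraphLabel (hullReps M)) : (lab x).vertex.1 = cl x.vertex.1
  map_class (x : GraphLabel (hullReps M)) : dClass (lab x).elt = cl (dClass x.elt)

/-- The inverse of an isomorphism of classes and labels. -/
def DataIso.symm (D : DataIso M N) : DataIso N M where
  cl := D.cl.symm
  lab := D.lab.symm
  map_zero := by rw [Equiv.symm_apply_eq, D.map_zero]
  prec_iff a b := by rw [← D.prec_iff, Equiv.apply_symm_apply, Equiv.apply_symm_apply]
  map_vertex x := by rw [Equiv.eq_symm_apply, ← D.map_vertex, Equiv.apply_symm_apply]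
  map_class x := by rw [Equiv.eq_symm_apply, ← D.map_class, Equiv.apply_symm_apply]

theorem DataIso.eq_zero_iff (D : DataIso M N) {a : DClass (InverseHull M)} :
    D.cl a = dClass 0 ↔ a = dClass 0 := by rw [← D.map_zero, D.cl.injective.eq_iff]

theorem exists_eq_sumCongr {α β γ δ : Type*} (σ : α ⊕ β ≃ γ ⊕ δ)
    (h : ∀ x, (σ x).isRight = x.isRight) :
    ∃ (f : α ≃ γ) (g : β ≃ δ), σ = Equiv.sumCongr f g := by
  have h1 : ∀ a, ∃ c, σ (.inl a) = .inl c := fun a => by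
    have := h (.inl a)
    cases hs : σ (.inl a) with
    | inl c => exact ⟨c, rfl⟩
    | inr d => simp [hs] at this
  have h2 : ∀ b, ∃ d, σ (.inr b) = .inr d := fun b => by
    have := h (.inr b)
    cases hs : σ (.inr b) with
    | inl c => simp [hs] at this
    | inr d => exact ⟨d, rfl⟩
  choose f hf using h1
  choose g hg using h2
  have hfb : Function.Bijective f := by
    refine ⟨fun a a' haa => Sum.inl_injective (σ.injective (by rw [hf, hf, haa])), fun c => ?_⟩
    obtain ⟨a | b, hx⟩ := σ.surjective (.inl c)
    · exact ⟨a, Sum.inl_injective (by rw [← hf, hx])⟩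
    · simp [hg] at hx
  have hgb : Function.Bijective g := by
    refine ⟨fun a a' haa => Sum.inr_injective (σ.injective (by rw [hg, hg, haa])), fun c => ?_⟩
    obtain ⟨a | b, hx⟩ := σ.surjective (.inr c)
    · simp [hf] at hx
    · exact ⟨b, Sum.inr_injective (by rw [← hg, hx])⟩
  refine ⟨Equiv.ofBijective f hfb, Equiv.ofBijective g hgb, Equiv.ext ?_⟩
  rintro (a | b)
  · exact hf a
  · exact hg b

variable [Finite A] [Finite B] (hM : IsMarkovTransitionMatrix M)
  (hN : IsMarkovTransitionMatrix N)

/-! ### Isomorphisms of combinatorial data -/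

include hM in
theorem meet_eq_right_iff {a b : DClass (InverseHull M)} : meet a b = b ↔ Prec b a :=
  ⟨fun h => h ▸ (isMeet_meet hM a b).1, meet_eq_right hM⟩

include hM in
theorem GraphLabel.not_prec_zero (x : GraphLabel (hullReps M)) : ¬ Prec x.vertex.1 (dClass 0) :=
  fun h => x.vertex.2 ((prec_zero_iff hM).1 h)

include hM in
theorem combMul_zero_left (x : DClass (InverseHull M) ⊕ GraphLabel (hullReps M)) :
    combMul (.inl (dClass 0)) x = .inl (dClass 0) := by
  rcases x with a | x
  · rw [combMul, meet_comm hM, meet_eq_right hM (prec_zero_left a)]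
  · rw [combMul, if_neg (x.not_prec_zero hM)]

include hM in
theorem combMul_zero_right (x : DClass (InverseHull M) ⊕ GraphLabel (hullReps M)) :
    combMul x (.inl (dClass 0)) = .inl (dClass 0) := by
  rcases x with a | x
  · rw [combMul, meet_eq_right hM (prec_zero_left a)]
  · rw [combMul, if_neg (x.not_prec_zero hM)]

include hM in
/-- The labels are the atoms of the combinatorial data. -/
theorem isRight_iff (x : DClass (InverseHull M) ⊕ GraphLabel (hullReps M)) :
    x.isRight ↔ x ≠ .inl (dClass 0) ∧ ∀ y, combMul x y = x ∨ combMul x y = .inl (dClass 0) := by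
  rcases x with a | x
  · simp only [Sum.isRight_inl, Bool.false_eq_true, false_iff, not_and]
    intro ha hy
    have ha' : a ≠ dClass 0 := fun h => ha (by rw [h])
    rcases exists_isLabel_or_prec hM ha' with ⟨f, hf⟩ | ⟨c, hc, hca, hp⟩
    · have := hy (.inr ⟨⟨a, ha'⟩, f, hf⟩)
      rw [combMul, if_pos (prec_refl hM a)] at this
      simp at this
    · have := hy (.inl c)
      rw [combMul, meet_eq_right hM hp] at this
      simp [hc, hca] at this
  · simp only [Sum.isRight_inr, ne_eq, reduceCtorEq, not_false_eq_true, true_and, true_iff]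
    rintro (b | y)
    · rw [combMul]
      split_ifs <;> simp
    · rw [combMul]
      split_ifs <;> simp

include hM hN in
/-- Classes and labels can be recognized in the combinatorial data: labels are atoms, and the order
on classes and the vertex of a label can be expressed by the multiplication. -/
theorem nonempty_dataIso_of_combData
    (h : ∃ π : combData (hullReps M) ≃ combData (hullReps N), IsDClassPreservingIso π) :
    Nonempty (DataIso M N) := by
  obtain ⟨π, hπ⟩ := h
  let σ := (combEquiv hM).trans (π.trans (combEquiv hN).symm)
  have hσ : ∀ x, combEquiv hN (σ x) = π (combEquiv hM x) := fun x =>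
    (combEquiv hN).apply_symm_apply _
  have hmul : ∀ x y z, combMul x y = z ↔ combMul (σ x) (σ y) = σ z := fun x y z => by
    rw [← combEquiv_mul_iff hM, ← combEquiv_mul_iff hN, hπ.map_mul_iff, hσ, hσ, hσ]
  have hcl : ∀ x y, combClass x = combClass y ↔ combClass (σ x) = combClass (σ y) := fun x y => by
    rw [← greenD_combElt_iff hM, ← greenD_combElt_iff hN, ← combEquiv_val, ← combEquiv_val,
      ← combEquiv_val, ← combEquiv_val, hσ, hσ]
    exact hπ.map_greenD_iff _ _
  have hzero : σ (.inl (dClass 0)) = .inl (dClass 0) := by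
    have h1 := (hmul _ _ _).1 (combMul_zero_left hM (σ.symm (.inl (dClass 0))))
    rw [Equiv.apply_symm_apply, combMul_zero_right hN] at h1
    exact h1.symm
  have hright : ∀ x, (σ x).isRight = x.isRight := fun x => by
    rw [Bool.eq_iff_iff, isRight_iff hM, isRight_iff hN, ← hzero, σ.injective.ne_iff]
    refine and_congr_right fun _ => ⟨fun h y => ?_, fun h y => ?_⟩
    · rw [hmul, hmul]
      exact h (σ y)
    · obtain ⟨y, rfl⟩ := σ.surjective y
      rw [← hmul, ← hmul]
      exact h y
  obtain ⟨f, g, hfg⟩ := exists_eq_sumCongr σ hright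
  have hf : ∀ a, σ (.inl a) = .inl (f a) := fun a => by rw [hfg]; rfl
  have hg : ∀ x, σ (.inr x) = .inr (g x) := fun x => by rw [hfg]; rfl
  have hprec : ∀ a b, Prec (f a) (f b) ↔ Prec a b := fun a b => by
    have := hmul (.inl b) (.inl a) (.inl a)
    rw [hf, hf, combMul, combMul, Sum.inl.injEq, Sum.inl.injEq, meet_eq_right_iff hM,
      meet_eq_right_iff hN] at this
    exact this.symm
  have hlab : ∀ x a, Prec (g x).vertex.1 (f a) ↔ Prec x.vertex.1 a := fun x a => by
    have := hmul (.inl a) (.inr x) (.inr x)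
    rw [hf, hg, combMul, combMul] at this
    simpa using this.symm
  refine ⟨⟨f, g, ?_, hprec, fun x => ?_, fun x => ?_⟩⟩
  · rw [hf] at hzero
    exact Sum.inl_injective hzero
  · refine prec_antisymm hN ((hlab x _).2 (prec_refl hM _)) ?_
    rw [← f.apply_symm_apply (g x).vertex.1, hprec, ← hlab, f.apply_symm_apply]
    exact prec_refl hN _
  · have := (hcl (.inr x) (.inl (dClass x.elt))).1 rfl
    rwa [hg, hf] at this

include hM hN in
theorem DataIso.exists_combData_iso (D : DataIso M N) :
    ∃ π : combData (hullReps M) ≃ combData (hullReps N), IsDClassPreservingIso π := by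
  let σ := Equiv.sumCongr D.cl D.lab
  have hmeet : ∀ a b, D.cl (meet a b) = meet (D.cl a) (D.cl b) := fun a b => by
    obtain ⟨h1, h2, h3⟩ := isMeet_meet hM a b
    refine (meet_eq_of_isMeet hN ⟨(D.prec_iff _ _).2 h1, (D.prec_iff _ _).2 h2,
      fun d h4 h5 => ?_⟩).symm
    obtain ⟨d, rfl⟩ := D.cl.surjective d
    rw [D.prec_iff] at *
    exact h3 d h4 h5
  have hlab : ∀ x a, Prec (D.lab x).vertex.1 (D.cl a) ↔ Prec x.vertex.1 a := fun x a => by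
    rw [D.map_vertex, D.prec_iff]
  have hzero : σ (.inl (dClass 0)) = .inl (dClass 0) := congrArg Sum.inl D.map_zero
  have hmul : ∀ x y, σ (combMul x y) = combMul (σ x) (σ y) := by
    rintro (a | x) (b | y)
    · exact congrArg Sum.inl (hmeet a b)
    · by_cases h : Prec y.vertex.1 a
      · change σ (combMul _ _) = combMul (.inl (D.cl a)) (.inr (D.lab y))
        rw [combMul, combMul, if_pos h, if_pos ((hlab y a).2 h)]
        rfl
      · change σ (combMul _ _) = combMul (.inl (D.cl a)) (.inr (D.lab y))
        rw [combMul, combMul, if_neg h, if_neg (fun h' => h ((hlab y a).1 h')), hzero]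
    · by_cases h : Prec x.vertex.1 b
      · change σ (combMul _ _) = combMul (.inr (D.lab x)) (.inl (D.cl b))
        rw [combMul, combMul, if_pos h, if_pos ((hlab x b).2 h)]
        rfl
      · change σ (combMul _ _) = combMul (.inr (D.lab x)) (.inl (D.cl b))
        rw [combMul, combMul, if_neg h, if_neg (fun h' => h ((hlab x b).1 h')), hzero]
    · by_cases h : x = y
      · change σ (combMul _ _) = combMul (.inr (D.lab x)) (.inr (D.lab y))
        rw [combMul, combMul, if_pos h, if_pos (congrArg D.lab h)]
        rfl
      · change σ (combMul _ _) = combMul (.inr (D.lab x)) (.inr (D.lab y))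
        rw [combMul, combMul, if_neg h, if_neg (fun h' => h (D.lab.injective h')), hzero]
  have hcl : ∀ x, combClass (σ x) = D.cl (combClass x) := by
    rintro (a | x)
    · rfl
    · exact D.map_class x
  refine ⟨(combEquiv hM).symm.trans (σ.trans (combEquiv hN)), fun x y z => ?_, fun x y => ?_⟩
  · obtain ⟨x, rfl⟩ := (combEquiv hM).surjective x
    obtain ⟨y, rfl⟩ := (combEquiv hM).surjective y
    obtain ⟨z, rfl⟩ := (combEquiv hM).surjective z
    simp only [Equiv.trans_apply, Equiv.symm_apply_apply]
    rw [combEquiv_mul_iff, combEquiv_mul_iff, ← hmul, σ.injective.eq_iff]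
  · obtain ⟨x, rfl⟩ := (combEquiv hM).surjective x
    obtain ⟨y, rfl⟩ := (combEquiv hM).surjective y
    simp only [Equiv.trans_apply, Equiv.symm_apply_apply]
    rw [combEquiv_val, combEquiv_val, combEquiv_val, combEquiv_val, greenD_combElt_iff,
      greenD_combElt_iff, hcl, hcl, D.cl.injective.eq_iff]

/-! ### Isomorphisms of labelled graphs -/

omit [Finite A] [Finite B] in
theorem exists_extend_vertex (e : Vertex (InverseHull M) ≃ Vertex (InverseHull N)) :
    ∃ f : DClass (InverseHull M) ≃ DClass (InverseHull N), f (dClass 0) = dClass 0 ∧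
      ∀ a : Vertex (InverseHull M), f a.1 = (e a).1 := by
  classical
  let e₀ : {a : DClass (InverseHull M) // a = dClass 0} ≃
    {b : DClass (InverseHull N) // b = dClass 0} := Equiv.ofUnique _ _
  let e₁ : {a : DClass (InverseHull M) // ¬ a = dClass 0} ≃
    {b : DClass (InverseHull N) // ¬ b = dClass 0} := e
  refine ⟨(Equiv.sumCompl (· = dClass 0)).symm.trans
    ((Equiv.sumCongr e₀ e₁).trans (Equiv.sumCompl (· = dClass 0))), ?_, fun a => ?_⟩
  · rw [Equiv.trans_apply, Equiv.sumCompl_symm_apply_of_pos (p := (· = dClass 0)) rfl]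
    exact (e₀ ⟨dClass 0, rfl⟩).2
  · rw [Equiv.trans_apply, Equiv.sumCompl_symm_apply_of_neg (p := (· = dClass 0)) a.2]
    rfl

/-- The class of the idempotent of a label, as a vertex. -/
def GraphLabel.classVertex (x : GraphLabel (hullReps M)) : Vertex (InverseHull M) :=
  ⟨dClass x.elt, fun h => x.isLabel.1 (dClass_eq_zero_iff.1 h)⟩

include hM hN in
theorem nonempty_dataIso_of_labelledGraph
    (h : ∃ π : (labelledGraph (hullReps M)).Iso (labelledGraph (hullReps N)),
      ∀ a b : Vertex (InverseHull M), Prec a.1 b.1 ↔ Prec (π.onV a).1 (π.onV b).1) :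
    Nonempty (DataIso M N) := by
  obtain ⟨π, hπ⟩ := h
  obtain ⟨f, hf0, hf⟩ := exists_extend_vertex π.onV
  have hprec : ∀ a b, Prec (f a) (f b) ↔ Prec a b := fun a b => by
    by_cases ha : a = dClass 0
    · rw [ha, hf0]
      exact iff_of_true (prec_zero_left _) (prec_zero_left _)
    by_cases hb : b = dClass 0
    · rw [hb, hf0, prec_zero_iff hM, prec_zero_iff hN, ← hf0, f.injective.eq_iff]
    rw [hf ⟨a, ha⟩, hf ⟨b, hb⟩]
    exact (hπ ⟨a, ha⟩ ⟨b, hb⟩).symm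
  have hlab : ∀ e, (π.onE e).lab = π.onL e.lab := π.map_label
  have hsrc : ∀ e, (π.onE e).source = π.onV e.source := π.map_s
  have hrng : ∀ e, (π.onE e).lab.vertex = π.onV e.lab.vertex := π.map_r
  refine ⟨⟨f, π.onL, hf0, hprec, fun x => ?_, fun x => ?_⟩⟩
  -- the vertex of a label is the range, and its class the largest source, of the edges carrying it
  · have := hrng ⟨x, x.classVertex, prec_refl hM _⟩
    rw [hlab] at this
    rw [this, hf]
  · refine prec_antisymm hN ?_ ?_
    · obtain ⟨e, he⟩ := π.onE.surjective ⟨π.onL x, (π.onL x).classVertex, prec_refl hN _⟩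
      have h1 := hlab e
      have h2 := hsrc e
      have h3 := e.source_prec
      rw [he] at h1 h2
      rw [π.onL.injective h1.symm, ← hprec, hf, ← h2] at h3
      exact h3
    · have h1 := (π.onE ⟨x, x.classVertex, prec_refl hM _⟩).source_prec
      rw [hlab, hsrc, ← hf] at h1
      exact h1

omit [Finite A] [Finite B] in
theorem DataIso.exists_labelledGraph_iso (D : DataIso M N) :
    ∃ π : (labelledGraph (hullReps M)).Iso (labelledGraph (hullReps N)),
      ∀ a b : Vertex (InverseHull M), Prec a.1 b.1 ↔ Prec (π.onV a).1 (π.onV b).1 := by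
  let onV : Vertex (InverseHull M) ≃ Vertex (InverseHull N) :=
    D.cl.subtypeEquiv fun a => not_congr D.eq_zero_iff.symm
  let onE : GraphEdge (hullReps M) ≃ GraphEdge (hullReps N) :=
    { toFun := fun e => ⟨D.lab e.lab, onV e.source, by
        rw [D.map_class]
        exact (D.prec_iff _ _).2 e.source_prec⟩
      invFun := fun e => ⟨D.lab.symm e.lab, onV.symm e.source, by
        change Prec (D.symm.cl e.source.1) (dClass (D.symm.lab e.lab).elt)
        rw [D.symm.map_class]
        exact (D.symm.prec_iff _ _).2 e.source_prec⟩
      left_inv := fun e => GraphEdge.ext (D.lab.symm_apply_apply _) (onV.symm_apply_apply _)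
      right_inv := fun e => GraphEdge.ext (D.lab.apply_symm_apply _) (onV.apply_symm_apply _) }
  exact ⟨⟨onV, onE, D.lab, fun _ => rfl, fun e => Subtype.ext (D.map_vertex e.lab), fun _ => rfl⟩,
    fun a b => (D.prec_iff _ _).symm⟩

end DataIso

/-! ### Invariants of Morita equivalence -/

section Splitting

variable {S : Type*} [InverseSemigroup S]

theorem IdempotentSplitting.comp_val {e f g : IdempotentSplitting S} (s : e ⟶ f) (t : f ⟶ g) :
    (s ≫ t).1 = s.1 * t.1 := rfl

theorem IdempotentSplitting.id_val (e : IdempotentSplitting S) : (𝟙 e : e ⟶ e).1 = e.val := rfl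

theorem IdempotentSplitting.hom_ext {e f : IdempotentSplitting S} {s t : e ⟶ f}
    (h : s.1 = t.1) : s = t := Subtype.ext h

theorem IdempotentSplitting.val_mul {e f : IdempotentSplitting S} (s : e ⟶ f) :
    e.val * s.1 = s.1 := congrArg Subtype.val (Category.id_comp s)

theorem IdempotentSplitting.mul_val {e f : IdempotentSplitting S} (s : e ⟶ f) :
    s.1 * f.val = s.1 := congrArg Subtype.val (Category.comp_id s)

theorem IdempotentSplitting.ext_val {e f : IdempotentSplitting S} (h : e.val = f.val) :
    e = f := by
  cases e
  cases f
  cases h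
  rfl

/-- An element `s` with `es = s = sf`, as a morphism. -/
def homMk {e f : IdempotentSplitting S} (s : S) (h : e.val * s = s) (h' : s * f.val = s) :
    e ⟶ f := ⟨s, s, by rw [h, h']⟩

theorem greenD_mul_comm {x y : S} (h : x * y * x = x) : GreenD (y * x) (x * y) :=
  ⟨x, Or.inr ⟨⟨y, rfl⟩, ⟨x, by rw [← mul_assoc, h]⟩⟩, Or.inr ⟨⟨x, h.symm⟩, ⟨y, rfl⟩⟩⟩

theorem greenD_of_iso {e f : IdempotentSplitting S} (i : e ≅ f) : GreenD e.val f.val := by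
  have h1 : i.hom.1 * i.inv.1 = e.val := congrArg Subtype.val i.hom_inv_id
  have h2 : i.inv.1 * i.hom.1 = f.val := congrArg Subtype.val i.inv_hom_id
  have h3 : GreenD (i.hom.1 * i.inv.1) (i.inv.1 * i.hom.1) := greenD_mul_comm (by
    rw [h2]
    exact IdempotentSplitting.val_mul i.inv)
  rwa [h1, h2] at h3

theorem nonempty_iso_of_greenD {e f : IdempotentSplitting S} (h : GreenD e.val f.val) :
    Nonempty (e ≅ f) := by
  obtain ⟨s, h1, h2⟩ := exists_of_greenD e.idem f.idem h
  have h3 := InverseSemigroup.mul_inv_mul s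
  have h4 := InverseSemigroup.inv_mul_inv s
  exact ⟨⟨homMk s (by rw [← h1, h3]) (by rw [← h2, ← mul_assoc, h3]),
    homMk s⁻¹ (by rw [← h2, h4]) (by rw [← h1, ← mul_assoc, h4]),
    IdempotentSplitting.hom_ext h1, IdempotentSplitting.hom_ext h2⟩⟩

/-- The object `ss⁻¹` of the idempotent splitting. -/
def rangeObj (s : S) : IdempotentSplitting S := ⟨s * s⁻¹, mul_inv_idem s⟩

theorem greenR_mul_inv (s : S) : GreenR s (s * s⁻¹) :=
  Or.inr ⟨⟨s, (InverseSemigroup.mul_inv_mul s).symm⟩, ⟨s⁻¹, rfl⟩⟩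

theorem greenD_rangeObj {s t : S} (h : GreenD s t) :
    GreenD (rangeObj s).val (rangeObj t).val :=
  GreenD.trans (GreenD.symm ⟨s, Or.inl rfl, greenR_mul_inv s⟩)
    (GreenD.trans h ⟨t, Or.inl rfl, greenR_mul_inv t⟩)

variable {T : Type*} [InverseSemigroup T]

/-- The map on `D`-classes induced by a functor between idempotent splittings. -/
def classMap (F : IdempotentSplitting S ⥤ IdempotentSplitting T) (a : DClass S) : DClass T :=
  Quotient.lift (s := greenDSetoid S) (fun s => dClass (F.obj (rangeObj s)).val)
    (fun _ _ h => dClass_eq_iff.2 (greenD_of_iso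
      (F.mapIso (nonempty_iso_of_greenD (greenD_rangeObj h)).some))) a

theorem classMap_val (F : IdempotentSplitting S ⥤ IdempotentSplitting T)
    (e : IdempotentSplitting S) : classMap F (dClass e.val) = dClass (F.obj e).val := by
  have h : rangeObj e.val = e := IdempotentSplitting.ext_val (mul_inv_of_idem e.idem)
  change dClass (F.obj (rangeObj e.val)).val = _
  rw [h]

theorem exists_dClass_val (a : DClass S) : ∃ e : IdempotentSplitting S, dClass e.val = a := by
  induction a using Quotient.inductionOn with
  | h s => exact ⟨rangeObj s, dClass_eq_iff.2 (GreenD.symm ⟨s, Or.inl rfl, greenR_mul_inv s⟩)⟩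

/-- The bijection on `D`-classes induced by an equivalence of idempotent splittings. -/
def classEquiv (F : IdempotentSplitting S ≌ IdempotentSplitting T) : DClass S ≃ DClass T where
  toFun := classMap F.functor
  invFun := classMap F.inverse
  left_inv a := by
    obtain ⟨e, rfl⟩ := exists_dClass_val a
    rw [classMap_val, classMap_val]
    exact dClass_eq_iff.2 (greenD_of_iso (F.unitIso.app e).symm)
  right_inv a := by
    obtain ⟨e, rfl⟩ := exists_dClass_val a
    rw [classMap_val, classMap_val]
    exact dClass_eq_iff.2 (greenD_of_iso (F.counitIso.app e))

end Splitting

section LocalEquiv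

/-- An isomorphism between the semilattices of idempotents below `e` and below `e'`. -/
structure LocalEquiv {S T : Type*} [Mul S] [Mul T] (e : S) (e' : T) where
  /-- the underlying bijection -/
  toEquiv : {f : S // IsIdempotentElem f ∧ IdemLE f e} ≃ {f : T // IsIdempotentElem f ∧ IdemLE f e'}
  map_mul (f g h : {f : S // IsIdempotentElem f ∧ IdemLE f e}) :
    (toEquiv f).1 * (toEquiv g).1 = (toEquiv h).1 ↔ f.1 * g.1 = h.1

/-- The inverse of a local equivalence. -/
def LocalEquiv.symm {S T : Type*} [Mul S] [Mul T] {e : S} {e' : T} (φ : LocalEquiv e e') :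
    LocalEquiv e' e where
  toEquiv := φ.toEquiv.symm
  map_mul f g h := by rw [← φ.map_mul, Equiv.apply_symm_apply, Equiv.apply_symm_apply,
    Equiv.apply_symm_apply]

section

variable {S T : Type*} [InverseSemigroup S] [InverseSemigroup T]

/-- The action of a fully faithful functor on the idempotent endomorphisms of an object. -/
noncomputable def localEquivOfFunctor (F : IdempotentSplitting S ⥤ IdempotentSplitting T) [F.Full]
    [F.Faithful] {e : IdempotentSplitting S} {e' : IdempotentSplitting T} (i : F.obj e ≅ e') :
    LocalEquiv e.val e'.val :=
  let ψ : (e ⟶ e) ≃ (e' ⟶ e') :=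
    (Functor.FullyFaithful.ofFullyFaithful F).homEquiv.trans (i.homCongr i)
  have hψ : ∀ s t, ψ (s ≫ t) = ψ s ≫ ψ t := fun s t => by simp [ψ]
  have hψ' : ∀ s t u, (ψ s).1 * (ψ t).1 = (ψ u).1 ↔ s.1 * t.1 = u.1 := fun s t u => by
    have h1 : (ψ s).1 * (ψ t).1 = (ψ (s ≫ t)).1 := by rw [hψ]; rfl
    have h2 : s.1 * t.1 = (s ≫ t).1 := rfl
    rw [h1, h2]
    exact ⟨fun h => congrArg Subtype.val (ψ.injective (Subtype.ext h)),
      fun h => congrArg (fun x => (ψ x).1) (Subtype.ext h)⟩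
  { toEquiv :=
    { toFun f := ⟨(ψ (homMk f.1 f.2.2.2 f.2.2.1)).1, (hψ' _ _ _).2 f.2.1,
        IdempotentSplitting.mul_val _, IdempotentSplitting.val_mul _⟩
      invFun f := ⟨(ψ.symm (homMk f.1 f.2.2.2 f.2.2.1)).1, by
        rw [IsIdempotentElem, ← hψ', Equiv.apply_symm_apply]
        exact f.2.1, IdempotentSplitting.mul_val _, IdempotentSplitting.val_mul _⟩
      left_inv f := Subtype.ext (congrArg (fun x : e ⟶ e => x.1)
        (ψ.symm_apply_apply (homMk f.1 f.2.2.2 f.2.2.1)))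
      right_inv f := Subtype.ext (congrArg (fun x : e' ⟶ e' => x.1)
        (ψ.apply_symm_apply (homMk f.1 f.2.2.2 f.2.2.1))) }
    map_mul _ _ _ := hψ' _ _ _ }

theorem dClass_localEquivOfFunctor (F : IdempotentSplitting S ⥤ IdempotentSplitting T) [F.Full]
    [F.Faithful] {e : IdempotentSplitting S} {e' : IdempotentSplitting T} (i : F.obj e ≅ e')
    (f : {f : S // IsIdempotentElem f ∧ IdemLE f e.val}) :
    dClass ((localEquivOfFunctor F i).toEquiv f).1 = classMap F (dClass f.1) := by
  obtain ⟨f, hf, hfe⟩ := f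
  let f' : IdempotentSplitting S := ⟨f, hf⟩
  -- the idempotent endomorphism `f` of `e` splits through the object `f`
  let α : e ⟶ f' := homMk f hfe.2 hf
  let β : f' ⟶ e := homMk f hf hfe.1
  have h1 : β ≫ α = 𝟙 f' := IdempotentSplitting.hom_ext hf
  have h2 : α ≫ β = homMk f hfe.2 hfe.1 := IdempotentSplitting.hom_ext hf
  change dClass (i.inv ≫ F.map (homMk f hfe.2 hfe.1) ≫ i.hom).1 = classMap F (dClass f'.val)
  rw [classMap_val, ← h2, dClass_eq_iff]
  have h3 : (i.inv ≫ F.map (α ≫ β) ≫ i.hom).1 = (i.inv ≫ F.map α).1 * (F.map β ≫ i.hom).1 := by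
    rw [← IdempotentSplitting.comp_val]
    simp
  have h4 : (F.obj f').val = (F.map β ≫ i.hom).1 * (i.inv ≫ F.map α).1 := by
    have h5 : 𝟙 (F.obj f') = (F.map β ≫ i.hom) ≫ i.inv ≫ F.map α := by
      simp [← F.map_comp, h1]
    exact congrArg (fun x : F.obj f' ⟶ F.obj f' => x.1) h5
  rw [h3]
  conv_rhs => rw [h4]
  refine greenD_mul_comm ?_
  rw [← h4]
  exact IdempotentSplitting.val_mul _

end

variable {S T : Type*} [InverseSemigroupWithZero S] [InverseSemigroupWithZero T] {e : S} {e' : T}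

theorem idemLE_iff_mul_eq {f g : S} (hf : IsIdempotentElem f) (hg : IsIdempotentElem g) :
    IdemLE f g ↔ f * g = f := ⟨fun h => h.1, fun h => ⟨h, by rw [idem_comm hg hf, h]⟩⟩

theorem LocalEquiv.le_iff (φ : LocalEquiv e e') (f g : {f : S // IsIdempotentElem f ∧ IdemLE f e}) :
    IdemLE (φ.toEquiv f).1 (φ.toEquiv g).1 ↔ IdemLE f.1 g.1 := by
  rw [idemLE_iff_mul_eq f.2.1 g.2.1, idemLE_iff_mul_eq (φ.toEquiv f).2.1 (φ.toEquiv g).2.1,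
    φ.map_mul]

theorem zero_le_idem (e : S) : IsIdempotentElem (0 : S) ∧ IdemLE 0 e :=
  ⟨zero_mul 0, zero_mul e, mul_zero e⟩

theorem LocalEquiv.map_zero (φ : LocalEquiv e e') : (φ.toEquiv ⟨0, zero_le_idem e⟩).1 = 0 := by
  have h := φ.le_iff ⟨0, zero_le_idem e⟩ (φ.toEquiv.symm ⟨0, zero_le_idem e'⟩)
  rw [Equiv.apply_symm_apply] at h
  exact (h.2 (zero_le_idem _).2).antisymm (zero_le_idem _).2

theorem LocalEquiv.eq_zero_iff (φ : LocalEquiv e e')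
    (f : {f : S // IsIdempotentElem f ∧ IdemLE f e}) : (φ.toEquiv f).1 = 0 ↔ f.1 = 0 := by
  rw [← φ.map_zero, ← Subtype.ext_iff, φ.toEquiv.injective.eq_iff, Subtype.ext_iff]

theorem LocalEquiv.map_self (φ : LocalEquiv e e') (he : IsIdempotentElem e)
    (he' : IsIdempotentElem e') : (φ.toEquiv ⟨e, he, .refl he⟩).1 = e' := by
  have h := φ.le_iff (φ.toEquiv.symm ⟨e', he', .refl he'⟩) ⟨e, he, .refl he⟩
  rw [Equiv.apply_symm_apply] at h
  exact (φ.toEquiv _).2.2.antisymm (h.2 (φ.toEquiv.symm _).2.2)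

theorem LocalEquiv.immBelow (φ : LocalEquiv e e')
    {f g : {f : S // IsIdempotentElem f ∧ IdemLE f e}} (h : ImmBelow f.1 g.1) :
    ImmBelow (φ.toEquiv f).1 (φ.toEquiv g).1 := by
  obtain ⟨h1, h2, h3, h4, h5⟩ := h
  refine ⟨(φ.toEquiv f).2.1, (φ.toEquiv g).2.1, (φ.le_iff f g).2 h3,
    fun h => h4 (congrArg Subtype.val (φ.toEquiv.injective (Subtype.ext h))), fun k hk h6 h7 => ?_⟩
  obtain ⟨k', hk'⟩ := φ.toEquiv.surjective ⟨k, hk, h7.trans (φ.toEquiv g).2.2⟩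
  obtain rfl : (φ.toEquiv k').1 = k := by rw [hk']
  rw [φ.le_iff] at h6 h7
  rcases h5 k'.1 k'.2.1 h6 h7 with h | h
  · exact Or.inl (by rw [Subtype.ext h])
  · exact Or.inr (by rw [Subtype.ext h])

theorem LocalEquiv.immBelow_iff (φ : LocalEquiv e e')
    {f g : {f : S // IsIdempotentElem f ∧ IdemLE f e}} :
    ImmBelow (φ.toEquiv f).1 (φ.toEquiv g).1 ↔ ImmBelow f.1 g.1 := by
  refine ⟨fun h => ?_, φ.immBelow⟩
  have := φ.symm.immBelow h
  change ImmBelow (φ.toEquiv.symm (φ.toEquiv f)).1 (φ.toEquiv.symm (φ.toEquiv g)).1 at this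
  rwa [Equiv.symm_apply_apply, Equiv.symm_apply_apply] at this

theorem idem_le_of_mem_core (he : IsIdempotentElem e) {f : S} (hf : f ∈ core e) :
    IsIdempotentElem f ∧ IdemLE f e := by
  refine hf {f | IsIdempotentElem f ∧ IdemLE f e} ⟨fun f h => h, ⟨he, .refl he⟩, ?_, ?_, ?_⟩
  · exact fun f hf g hg _ => ⟨idem_mul_idem hf.1 hg.1,
      (idemLE_mul_self_left hf.1 hg.1).trans hf.2⟩
  · exact fun h₁ hh₁ h₂ hh₂ f g hf hg _ _ _ =>
      ⟨⟨hf.1, hf.2.2.1.trans hh₁.2⟩, ⟨hg.1, hg.2.2.1.trans hh₂.2⟩⟩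
  · exact fun e₁ _ e₂ h₂ g hg _ h => ⟨hg, h.trans h₂.2⟩

/-- Cores only depend on the semilattice of idempotents below a given idempotent. -/
theorem LocalEquiv.mem_core (φ : LocalEquiv e e') (he : IsIdempotentElem e)
    (he' : IsIdempotentElem e') (f : {f : S // IsIdempotentElem f ∧ IdemLE f e})
    (hf : f.1 ∈ core e) : (φ.toEquiv f).1 ∈ core e' := by
  intro C hC
  suffices h : IsCoreSet e {f | ∃ h, (φ.toEquiv ⟨f, h⟩).1 ∈ C} by
    obtain ⟨h1, h2⟩ := hf _ h
    exact h2
  refine ⟨fun f h => h.1, ⟨⟨he, .refl he⟩, ?_⟩, ?_, ?_, ?_⟩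
  · rw [φ.map_self he he']
    exact hC.self_mem
  · rintro f ⟨hf, hfC⟩ g ⟨hg, hgC⟩ hn
    have hfg : IsIdempotentElem (f * g) ∧ IdemLE (f * g) e :=
      ⟨idem_mul_idem hf.1 hg.1, (idemLE_mul_self_left hf.1 hg.1).trans hf.2⟩
    have h1 := (φ.map_mul ⟨f, hf⟩ ⟨g, hg⟩ ⟨f * g, hfg⟩).2 rfl
    refine ⟨hfg, ?_⟩
    rw [← h1]
    refine hC.mul_mem _ hfC _ hgC ?_
    rw [h1]
    exact fun h => hn ((φ.eq_zero_iff _).1 h)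
  · rintro h₁ ⟨hh₁, hC₁⟩ h₂ ⟨hh₂, hC₂⟩ f g hf hg hfg hgf hn
    have hf' : IsIdempotentElem f ∧ IdemLE f e := ⟨hf.1, hf.2.2.1.trans hh₁.2⟩
    have hg' : IsIdempotentElem g ∧ IdemLE g e := ⟨hg.1, hg.2.2.1.trans hh₂.2⟩
    have hfg' : IsIdempotentElem (f * g) ∧ IdemLE (f * g) e :=
      ⟨idem_mul_idem hf.1 hg.1, (idemLE_mul_self_left hf.1 hg.1).trans hf'.2⟩
    have h1 := (φ.map_mul ⟨f, hf'⟩ ⟨g, hg'⟩ ⟨f * g, hfg'⟩).2 rfl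
    have h2 := hC.diamond _ hC₁ _ hC₂ (φ.toEquiv ⟨f, hf'⟩).1 (φ.toEquiv ⟨g, hg'⟩).1
      (φ.immBelow hf) (φ.immBelow hg) (by rwa [φ.le_iff]) (by rwa [φ.le_iff])
      (by rw [h1]; exact fun h => hn ((φ.eq_zero_iff _).1 h))
    exact ⟨⟨hf', h2.1⟩, ⟨hg', h2.2⟩⟩
  · rintro e₁ ⟨h₁, hC₁⟩ e₂ ⟨h₂, hC₂⟩ g hg h3 h4
    have hg' : IsIdempotentElem g ∧ IdemLE g e := ⟨hg, h4.trans h₂.2⟩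
    exact ⟨hg', hC.convex _ hC₁ _ hC₂ _ (φ.toEquiv ⟨g, hg'⟩).2.1 ((φ.le_iff ⟨e₁, h₁⟩ ⟨g, hg'⟩).2 h3)
      ((φ.le_iff ⟨g, hg'⟩ ⟨e₂, h₂⟩).2 h4)⟩

theorem classMap_zero (F : IdempotentSplitting S ⥤ IdempotentSplitting T) [F.Full] [F.Faithful] :
    classMap F (dClass 0) = dClass 0 := by
  let z : IdempotentSplitting S := ⟨0, zero_mul 0⟩
  change classMap F (dClass z.val) = _
  rw [classMap_val]
  -- the object `0` has only one endomorphism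
  have h1 : ∀ s t : z ⟶ z, s = t := by
    have h2 : ∀ s : z ⟶ z, s.1 = 0 := fun s => by
      rw [← IdempotentSplitting.val_mul s]
      exact zero_mul _
    exact fun s t => IdempotentSplitting.hom_ext (by rw [h2, h2])
  let s : F.obj z ⟶ F.obj z := homMk 0 (mul_zero _) (zero_mul _)
  have h3 : 𝟙 (F.obj z) = s := by
    rw [← F.map_preimage s, ← F.map_id]
    exact congrArg F.map (h1 _ _)
  exact congrArg (fun x : F.obj z ⟶ F.obj z => dClass x.1) h3

theorem prec_classMap (F : IdempotentSplitting S ⥤ IdempotentSplitting T) [F.Full] [F.Faithful]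
    {a b : DClass S} (h : Prec a b) : Prec (classMap F a) (classMap F b) := by
  rcases h with h | rfl
  · refine Or.inl (Relation.TransGen.lift (classMap F) ?_ _ _ h)
    rintro a b ⟨e, he, f, hf, g, hg, rfl, rfl, hle⟩
    let o : IdempotentSplitting S := ⟨e, he⟩
    let φ : LocalEquiv e (F.obj o).val := localEquivOfFunctor F (Iso.refl (F.obj o))
    have hf' := idem_le_of_mem_core he hf
    have hg' := idem_le_of_mem_core he hg
    exact ⟨(F.obj o).val, (F.obj o).idem, _, φ.mem_core he (F.obj o).idem ⟨f, hf'⟩ hf, _,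
      φ.mem_core he (F.obj o).idem ⟨g, hg'⟩ hg,
      dClass_localEquivOfFunctor F (Iso.refl (F.obj o)) ⟨f, hf'⟩,
      dClass_localEquivOfFunctor F (Iso.refl (F.obj o)) ⟨g, hg'⟩, (φ.le_iff _ _).2 hle⟩
  · rw [classMap_zero]
    exact prec_zero_left _

theorem prec_classEquiv_iff (F : IdempotentSplitting S ≌ IdempotentSplitting T) (a b : DClass S) :
    Prec (classEquiv F a) (classEquiv F b) ↔ Prec a b := by
  refine ⟨fun h => ?_, prec_classMap F.functor⟩
  have := prec_classMap F.inverse h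
  change Prec ((classEquiv F).symm (classEquiv F a)) ((classEquiv F).symm (classEquiv F b)) at this
  rwa [Equiv.symm_apply_apply, Equiv.symm_apply_apply] at this

end LocalEquiv

/-! ### Counting labels -/

section Count

variable {A B : Type*} {M : Matrix A A ℕ} {N : Matrix B B ℕ} [Finite A] [Finite B]

variable (M) in
/-- The nonzero idempotents of class `b` immediately below the representative of `a`. -/
def belowSet (a b : DClass (InverseHull M)) : Set (InverseHull M) :=
  {f | f ≠ 0 ∧ ImmBelow f (rep (hullReps M) a) ∧ dClass f = b}

variable (M) in
/-- The labels of class `b` at `a`. -/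
def labelSet (a b : DClass (InverseHull M)) : Set (InverseHull M) :=
  {f | IsLabel (hullReps M) a f ∧ dClass f = b}

variable (hM : IsMarkovTransitionMatrix M) (hN : IsMarkovTransitionMatrix N)

include hM in
theorem finite_belowSet (a b : DClass (InverseHull M)) : (belowSet M a b).Finite := by
  refine ((Set.finite_range fun Y : Set A => el M [] Y []).union
    (Set.finite_range fun c : A => el M [c] (foll M c) [c])).subset ?_
  rintro f ⟨h0, h1, -⟩
  rcases eq_zero_or_eq_cls hM a with rfl | ⟨X, hX, rfl⟩
  · rw [rep_zero] at h1
    exact (h0 (h1.2.2.1.1.symm.trans (mul_zero f))).elim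
  · rw [rep_cls hM hX] at h1
    rcases h1.cases hM (good_nil hX) h0 with ⟨Y, -, h⟩ | ⟨c, -, h, -⟩
    · exact Or.inl ⟨Y, h.symm⟩
    · exact Or.inr ⟨c, h.symm⟩

omit [Finite A] in
theorem labelSet_of_prec {a b : DClass (InverseHull M)} (h : Prec b a) :
    labelSet M a b = belowSet M a b \ {rep (hullReps M) b} := by
  ext f
  constructor
  · rintro ⟨⟨h1, h2, h3⟩, rfl⟩
    exact ⟨⟨h1, h2, rfl⟩, h3.resolve_right fun h4 => h4 h⟩
  · rintro ⟨⟨h1, h2, rfl⟩, h3⟩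
    exact ⟨⟨h1, h2, Or.inl h3⟩, rfl⟩

omit [Finite A] in
theorem labelSet_of_not_prec {a b : DClass (InverseHull M)} (h : ¬ Prec b a) :
    labelSet M a b = belowSet M a b := by
  ext f
  constructor
  · rintro ⟨⟨h1, h2, h3⟩, rfl⟩
    exact ⟨h1, h2, rfl⟩
  · rintro ⟨h1, h2, rfl⟩
    exact ⟨⟨h1, h2, Or.inr h⟩, rfl⟩

include hM hN in
theorem ncard_belowSet
    (F : IdempotentSplitting (InverseHull M) ≌ IdempotentSplitting (InverseHull N))
    (a b : DClass (InverseHull M)) :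
    (belowSet N (classEquiv F a) (classEquiv F b)).ncard = (belowSet M a b).ncard := by
  have hid := isIdempotentElem_rep hM a
  have hid' := isIdempotentElem_rep hN (classEquiv F a)
  let o : IdempotentSplitting (InverseHull M) := ⟨rep (hullReps M) a, hid⟩
  let o' : IdempotentSplitting (InverseHull N) := ⟨rep (hullReps N) (classEquiv F a), hid'⟩
  obtain ⟨i⟩ : Nonempty (F.functor.obj o ≅ o') := by
    refine nonempty_iso_of_greenD (dClass_eq_iff.1 ?_)
    rw [← classMap_val]
    change classEquiv F (dClass (rep (hullReps M) a)) =
      dClass (rep (hullReps N) (classEquiv F a))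
    rw [dClass_rep hM, dClass_rep hN]
  let φ : LocalEquiv (rep (hullReps M) a) (rep (hullReps N) (classEquiv F a)) :=
    localEquivOfFunctor F.functor i
  have hcl : ∀ f, dClass (φ.toEquiv f).1 = classEquiv F (dClass f.1) :=
    dClass_localEquivOfFunctor F.functor i
  have hmem : ∀ f, (φ.toEquiv f).1 ∈ belowSet N (classEquiv F a) (classEquiv F b) ↔
      f.1 ∈ belowSet M a b := fun f => by
    have h1 := φ.immBelow_iff (f := f) (g := ⟨_, hid, .refl hid⟩)
    rw [φ.map_self hid hid'] at h1
    exact and_congr (not_congr (φ.eq_zero_iff f)) (and_congr h1 (by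
      rw [hcl, (classEquiv F).injective.eq_iff]))
  refine (Set.ncard_congr (fun f hf => (φ.toEquiv ⟨f, hf.2.1.1, hf.2.1.2.2.1⟩).1)
    (fun f hf => (hmem ⟨f, hf.2.1.1, hf.2.1.2.2.1⟩).2 hf) (fun f g hf hg h => ?_)
    (fun g hg => ?_)).symm
  · exact congrArg Subtype.val (φ.toEquiv.injective (Subtype.ext h))
  · obtain ⟨f, hf⟩ := φ.toEquiv.surjective ⟨g, hg.2.1.1, hg.2.1.2.2.1⟩
    have h1 : (φ.toEquiv f).1 = g := by rw [hf]
    rw [← h1, hmem] at hg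
    exact ⟨f.1, hg, h1⟩

include hM in
theorem rep_mem_belowSet_iff {a b : DClass (InverseHull M)} (h : Prec b a) :
    rep (hullReps M) b ∈ belowSet M a b ↔
      b ≠ dClass 0 ∧ b ≠ a ∧ ∀ c, Prec b c → Prec c a → c = b ∨ c = a := by
  have h1 : rep (hullReps M) b ≠ 0 ↔ b ≠ dClass 0 := by
    rw [ne_eq, ← dClass_eq_zero_iff, dClass_rep hM]
  rw [← h1]
  constructor
  · rintro ⟨h2, h3, -⟩
    exact ⟨h2, (immBelow_rep_iff hM (h1.1 h2) h).1 h3⟩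
  · rintro ⟨h2, h3⟩
    exact ⟨h2, (immBelow_rep_iff hM (h1.1 h2) h).2 h3, dClass_rep hM b⟩

include hM hN in
/-- The labels of class `b` at `a` are the covered idempotents of class `b`, except for the
representative of `b` when `b ⪯ a`; whether that one is covered can be read off from `⪯`. -/
theorem ncard_labelSet
    (F : IdempotentSplitting (InverseHull M) ≌ IdempotentSplitting (InverseHull N))
    (a b : DClass (InverseHull M)) :
    (labelSet N (classEquiv F a) (classEquiv F b)).ncard = (labelSet M a b).ncard := by
  by_cases h : Prec b a
  · have h' := (prec_classEquiv_iff F b a).2 h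
    rw [labelSet_of_prec h, labelSet_of_prec h']
    have h0 : classEquiv F (dClass 0) = dClass 0 := classMap_zero F.functor
    have hiff : rep (hullReps N) (classEquiv F b) ∈ belowSet N (classEquiv F a) (classEquiv F b) ↔
        rep (hullReps M) b ∈ belowSet M a b := by
      rw [rep_mem_belowSet_iff hM h, rep_mem_belowSet_iff hN h', (classEquiv F).injective.ne_iff,
        ← (classEquiv F).injective.ne_iff (x := b) (y := dClass 0), h0]
      refine and_congr_right fun _ => and_congr_right fun _ => ⟨fun hc c h1 h2 => ?_,
        fun hc c h1 h2 => ?_⟩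
      · have := hc (classEquiv F c) ((prec_classEquiv_iff F _ _).2 h1)
          ((prec_classEquiv_iff F _ _).2 h2)
        rwa [(classEquiv F).injective.eq_iff, (classEquiv F).injective.eq_iff] at this
      · obtain ⟨c, rfl⟩ := (classEquiv F).surjective c
        rw [prec_classEquiv_iff] at h1 h2
        rw [(classEquiv F).injective.eq_iff, (classEquiv F).injective.eq_iff]
        exact hc c h1 h2
    by_cases hm : rep (hullReps M) b ∈ belowSet M a b
    · rw [Set.ncard_sdiff_singleton_of_mem hm, Set.ncard_sdiff_singleton_of_mem (hiff.2 hm),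
        ncard_belowSet hM hN]
    · rw [Set.sdiff_singleton_eq_self hm, Set.sdiff_singleton_eq_self (fun h => hm (hiff.1 h)),
        ncard_belowSet hM hN]
  · rw [labelSet_of_not_prec h, labelSet_of_not_prec
      (fun h' => h ((prec_classEquiv_iff F b a).1 h')), ncard_belowSet hM hN]

variable (M) in
/-- Labels, sorted by vertex and class. -/
def labelSigma : GraphLabel (hullReps M) ≃
    Σ p : DClass (InverseHull M) × DClass (InverseHull M), labelSet M p.1 p.2 where
  toFun x := ⟨(x.vertex.1, dClass x.elt), x.elt, x.isLabel, rfl⟩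
  invFun x := ⟨⟨x.1.1, x.2.2.1.ne_zero⟩, x.2.1, x.2.2.1⟩
  left_inv _ := rfl
  right_inv := by
    rintro ⟨⟨a, b⟩, f, h, hb⟩
    dsimp only at hb
    subst hb
    rfl

include hM hN in
/-- An equivalence of idempotent splittings preserves `⪯`, and hence the number of labels with
given vertex and class. It need not map labels to labels itself. -/
theorem nonempty_dataIso_of_moritaEquivalent
    (h : MoritaEquivalent (InverseHull M) (InverseHull N)) : Nonempty (DataIso M N) := by
  obtain ⟨F⟩ := h
  have hfin : ∀ a b, Finite (labelSet M a b) := fun a b =>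
    ((finite_belowSet hM a b).subset fun f hf => ⟨hf.1.1, hf.1.2.1, hf.2⟩).to_subtype
  have hfin' : ∀ a b, Finite (labelSet N a b) := fun a b =>
    ((finite_belowSet hN a b).subset fun f hf => ⟨hf.1.1, hf.1.2.1, hf.2⟩).to_subtype
  have ε : ∀ p : DClass (InverseHull M) × DClass (InverseHull M),
      Nonempty (labelSet M p.1 p.2 ≃ labelSet N (classEquiv F p.1) (classEquiv F p.2)) := fun p =>
    Finite.card_eq.1 (ncard_labelSet hM hN F p.1 p.2).symm
  let σ := Equiv.sigmaCongr (Equiv.prodCongr (classEquiv F) (classEquiv F))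
    (β₂ := fun p => labelSet N p.1 p.2) fun p => (ε p).some
  let lab := (labelSigma M).trans (σ.trans (labelSigma N).symm)
  have hlab : ∀ x, (labelSigma N (lab x)).1 =
      (classEquiv F x.vertex.1, classEquiv F (dClass x.elt)) := fun x => by
      rw [Equiv.trans_apply, Equiv.trans_apply, Equiv.apply_symm_apply]
      rfl
  exact ⟨⟨classEquiv F, lab, classMap_zero F.functor, prec_classEquiv_iff F,
    fun x => congrArg Prod.fst (hlab x), fun x => congrArg Prod.snd (hlab x)⟩⟩

end Count

/-! ### Paths of labels -/

section Path

/-- `IsPath a L b` says that the labels in `L` lead from the class `a` down to the nonzero class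
`b`: the vertex of each label is below the class of the preceding one (below `a` for the first),
and `b` is below the class of the last one. -/
def IsPath {S : Type*} [InverseSemigroupWithZero S] {R : Set S} :
    DClass S → List (GraphLabel R) → DClass S → Prop
  | a, [], b => b ≠ dClass 0 ∧ Prec b a
  | a, x :: L, b => Prec x.vertex.1 a ∧ IsPath (dClass x.elt) L b

theorem IsPath.ne_zero {S : Type*} [InverseSemigroupWithZero S] {R : Set S} {a b : DClass S}
    {L : List (GraphLabel R)} (h : IsPath a L b) : b ≠ dClass 0 := by
  induction L generalizing a with
  | nil => exact h.1
  | cons x L ih => exact ih h.2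

variable {A B : Type*} {M : Matrix A A ℕ} {N : Matrix B B ℕ}

theorem DataIso.isPath_map_iff (D : DataIso M N) {a b : DClass (InverseHull M)}
    {L : List (GraphLabel (hullReps M))} :
    IsPath (D.cl a) (L.map D.lab) (D.cl b) ↔ IsPath a L b := by
  induction L generalizing a with
  | nil => exact and_congr (not_congr D.eq_zero_iff) (D.prec_iff _ _)
  | cons x L ih =>
    rw [List.map_cons, IsPath, IsPath, D.map_vertex, D.map_class, D.prec_iff, ih]

variable [Finite A] [Finite B] (hM : IsMarkovTransitionMatrix M)
  (hN : IsMarkovTransitionMatrix N)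

include hM in
theorem IsPath.mono {a b c : DClass (InverseHull M)} {L : List (GraphLabel (hullReps M))}
    (h : IsPath a L b) (hac : Prec a c) : IsPath c L b := by
  cases L with
  | nil => exact ⟨h.1, prec_trans hM h.2 hac⟩
  | cons x L => exact ⟨prec_trans hM h.1 hac, h.2⟩

include hM in
theorem IsPath.append {a b c : DClass (InverseHull M)} {L K : List (GraphLabel (hullReps M))}
    (h : IsPath a L b) (h' : IsPath b K c) : IsPath a (L ++ K) c := by
  induction L generalizing a with
  | nil => exact h'.mono hM h.2
  | cons x L ih => exact ⟨h.1, ih h.2⟩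

open Classical in
/-- The word that the idempotent of a label adds: empty for a subset, one letter otherwise. -/
noncomputable def GraphLabel.word (x : GraphLabel (hullReps M)) : List A :=
  if h : ∃ k Z, Good M k Z k ∧ x.elt = el M k Z k then h.choose else []

include hM in
theorem GraphLabel.exists_elt_eq (x : GraphLabel (hullReps M)) :
    ∃ Z, Good M x.word Z x.word ∧ x.elt = el M x.word Z x.word := by
  have h := (isIdempotentElem_cases hM x.isLabel.2.1.1).resolve_left x.isLabel.1
  rw [GraphLabel.word, dif_pos h]
  exact h.choose_spec

theorem GraphLabel.word_eq (x : GraphLabel (hullReps M)) {k : List A} {Z : Set A}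
    (hg : Good M k Z k) (hx : x.elt = el M k Z k) : x.word = k := by
  have h : ∃ k Z, Good M k Z k ∧ x.elt = el M k Z k := ⟨k, Z, hg, hx⟩
  rw [GraphLabel.word, dif_pos h]
  obtain ⟨Y, h1, h2⟩ := h.choose_spec
  exact (el_inj h1 (h2.symm.trans hx)).1

/-- The word spelled by a list of labels. -/
noncomputable def letters (L : List (GraphLabel (hullReps M))) : List A :=
  L.flatMap GraphLabel.word

omit [Finite A] in
theorem letters_cons (x : GraphLabel (hullReps M)) (L : List (GraphLabel (hullReps M))) :
    letters (x :: L) = x.word ++ letters L := List.flatMap_cons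

omit [Finite A] in
theorem letters_append (L K : List (GraphLabel (hullReps M))) :
    letters (L ++ K) = letters L ++ letters K := List.flatMap_append

include hM in
theorem GraphLabel.bel_word (x : GraphLabel (hullReps M)) {Y Z : Set A} (hY : Y ∈ Fam M)
    (hx : x.vertex.1 = cls M Y) (hZ : Good M x.word Z x.word)
    (hx' : x.elt = el M x.word Z x.word) : Bel M Y x.word Z := by
  have h := x.isLabel.2.1.2.2.1
  rw [hx, rep_cls hM hY, hx', idemLE_el_iff hZ (good_nil hY)] at h
  obtain ⟨k, h1, h2⟩ := h
  rw [List.nil_append] at h1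
  rwa [h1]

include hM in
theorem IsPath.bel {X Z : Set A} (hX : X ∈ Fam M) (hZ : Z ∈ Fam M)
    {L : List (GraphLabel (hullReps M))} (h : IsPath (cls M X) L (cls M Z)) :
    Bel M X (letters L) Z := by
  induction L generalizing X with
  | nil => exact bel_nil.2 ((prec_cls_iff hM hZ hX).1 h.2).subset
  | cons x L ih =>
    obtain ⟨h1, h2⟩ := h
    obtain ⟨W, hW, hx⟩ := x.exists_elt_eq hM
    obtain ⟨Y, hY, hxY⟩ := (eq_zero_or_eq_cls hM x.vertex.1).resolve_left x.vertex.2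
    rw [hx, dClass_el hW] at h2
    rw [hxY, prec_cls_iff hM hY hX] at h1
    rw [letters_cons]
    exact Bel.append (fun z hz => (x.bel_word hM hY hxY hW hx z hz).mono h1.subset) (ih hW.mem h2)

include hM in
theorem exists_isPath_of_subset {Z X : Set A} (hZ : Z ∈ Fam M) (hX : X ∈ Fam M) (hs : Z ⊆ X) :
    ∃ L : List (GraphLabel (hullReps M)), IsPath (cls M X) L (cls M Z) ∧ letters L = [] := by
  have hwf : WellFounded fun X Y : Set A => X ⊂ Y := wellFounded_lt
  induction X using hwf.induction with
  | _ X ih =>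
    by_cases hne : Z = X
    · subst hne
      exact ⟨[], ⟨cls_ne_zero hZ, prec_refl hM _⟩, rfl⟩
    obtain ⟨K, hK, hZK⟩ := exists_cov hZ hX hs hne
    obtain ⟨L, hL, hL'⟩ := ih K (hK.subset.ssubset_of_ne hK.ne) hK.left_mem hZK
    by_cases hp : PrecF (Fam M) K X
    · exact ⟨L, hL.mono hM ((prec_cls_iff hM hK.left_mem hX).2 hp), hL'⟩
    · let x : GraphLabel (hullReps M) := ⟨⟨cls M X, cls_ne_zero hX⟩, el M [] K [],
        (isLabel_cls_iff hM hX).2 (Or.inl ⟨K, hK, rfl, hp⟩)⟩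
      refine ⟨x :: L, ⟨prec_refl hM _, hL⟩, ?_⟩
      rw [letters_cons, hL', x.word_eq (good_nil hK.left_mem) rfl, List.append_nil]

include hM in
/-- Every nonzero idempotent below the representative of `X` is reached by a path from `X`. -/
theorem Bel.exists_isPath {Z X : Set A} (hZ : Z ∈ Fam M) (hX : X ∈ Fam M) {u : List A}
    (h : Bel M X u Z) :
    ∃ L : List (GraphLabel (hullReps M)), IsPath (cls M X) L (cls M Z) ∧ letters L = u := by
  induction u generalizing X with
  | nil => exact exists_isPath_of_subset hM hZ hX (bel_nil.1 h)
  | cons a u ih =>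
    obtain ⟨ha, hp⟩ := (bel_cons hZ.1).1 h
    have h1 : Bel M (foll M a) u Z := fun z hz => isW_foll.2 ⟨by simp, hp z hz⟩
    obtain ⟨K, hK, hK'⟩ := ih (foll_mem_fam hM a) h1
    have hfin : {Y | Y ∈ Fam M ∧ a ∈ Y ∧ Y ⊆ X}.Finite := Set.toFinite _
    obtain ⟨Y, hY⟩ := hfin.exists_minimal ⟨X, hX, ha, subset_rfl⟩
    obtain ⟨hYF, haY, hYX⟩ := hY.prop
    obtain ⟨L, hL, hL'⟩ := exists_isPath_of_subset hM hYF hX hYX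
    let x : GraphLabel (hullReps M) := ⟨⟨cls M Y, cls_ne_zero hYF⟩, el M [a] (foll M a) [a],
      (isLabel_cls_iff hM hYF).2 (Or.inr ⟨a, haY, rfl, fun W hW haW hWY =>
        hWY.antisymm (hY.2 ⟨hW, haW, hWY.trans hYX⟩ hWY)⟩)⟩
    have hx : dClass x.elt = cls M (foll M a) := dClass_el (good_letter hM a)
    refine ⟨L ++ x :: K, hL.append hM ⟨prec_refl hM _, ?_⟩, ?_⟩
    · rw [hx]
      exact hK
    · rw [letters_append, letters_cons, hL', hK', x.word_eq (good_letter hM a) rfl]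
      rfl

include hM in
theorem IsPath.le_elt {a : DClass (InverseHull M)} {x : GraphLabel (hullReps M)}
    {L : List (GraphLabel (hullReps M))} {Z : Set A} (hZ : Z ∈ Fam M)
    (h : IsPath a (x :: L) (cls M Z)) :
    Good M (letters (x :: L)) Z (letters (x :: L)) ∧
      IdemLE (el M (letters (x :: L)) Z (letters (x :: L))) x.elt := by
  obtain ⟨W, hW, hx⟩ := x.exists_elt_eq hM
  have h2 := h.2
  rw [hx, dClass_el hW] at h2
  have h3 := h2.bel hM hW.mem hZ
  have h4 : Good M (letters (x :: L)) Z (letters (x :: L)) := by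
    rw [letters_cons]
    exact good_self_of hZ (hW.left.append h3)
  refine ⟨h4, ?_⟩
  rw [hx, idemLE_el_iff h4 hW]
  exact ⟨_, letters_cons x L, h3⟩

theorem eq_zero_of_le_of_le {S : Type*} [InverseSemigroupWithZero S] {z f g : S}
    (hf : IdemLE z f) (hg : IdemLE z g) (h : f * g = 0) : z = 0 := by
  rw [← hg.1, ← hf.1, mul_assoc, h, mul_zero]

include hM in
/-- A nonempty path and the empty path between two classes do not spell the same word. -/
theorem IsPath.letters_ne_nil {a : DClass (InverseHull M)} {x : GraphLabel (hullReps M)}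
    {L : List (GraphLabel (hullReps M))} {Z : Set A} (hZ : Z ∈ Fam M)
    (h : IsPath a (x :: L) (cls M Z)) (h' : Prec (cls M Z) a) : letters (x :: L) ≠ [] := by
  intro hnil
  obtain ⟨hg, hle⟩ := h.le_elt hM hZ
  rw [hnil] at hg hle
  have hle' := hle.trans x.isLabel.2.1.2.2.1
  have hZrep := rep_cls hM hZ
  have hz := el_ne_zero hg
  -- the class of the end point is below the vertex of the first label for `⪯` and different from
  -- it, but the end point is contained in that label
  obtain ⟨g, h1, h2, h3⟩ := exists_rep_eq_mul hM h' h.1 (by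
    rw [hZrep, hle'.1]
    exact hz)
  rw [hZrep, hle'.1] at h1
  have h4 : g = cls M Z := rep_injective hM (h1.trans hZrep.symm)
  rw [h4] at h3
  have h5 : cls M Z ≠ x.vertex.1 := fun h5 => by
    rw [← h5, hZrep] at hle'
    have h6 := x.isLabel.2.1.2.2.1
    rw [← h5, hZrep] at h6
    have h7 := x.isLabel.2.1.2.2.2.1
    rw [← h5, hZrep] at h7
    exact h7 (h6.antisymm hle)
  have h6 := x.isLabel.rep_mul_eq_zero hM h3 h5
  rw [hZrep, hle.1] at h6
  exact hz h6

include hM in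
/-- A path is determined by its end points and the word that it spells: labels at the same vertex
are disjoint, and labels are disjoint from the classes strictly below their vertex. -/
theorem IsPath.unique {a : DClass (InverseHull M)} {L K : List (GraphLabel (hullReps M))}
    {b : DClass (InverseHull M)} (h : IsPath a L b) (h' : IsPath a K b)
    (hl : letters L = letters K) : L = K := by
  obtain ⟨Z, hZ, rfl⟩ := (eq_zero_or_eq_cls hM b).resolve_left h.ne_zero
  induction L generalizing a K with
  | nil =>
    cases K with
    | nil => rfl
    | cons y K => exact (h'.letters_ne_nil hM hZ h.2 hl.symm).elim
  | cons x L ih =>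
    cases K with
    | nil => exact (h.letters_ne_nil hM hZ h'.2 hl).elim
    | cons y K =>
      obtain ⟨hg, hx⟩ := h.le_elt hM hZ
      have hy := (h'.le_elt hM hZ).2
      rw [← hl] at hy
      have hz := el_ne_zero hg
      have hx' := hx.trans x.isLabel.2.1.2.2.1
      have hy' := hy.trans y.isLabel.2.1.2.2.1
      -- the common end point is below the class `g` of the product of the two vertices; as labels
      -- are disjoint from smaller classes, `g` is the vertex of both first labels
      obtain ⟨g, h1, h2, h3⟩ := exists_rep_eq_mul hM h.1 h'.1
        fun h0 => hz (eq_zero_of_le_of_le hx' hy' h0)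
      have hle : IdemLE (el M (letters (x :: L)) Z (letters (x :: L))) (rep (hullReps M) g) := by
        rw [h1]
        exact ⟨by rw [← mul_assoc, hx'.1, hy'.1], by rw [mul_assoc, hy'.2, hx'.2]⟩
      have h4 : g = x.vertex.1 := by
        by_contra hne
        exact hz (eq_zero_of_le_of_le hle hx (x.isLabel.rep_mul_eq_zero hM h2 hne))
      have h5 : g = y.vertex.1 := by
        by_contra hne
        exact hz (eq_zero_of_le_of_le hle hy (y.isLabel.rep_mul_eq_zero hM h3 hne))
      have h6 : x.vertex.1 = y.vertex.1 := h4.symm.trans h5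
      have h7 : x.elt = y.elt := by
        by_contra hne
        have hy2 := y.isLabel
        rw [← h6] at hy2
        exact hz (eq_zero_of_le_of_le hx hy (x.isLabel.mul_eq_zero hM hy2 hne))
      obtain rfl : x = y := GraphLabel.ext (Subtype.ext h6) h7
      rw [letters_cons, letters_cons] at hl
      rw [ih (List.append_cancel_left hl) h.2 h'.2]

end Path

/-! ### The equivalence of idempotent splittings -/

section Morita

variable {A B : Type*} {M : Matrix A A ℕ} {N : Matrix B B ℕ}

open Classical in
/-- The word `u` of an idempotent in normal form `el M u X u` (the empty word for the idempotent
`0`). -/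
noncomputable def stem (e : IdempotentSplitting (InverseHull M)) : List A :=
  if h : ∃ u X, Good M u X u ∧ e.val = el M u X u then h.choose else []

/-- `s` restricts to the element that sends the idempotent at the end of the path `K` from `f` to
the idempotent at the end of the path `L` from `e`, where both paths end in the class `b`. Only
nonzero classes `b` are of interest. -/
def Res (e f : IdempotentSplitting (InverseHull M)) (s : InverseHull M)
    (L K : List (GraphLabel (hullReps M))) (b : DClass (InverseHull M)) : Prop :=
  ∀ Z ∈ Fam M, cls M Z = b → Sub s (stem e ++ letters L) Z (stem f ++ letters K)

variable [Finite A] [Finite B] (hM : IsMarkovTransitionMatrix M)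
  (hN : IsMarkovTransitionMatrix N)

include hM in
theorem exists_val_eq (e : IdempotentSplitting (InverseHull M)) (he : e.val ≠ 0) :
    ∃ X, Good M (stem e) X (stem e) ∧ e.val = el M (stem e) X (stem e) ∧
      dClass e.val = cls M X := by
  have h := (isIdempotentElem_cases hM e.idem).resolve_left he
  rw [stem, dif_pos h]
  obtain ⟨X, h1, h2⟩ := h.choose_spec
  exact ⟨X, h1, h2, by rw [h2, dClass_el h1]⟩

include hM in
theorem IsPath.start_ne_zero {a b : DClass (InverseHull M)} {L : List (GraphLabel (hullReps M))}
    (h : IsPath a L b) : a ≠ dClass 0 := by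
  rintro rfl
  cases L with
  | nil => exact h.1 ((prec_zero_iff hM).1 h.2)
  | cons x L => exact x.not_prec_zero hM h.1

include hM in
theorem IsPath.exists_good {e : IdempotentSplitting (InverseHull M)} {b : DClass (InverseHull M)}
    {L : List (GraphLabel (hullReps M))} (h : IsPath (dClass e.val) L b) {Z : Set A}
    (hZ : Z ∈ Fam M) (hb : cls M Z = b) : Good M (stem e ++ letters L) Z (stem e ++ letters L) ∧
      IdemLE (el M (stem e ++ letters L) Z (stem e ++ letters L)) e.val := by
  subst hb
  obtain ⟨X, h1, h2, h3⟩ := exists_val_eq hM e fun h0 => h.start_ne_zero hM (by rw [h0])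
  rw [h3] at h
  have h4 := h.bel hM h1.mem hZ
  have h5 := good_self_of hZ (h1.left.append h4)
  refine ⟨h5, ?_⟩
  rw [h2]
  exact (idemLE_el_iff h5 h1).2 ⟨_, rfl, h4⟩

include hM in
theorem exists_isPath_of_le {e : IdempotentSplitting (InverseHull M)} {u : List A} {Z : Set A}
    (hu : Good M u Z u) (h : IdemLE (el M u Z u) e.val) :
    ∃ L : List (GraphLabel (hullReps M)), IsPath (dClass e.val) L (cls M Z) ∧
      u = stem e ++ letters L := by
  obtain ⟨X, h1, h2, h3⟩ := exists_val_eq hM e fun h0 => el_ne_zero hu (by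
    rw [← h.1, h0, mul_zero])
  rw [h2, idemLE_el_iff hu h1] at h
  obtain ⟨k, rfl, hk⟩ := h
  obtain ⟨L, hL, rfl⟩ := hk.exists_isPath hM hu.mem h1.mem
  exact ⟨L, h3 ▸ hL, rfl⟩

include hM in
/-- Every nonzero morphism is given by two paths with a common end point. -/
theorem hom_cases {e f : IdempotentSplitting (InverseHull M)} (s : e ⟶ f) :
    s.1 = 0 ∨ ∃ L K Z, Z ∈ Fam M ∧ IsPath (dClass e.val) L (cls M Z) ∧
      IsPath (dClass f.val) K (cls M Z) ∧
      s.1 = el M (stem e ++ letters L) Z (stem f ++ letters K) := by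
  rcases eq_zero_or_eq_el hM s.1 with h | ⟨a, Z, b, hg, hs⟩
  · exact Or.inl h
  have h1 := IdempotentSplitting.val_mul s
  have h2 := IdempotentSplitting.mul_val s
  rw [hs] at h1 h2
  have h3 : IdemLE (el M a Z a) e.val := by
    refine (idemLE_iff_mul_eq (isIdempotentElem_el (good_self_of hg.mem hg.left)) e.idem).2 ?_
    rw [idem_comm (isIdempotentElem_el (good_self_of hg.mem hg.left)) e.idem,
      ← el_mul hg hg.symm, ← mul_assoc, h1]
  have h4 : IdemLE (el M b Z b) f.val := by
    refine (idemLE_iff_mul_eq (isIdempotentElem_el (good_self_of hg.mem hg.right)) f.idem).2 ?_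
    rw [← el_mul hg.symm hg, mul_assoc, h2]
  obtain ⟨L, hL, rfl⟩ := exists_isPath_of_le hM (good_self_of hg.mem hg.left) h3
  obtain ⟨K, hK, rfl⟩ := exists_isPath_of_le hM (good_self_of hg.mem hg.right) h4
  exact Or.inr ⟨L, K, Z, hg.mem, hL, hK, hs⟩

include hM in
theorem exists_hom_of_isPath {e f : IdempotentSplitting (InverseHull M)}
    {L K : List (GraphLabel (hullReps M))} {Z : Set A} (hZ : Z ∈ Fam M)
    (hL : IsPath (dClass e.val) L (cls M Z)) (hK : IsPath (dClass f.val) K (cls M Z)) :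
    Good M (stem e ++ letters L) Z (stem f ++ letters K) ∧
      ∃ s : e ⟶ f, s.1 = el M (stem e ++ letters L) Z (stem f ++ letters K) := by
  obtain ⟨h1, h2⟩ := hL.exists_good hM hZ rfl
  obtain ⟨h3, h4⟩ := hK.exists_good hM hZ rfl
  have hg : Good M (stem e ++ letters L) Z (stem f ++ letters K) := ⟨hZ, h1.left, h3.left⟩
  refine ⟨hg, homMk (el M (stem e ++ letters L) Z (stem f ++ letters K)) ?_ ?_, rfl⟩
  · rw [← el_mul h1 hg, ← mul_assoc, h2.2]
  · rw [← el_mul hg h3, mul_assoc, h4.1]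

omit [Finite A] in
theorem not_sub_zero {u v : List A} {Z : Set A} (hZ : Z.Nonempty) :
    ¬ Sub (0 : InverseHull M) u Z v := fun h => by
  obtain ⟨z, hz⟩ := hZ
  exact not_hrel_zero (h [z] (isW_singleton.2 hz))

include hM in
theorem not_res_zero {e f : IdempotentSplitting (InverseHull M)}
    {L K : List (GraphLabel (hullReps M))} {b : DClass (InverseHull M)} (hb : b ≠ dClass 0) :
    ¬ Res e f 0 L K b := fun h => by
  obtain ⟨Z, hZ, rfl⟩ := (eq_zero_or_eq_cls hM b).resolve_left hb
  exact not_sub_zero hZ.1 (h Z hZ rfl)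

include hM in
/-- The restrictions of a morphism given by two paths are obtained by prolonging both paths in the
same way. -/
theorem res_el_iff {e f : IdempotentSplitting (InverseHull M)}
    {L K L' K' : List (GraphLabel (hullReps M))} {Z : Set A} {b : DClass (InverseHull M)}
    (hZ : Z ∈ Fam M) (hL : IsPath (dClass e.val) L (cls M Z))
    (hK : IsPath (dClass f.val) K (cls M Z)) (hL' : IsPath (dClass e.val) L' b)
    (hK' : IsPath (dClass f.val) K' b) :
    Res e f (el M (stem e ++ letters L) Z (stem f ++ letters K)) L' K' b ↔
      ∃ J, IsPath (cls M Z) J b ∧ L' = L ++ J ∧ K' = K ++ J := by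
  obtain ⟨hg, -⟩ := exists_hom_of_isPath hM hZ hL hK
  constructor
  · intro h
    obtain ⟨Y, hY, rfl⟩ := (eq_zero_or_eq_cls hM b).resolve_left hL'.ne_zero
    obtain ⟨k, h1, h2, h3⟩ := (sub_el_iff hg hY.1).1 (h Y hY rfl)
    obtain ⟨J, hJ, rfl⟩ := h3.exists_isPath hM hY hZ
    rw [List.append_assoc, ← letters_append] at h1 h2
    exact ⟨J, hJ, hL'.unique hM (hL.append hM hJ) (List.append_cancel_left h1),
      hK'.unique hM (hK.append hM hJ) (List.append_cancel_left h2)⟩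
  · rintro ⟨J, hJ, rfl, rfl⟩ Y hY rfl
    exact (sub_el_iff hg hY.1).2 ⟨letters J, by rw [letters_append, List.append_assoc],
      by rw [letters_append, List.append_assoc], hJ.bel hM hZ hY⟩

include hM in
/-- A morphism is determined by its restrictions. -/
theorem hom_eq_of_res {e f : IdempotentSplitting (InverseHull M)} {s t : e ⟶ f}
    (h : ∀ L K b, IsPath (dClass e.val) L b → IsPath (dClass f.val) K b →
      (Res e f s.1 L K b ↔ Res e f t.1 L K b)) : s = t := by
  have key : ∀ s t : e ⟶ f, (∀ L K b, IsPath (dClass e.val) L b → IsPath (dClass f.val) K b →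
      Res e f s.1 L K b → Res e f t.1 L K b) → ∀ x y, HRel s.1 x y → HRel t.1 x y := by
    intro s t h x y hxy
    rcases hom_cases hM s with hs | ⟨L, K, Z, hZ, hL, hK, hs⟩
    · rw [hs] at hxy
      exact (not_hrel_zero hxy).elim
    · have hg := (exists_hom_of_isPath hM hZ hL hK).1
      have h1 : Res e f s.1 L K (cls M Z) := by
        rw [hs, res_el_iff hM hZ hL hK hL hK]
        exact ⟨[], ⟨cls_ne_zero hZ, prec_refl hM _⟩, by simp, by simp⟩
      have h2 := h L K _ hL hK h1 Z hZ rfl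
      rw [hs] at hxy
      obtain ⟨w, hw, rfl, rfl⟩ := (hrel_el hg).1 hxy
      exact h2 w hw
  refine IdempotentSplitting.hom_ext (hull_ext fun x y => ⟨key s t ?_ x y, key t s ?_ x y⟩)
  · exact fun L K b hL hK => (h L K b hL hK).1
  · exact fun L K b hL hK => (h L K b hL hK).2

include hM in
/-- Restrictions compose like relations between paths. -/
theorem res_mul_iff {e f g : IdempotentSplitting (InverseHull M)} (s : e ⟶ f) (t : f ⟶ g)
    {L K : List (GraphLabel (hullReps M))} {b : DClass (InverseHull M)} (hb : b ≠ dClass 0) :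
    Res e g (s.1 * t.1) L K b ↔
      ∃ J, IsPath (dClass f.val) J b ∧ Res e f s.1 L J b ∧ Res f g t.1 J K b := by
  obtain ⟨Z, hZ, rfl⟩ := (eq_zero_or_eq_cls hM b).resolve_left hb
  constructor
  · intro h
    have h0 := h Z hZ rfl
    rcases hom_cases hM s with hs | ⟨L₁, K₁, Z₁, hZ₁, hL₁, hK₁, hs⟩
    · rw [hs, zero_mul] at h0
      exact (not_sub_zero hZ.1 h0).elim
    rcases hom_cases hM t with ht | ⟨L₂, K₂, Z₂, hZ₂, hL₂, hK₂, ht⟩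
    · rw [ht, mul_zero] at h0
      exact (not_sub_zero hZ.1 h0).elim
    have hg₁ := (exists_hom_of_isPath hM hZ₁ hL₁ hK₁).1
    have hg₂ := (exists_hom_of_isPath hM hZ₂ hL₂ hK₂).1
    obtain ⟨n, hn⟩ : ∃ n, ∀ z ∈ Z, HRel s.1 (n ++ [z]) (stem e ++ letters L ++ [z]) ∧
        HRel t.1 (stem g ++ letters K ++ [z]) (n ++ [z]) := by
      have h1 : ∀ z ∈ Z, ∃ n, HRel s.1 (n ++ [z]) (stem e ++ letters L ++ [z]) ∧
          HRel t.1 (stem g ++ letters K ++ [z]) (n ++ [z]) ∧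
          ∃ j, stem e ++ letters L = stem e ++ letters L₁ ++ j ∧
            n = stem f ++ letters K₁ ++ j := by
        intro z hz
        obtain ⟨y, hy, hy'⟩ := hrel_mul.1 (h0 [z] (isW_singleton.2 hz))
        have hy₂ := hy'
        rw [hs] at hy'
        obtain ⟨w, hw, rfl, hw'⟩ := (hrel_el hg₁).1 hy'
        obtain ⟨j, c, rfl⟩ := (List.eq_nil_or_concat w).resolve_left hw.ne_nil
        rw [List.concat_eq_append, ← List.append_assoc] at *
        have h2 := List.append_inj' hw' rfl
        rw [← (List.cons.inj h2.2).1] at hy hy₂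
        exact ⟨stem f ++ letters K₁ ++ j, hy₂, hy, j, h2.1, rfl⟩
      obtain ⟨z, hz⟩ := hZ.1
      obtain ⟨n, -, -, j, h2, rfl⟩ := h1 z hz
      refine ⟨stem f ++ letters K₁ ++ j, fun z' hz' => ?_⟩
      obtain ⟨n', h3, h4, j', h5, rfl⟩ := h1 z' hz'
      rw [h2] at h5
      rw [List.append_cancel_left h5]
      exact ⟨h3, h4⟩
    -- membership of single letters suffices to recognize a restriction
    have ext : ∀ {s : InverseHull M} {a b u v : List A} {Y : Set A}, Good M a Y b →
        s = el M a Y b → (∀ z ∈ Z, HRel s (v ++ [z]) (u ++ [z])) → Sub s u Z v := by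
      rintro s a b u v Y hg rfl hz w hw
      obtain ⟨z, hzZ, w', rfl⟩ := hw.cases
      have hk : ∀ z ∈ Z, ∃ k, u = a ++ k ∧ v = b ++ k ∧ IsW M Y (k ++ [z]) := by
        intro z hzZ
        obtain ⟨w, hw, h1, h2⟩ := (hrel_el hg).1 (hz z hzZ)
        obtain ⟨k, c, rfl⟩ := (List.eq_nil_or_concat w).resolve_left hw.ne_nil
        rw [List.concat_eq_append] at *
        rw [← List.append_assoc] at h1 h2
        have h3 := List.append_inj' h1 rfl
        have h4 := List.append_inj' h2 rfl
        rw [(List.cons.inj h3.2).1]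
        exact ⟨k, h4.1, h3.1, hw⟩
      obtain ⟨k, h1, h2, -⟩ := hk z hzZ
      refine (sub_el_iff hg hZ.1).2 ⟨k, h1, h2, fun z' hz' => ?_⟩ _ hw
      obtain ⟨k', h3, -, h4⟩ := hk z' hz'
      rw [h1] at h3
      rwa [List.append_cancel_left h3]
    have hsub₁ := ext hg₁ hs fun z hz => (hn z hz).1
    have hsub₂ := ext hg₂ ht fun z hz => (hn z hz).2
    -- the intermediate idempotent lies below `f`, so that it is the end of a path
    have hfs : ∀ w, IsW M Z w → HRel f.val (n ++ w) (n ++ w) := by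
      intro w hw
      have h1 := hsub₁ w hw
      rw [← IdempotentSplitting.mul_val s] at h1
      obtain ⟨y, h2, h3⟩ := hrel_mul.1 h1
      rwa [h3.injective (hsub₁ w hw)] at h2
    have hng : Good M n Z n := good_self_of hZ fun z hz => by
      obtain ⟨p, q, h1, h2, h3⟩ := (hn z hz).1
      rw [← h1]
      exact p.2.2
    obtain ⟨J, hJ, rfl⟩ := exists_isPath_of_le hM hng ((idemLE_iff_sub hng).2 hfs)
    refine ⟨J, hJ, fun Y hY h1 => ?_, fun Y hY h1 => ?_⟩
    · rwa [cls_inj hM hY hZ h1]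
    · rwa [cls_inj hM hY hZ h1]
  · rintro ⟨J, hJ, h1, h2⟩ Y hY hYZ w hw
    exact hrel_mul.2 ⟨_, h2 Y hY hYZ w hw, h1 Y hY hYZ w hw⟩

include hM in
theorem res_id_iff {e : IdempotentSplitting (InverseHull M)}
    {L K : List (GraphLabel (hullReps M))} {b : DClass (InverseHull M)}
    (hL : IsPath (dClass e.val) L b) (hK : IsPath (dClass e.val) K b) :
    Res e e e.val L K b ↔ L = K := by
  obtain ⟨Z, hZ, rfl⟩ := (eq_zero_or_eq_cls hM b).resolve_left hL.ne_zero
  obtain ⟨X, h1, h2, h3⟩ := exists_val_eq hM e fun h0 => hL.start_ne_zero hM (by rw [h0])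
  constructor
  · intro h
    have h4 := h Z hZ rfl
    rw [h2, sub_el_iff h1 hZ.1] at h4
    obtain ⟨k, h5, h6, -⟩ := h4
    exact hL.unique hM hK ((List.append_cancel_left h5).trans (List.append_cancel_left h6).symm)
  · rintro rfl Y hY hYZ
    obtain ⟨h4, h5⟩ := hL.exists_good hM hY hYZ
    exact (idemLE_iff_sub h4).1 h5

/-- The morphisms `s` and `t` have corresponding restrictions. -/
def HomRel (D : DataIso M N) {e f : IdempotentSplitting (InverseHull M)}
    {e' f' : IdempotentSplitting (InverseHull N)} (s : e ⟶ f) (t : e' ⟶ f') : Prop :=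
  ∀ L K b, IsPath (dClass e.val) L b → IsPath (dClass f.val) K b →
    (Res e f s.1 L K b ↔ Res e' f' t.1 (L.map D.lab) (K.map D.lab) (D.cl b))

omit [Finite A] [Finite B] in
theorem DataIso.map_symm_map (D : DataIso M N) (L : List (GraphLabel (hullReps N))) :
    (L.map D.symm.lab).map D.lab = L := by
  rw [List.map_map]
  exact (List.map_congr_left fun x _ => D.lab.apply_symm_apply x).trans (List.map_id L)

/-- Corresponding objects: their classes correspond. -/
def ObjRel (D : DataIso M N) (e : IdempotentSplitting (InverseHull M))
    (e' : IdempotentSplitting (InverseHull N)) : Prop := dClass e'.val = D.cl (dClass e.val)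

section

variable {D : DataIso M N} {e f g : IdempotentSplitting (InverseHull M)}
  {e' f' g' : IdempotentSplitting (InverseHull N)} (he : ObjRel D e e') (hf : ObjRel D f f')
  (hg : ObjRel D g g')

include he in
omit [Finite A] [Finite B] in
theorem ObjRel.symm : ObjRel D.symm e' e := by
  change dClass e.val = D.cl.symm (dClass e'.val)
  rw [he, Equiv.symm_apply_apply]

include he in
omit [Finite A] [Finite B] in
theorem ObjRel.isPath_iff {L : List (GraphLabel (hullReps M))} {b : DClass (InverseHull M)} :
    IsPath (dClass e'.val) (L.map D.lab) (D.cl b) ↔ IsPath (dClass e.val) L b := by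
  rw [he]
  exact D.isPath_map_iff

include he hf in
omit [Finite A] [Finite B] in
theorem HomRel.symm {s : e ⟶ f} {t : e' ⟶ f'} (h : HomRel D s t) : HomRel D.symm t s := by
  intro L K b hL hK
  have h1 := h (L.map D.symm.lab) (K.map D.symm.lab) (D.symm.cl b)
    ((ObjRel.symm he).isPath_iff.2 hL) ((ObjRel.symm hf).isPath_iff.2 hK)
  rw [D.map_symm_map, D.map_symm_map] at h1
  change _ ↔ Res e' f' t.1 L K (D.cl (D.cl.symm b)) at h1
  rw [Equiv.apply_symm_apply] at h1
  exact h1.symm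

include hM hN he hf in
theorem exists_homRel (s : e ⟶ f) : ∃ t : e' ⟶ f', HomRel D s t := by
  rcases hom_cases hM s with hs | ⟨L, K, Z, hZ, hL, hK, hs⟩
  · refine ⟨homMk 0 (mul_zero _) (zero_mul _), fun L K b hL hK => ?_⟩
    rw [hs]
    exact iff_of_false (not_res_zero hM hL.ne_zero)
      (not_res_zero hN fun h => hL.ne_zero (D.eq_zero_iff.1 h))
  · obtain ⟨Z', hZ', h1⟩ := (eq_zero_or_eq_cls hN (D.cl (cls M Z))).resolve_left
      fun h => hL.ne_zero (D.eq_zero_iff.1 h)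
    have hL' := he.isPath_iff.2 hL
    have hK' := hf.isPath_iff.2 hK
    rw [h1] at hL' hK'
    obtain ⟨-, t, ht⟩ := exists_hom_of_isPath hN hZ' hL' hK'
    refine ⟨t, fun L₁ K₁ b hL₁ hK₁ => ?_⟩
    rw [hs, ht, res_el_iff hM hZ hL hK hL₁ hK₁,
      res_el_iff hN hZ' hL' hK' (he.isPath_iff.2 hL₁) (hf.isPath_iff.2 hK₁)]
    have hinj := List.map_injective_iff.2 D.lab.injective
    constructor
    · rintro ⟨J, hJ, rfl, rfl⟩
      refine ⟨J.map D.lab, ?_, List.map_append, List.map_append⟩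
      rw [← h1]
      exact D.isPath_map_iff.2 hJ
    · rintro ⟨J, hJ, h2, h3⟩
      rw [← D.map_symm_map J, ← List.map_append] at h2 h3
      refine ⟨_, ?_, hinj h2, hinj h3⟩
      rw [← D.isPath_map_iff, D.map_symm_map, h1]
      exact hJ

include hN he hf in
omit [Finite A] in
theorem HomRel.right_unique {s : e ⟶ f} {t t' : e' ⟶ f'} (h : HomRel D s t)
    (h' : HomRel D s t') : t = t' := by
  refine hom_eq_of_res hN fun L K b hL hK => ?_
  rw [HomRel.symm he hf h L K b hL hK, HomRel.symm he hf h' L K b hL hK]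

include hM hN hf in
theorem HomRel.comp {s : e ⟶ f} {s' : f ⟶ g} {t : e' ⟶ f'} {t' : f' ⟶ g'} (h : HomRel D s t)
    (h' : HomRel D s' t') : HomRel D (s ≫ s') (t ≫ t') := by
  intro L K b hL hK
  rw [IdempotentSplitting.comp_val, IdempotentSplitting.comp_val, res_mul_iff hM s s' hL.ne_zero,
    res_mul_iff hN t t' fun h => hL.ne_zero (D.eq_zero_iff.1 h)]
  constructor
  · rintro ⟨J, hJ, h1, h2⟩
    exact ⟨_, hf.isPath_iff.2 hJ, (h L J b hL hJ).1 h1, (h' J K b hJ hK).1 h2⟩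
  · rintro ⟨J, hJ, h1, h2⟩
    rw [← D.map_symm_map J] at hJ h1 h2
    have hJ' := hf.isPath_iff.1 hJ
    exact ⟨_, hJ', (h L _ b hL hJ').2 h1, (h' _ K b hJ' hK).2 h2⟩

include hM hN he in
theorem homRel_id : HomRel D (𝟙 e) (𝟙 e') := by
  intro L K b hL hK
  rw [IdempotentSplitting.id_val, IdempotentSplitting.id_val, res_id_iff hM hL hK,
    res_id_iff hN (he.isPath_iff.2 hL) (he.isPath_iff.2 hK),
    (List.map_injective_iff.2 D.lab.injective).eq_iff]

end

/-- The object with the corresponding class. -/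
noncomputable def DataIso.obj (D : DataIso M N) (e : IdempotentSplitting (InverseHull M)) :
    IdempotentSplitting (InverseHull N) :=
  ⟨rep (hullReps N) (D.cl (dClass e.val)), isIdempotentElem_rep hN _⟩

omit [Finite A] in
theorem DataIso.objRel (D : DataIso M N) (e : IdempotentSplitting (InverseHull M)) :
    ObjRel D e (D.obj hN e) := dClass_rep hN _

/-- The functor that sends a morphism to the one with the corresponding restrictions. -/
noncomputable def DataIso.functor (D : DataIso M N) :
    IdempotentSplitting (InverseHull M) ⥤ IdempotentSplitting (InverseHull N) where
  obj e := D.obj hN e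
  map {e f} s := (exists_homRel hM hN (D.objRel hN e) (D.objRel hN f) s).choose
  map_id e := HomRel.right_unique hN (D.objRel hN e) (D.objRel hN e)
    (exists_homRel hM hN (D.objRel hN e) (D.objRel hN e) (𝟙 e)).choose_spec
    (homRel_id hM hN (D.objRel hN e))
  map_comp {e f g} s t := HomRel.right_unique hN (D.objRel hN e) (D.objRel hN g)
    (exists_homRel hM hN (D.objRel hN e) (D.objRel hN g) (s ≫ t)).choose_spec
    (HomRel.comp hM hN (D.objRel hN f)
      (exists_homRel hM hN (D.objRel hN e) (D.objRel hN f) s).choose_spec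
      (exists_homRel hM hN (D.objRel hN f) (D.objRel hN g) t).choose_spec)

theorem DataIso.homRel_map (D : DataIso M N) {e f : IdempotentSplitting (InverseHull M)}
    (s : e ⟶ f) : HomRel D s ((D.functor hM hN).map s) :=
  (exists_homRel hM hN (D.objRel hN e) (D.objRel hN f) s).choose_spec

include hM hN in
/-- `D.symm` yields the inverse correspondence between morphisms, so the functor is full and
faithful; it is essentially surjective because it induces the bijection of classes. -/
theorem DataIso.moritaEquivalent (D : DataIso M N) :
    MoritaEquivalent (InverseHull M) (InverseHull N) := by
  have h1 : (D.functor hM hN).Faithful := ⟨fun {e f s t} h => by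
    have hs := (D.homRel_map hM hN s).symm (D.objRel hN e) (D.objRel hN f)
    have ht := (D.homRel_map hM hN t).symm (D.objRel hN e) (D.objRel hN f)
    rw [← h] at ht
    exact hs.right_unique hM (D.objRel hN e).symm (D.objRel hN f).symm ht⟩
  have h2 : (D.functor hM hN).Full := ⟨fun {e f} t => by
    obtain ⟨s, hs⟩ := exists_homRel hN hM (D.objRel hN e).symm (D.objRel hN f).symm t
    exact ⟨s, (D.homRel_map hM hN s).right_unique hN (D.objRel hN e) (D.objRel hN f)
      (hs.symm (D.objRel hN e).symm (D.objRel hN f).symm)⟩⟩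
  have h3 : (D.functor hM hN).EssSurj := ⟨fun e' => by
    obtain ⟨e, he⟩ := exists_dClass_val (D.cl.symm (dClass e'.val))
    refine ⟨e, nonempty_iso_of_greenD (dClass_eq_iff.1 ?_)⟩
    change dClass (D.obj hN e).val = _
    rw [D.objRel hN e, he, Equiv.apply_symm_apply]⟩
  have h4 : (D.functor hM hN).IsEquivalence := {}
  exact ⟨(D.functor hM hN).asEquivalence⟩

end Morita

end MarkovMorita

theorem mainTheorem2 {A B : Type*} [Finite A] [Finite B] (M : Matrix A A ℕ) (N : Matrix B B ℕ)
    (hM : MarkovMorita.IsMarkovTransitionMatrix M) (hN : MarkovMorita.IsMarkovTransitionMatrix N) :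
    List.TFAE [
      MarkovMorita.MoritaEquivalent (MarkovMorita.InverseHull M) (MarkovMorita.InverseHull N),
      ∃ π : MarkovMorita.combData (MarkovMorita.hullReps M) ≃
          MarkovMorita.combData (MarkovMorita.hullReps N),
        MarkovMorita.IsDClassPreservingIso π,
      ∃ π : (MarkovMorita.labelledGraph (MarkovMorita.hullReps M)).Iso
          (MarkovMorita.labelledGraph (MarkovMorita.hullReps N)),
        ∀ a b : MarkovMorita.Vertex (MarkovMorita.InverseHull M),
          MarkovMorita.Prec a.1 b.1 ↔ MarkovMorita.Prec (π.onV a).1 (π.onV b).1] := by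
  tfae_have 1 → 2 := fun h => by
    obtain ⟨D⟩ := MarkovMorita.nonempty_dataIso_of_moritaEquivalent hM hN h
    exact MarkovMorita.DataIso.exists_combData_iso hM hN D
  tfae_have 2 → 3 := fun h => by
    obtain ⟨D⟩ := MarkovMorita.nonempty_dataIso_of_combData hM hN h
    exact D.exists_labelledGraph_iso
  tfae_have 3 → 1 := fun h => by
    obtain ⟨D⟩ := MarkovMorita.nonempty_dataIso_of_labelledGraph hM hN h
    exact MarkovMorita.DataIso.moritaEquivalent hM hN D
  tfae_finish
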